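/- For a real number $t$ let $\mathcal A(t)=\{O,a_1^{\pm}(t),\dots,a_8^{\pm}(t)\}\subset\mathbb R^6$ be the configuration of $17$ labelled points with $O=0$, $$\begin{aligned} a_1^{\pm}(t)&=(\pm1,\pm t,0,0,\sqrt2,0), & a_5^{\pm}(t)&=(\pm1,\mp t,0,0,-\sqrt2,0),\\ a_2^{\pm}(t)&=(\mp t,\pm1,0,0,1,1), & a_6^{\pm}(t)&=(\pm t,\pm1,0,0,-1,-1),\\ a_3^{\pm}(t)&=(0,0,\pm1,\pm t,0,\sqrt2), & a_7^{\pm}(t)&=(0,0,\pm1,\mp t,0,-\sqrt2),\\ a_4^{\pm}(t)&=(0,0,\mp t,\pm1,-1,1), & a_8^{\pm}(t)&=(0,0,\pm t,\pm1,1,-1). \end{aligned}$$ Definitions. A triangulation of a configuration $\mathcal A$ is a collection $T$ of affinely independent and affinely spanning subsets (cells) of $\mathcal A$ such that any two cells intersect in a common face and the convex hulls of the cells cover $\operatorname{conv}(\mathcal A)$. An oriented circuit of $\mathcal A$ is a minimal affinely dependent subset $C=C_+\cup C_-$, where $C_+$ and $C_-$ consist of the points with positive, respectively negative, coefficient in an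 affine dependence; put $T^C_{\pm}=\{C\setminus\{c\}:c\in C_{\pm}\}$. If all $\tau\in T^C_+$ are faces of a triangulation $T$ and have the same link $L=\{\rho:\rho\cap\tau=\emptyset,\ \rho\cup\tau\in T\}$ in it, then replacing the cells $\rho\cup\tau$ ($\rho\in L$, $\tau\in T^C_+$) of $T$ by the cells $\rho\cup\tau$ ($\rho\in L$, $\tau\in T^C_-$) is a flip. The graph of triangulations of $\mathcal A$ has the triangulations of $\mathcal A$ as vertices and the flips as edges. A triangulation contains a simplicial complex $K$ on the same labels if every facet of $K$ is contained in one of its cells. A configuration $\mathcal A'$ of $17$ points in $\mathbb R^6$, labelled in the same way as $\mathcal A$, is a perturbation of $\mathcal A$ if every determinant of $7$ (homogenized) points that is non-zero in $\mathcal A$ has the same sign in $\mathcal A'$; it is in general position if no determinant of $7$ different points vanishes. Theorem. There is a triangulation $K$ of the boundary of $\operatorname{conv}(\mathcal A(0))$ such that (a) $K$ is induced on the boundary by some triangulation of $\mathcal A(0)$, (b) no flip in a triangulation of $\mathcal A(0)$ inducing $K$ on the boundary affects the boundary, and such that for every sufficiently small $t>0$ the following holds, where $K$ is regarded as a complex on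 the labels of the points. 1. There are triangulations of $\mathcal A(t)$ that contain $K$ (and there are triangulations of $\mathcal A(t)$ that do not). 2. If $T$ is a triangulation of $\mathcal A(t)$ containing $K$, then every triangulation obtained from $T$ by a flip contains $K$. In particular, the graph of triangulations of $\mathcal A(t)$ is not connected. 3. Statements 1 and 2 remain true if $\mathcal A(t)$ is replaced by an arbitrary perturbation $\mathcal A'$ of $\mathcal A(t)$ in general position. -/

import Mathlib

noncomputable section

namespace PointConfig

variable {ι : Type*} {d : ℕ}

/-- The convex hull of the points of the labelled configuration `A` with labels in `σ`. -/
def hull (A : ι → Fin d → ℝ) (σ : Finset ι) : Set (Fin d → ℝ) :=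
  convexHull ℝ (A '' (σ : Set ι))

/-- The points with labels in `σ` are affinely independent. -/
def Indep (A : ι → Fin d → ℝ) (σ : Finset ι) : Prop :=
  AffineIndependent ℝ (fun i : {i // i ∈ σ} => A i)

/-- `T` is a triangulation of `A`: its cells are affinely independent and affinely spanning subsets
of `A`, any two cells intersect in the common face spanned by their common vertices,
and the cells cover `conv A`. -/
structure IsTriangulation [DecidableEq ι] (A : ι → Fin d → ℝ) (T : Finset (Finset ι)) : Prop where
  indep : ∀ σ ∈ T, Indep A σ
  spanning : ∀ σ ∈ T, affineSpan ℝ (A '' (σ : Set ι)) = ⊤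
  inter : ∀ σ ∈ T, ∀ τ ∈ T, hull A σ ∩ hull A τ = hull A (σ ∩ τ)
  cover : (⋃ σ ∈ T, hull A σ) = convexHull ℝ (Set.range A)

/-- `(P, Q)` is an oriented circuit of `A`: the set `P ∪ Q` is minimally affinely dependent, and `P`
and `Q` are the sets of labels that have positive, respectively negative, coefficient
in an affine dependence supported on it. -/
structure IsCircuit [Fintype ι] [DecidableEq ι] (A : ι → Fin d → ℝ) (P Q : Finset ι) : Prop where
  dependent : ¬ Indep A (P ∪ Q)
  minimal : ∀ S, S ⊂ P ∪ Q → Indep A S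
  sign : ∃ w : ι → ℝ, ∑ i, w i = 0 ∧ ∑ i, w i • A i = 0 ∧
    (∀ i, 0 < w i ↔ i ∈ P) ∧ (∀ i, w i < 0 ↔ i ∈ Q)

/-- The triangulation `{C \ {c} : c ∈ P}` of a circuit `C = (P, Q)`.
The other triangulation of the circuit is `circuitTriangulation Q P`. -/
def circuitTriangulation [DecidableEq ι] (P Q : Finset ι) : Finset (Finset ι) :=
  P.image fun c => (P ∪ Q).erase c

/-- The link of `τ` in `T`: the sets `ρ` disjoint from `τ` such that `ρ ∪ τ` is a cell of `T`. -/
def link [Fintype ι] [DecidableEq ι] (T : Finset (Finset ι)) (τ : Finset ι) : Finset (Finset ι) :=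
  Finset.univ.filter fun ρ => Disjoint ρ τ ∧ ρ ∪ τ ∈ T

/-- The family of all `ρ ∪ τ` with `ρ ∈ L` and `τ ∈ S`. -/
def join [DecidableEq ι] (L S : Finset (Finset ι)) : Finset (Finset ι) :=
  (L ×ˢ S).image fun p => p.1 ∪ p.2

/-- `T₂` is obtained from `T₁` by a geometric bistellar flip: for some oriented circuit `(P, Q)`
all the simplices of `{C \ {c} : c ∈ P}` are faces of `T₁` and have there the same link `L`
(nonempty, since a set is a face of a cell of `T₁` exactly if its link is nonempty),
and their joins with `L` are replaced by those of the simplices of `{C \ {c} : c ∈ Q}`. -/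
def IsFlip [Fintype ι] [DecidableEq ι] (A : ι → Fin d → ℝ) (T₁ T₂ : Finset (Finset ι)) : Prop :=
  ∃ P Q : Finset ι, IsCircuit A P Q ∧
    ∃ L : Finset (Finset ι), L.Nonempty ∧
      (∀ τ ∈ circuitTriangulation P Q, link T₁ τ = L) ∧
      T₂ = (T₁ \ join L (circuitTriangulation P Q)) ∪ join L (circuitTriangulation Q P)

/-- The graph of flips of `A`: its vertices are the triangulations of `A`, its edges the flips. -/
def flipGraph [Fintype ι] [DecidableEq ι] (A : ι → Fin d → ℝ) :
    SimpleGraph {T : Finset (Finset ι) // IsTriangulation A T} :=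
  SimpleGraph.fromRel fun T₁ T₂ => IsFlip A T₁.1 T₂.1

/-- The determinant of `d + 1` points of `A`, homogenized by a coordinate `1`. -/
def orientDet (A : ι → Fin d → ℝ) (I : Fin (d + 1) → ι) : ℝ :=
  Matrix.det (Matrix.of fun k : Fin (d + 1) => (Fin.cons 1 (A (I k)) : Fin (d + 1) → ℝ))

/-- `A'` is a perturbation of `A`: every determinant of `d + 1` points that is not zero in `A`
keeps its sign in `A'`. -/
def IsPerturbation (A A' : ι → Fin d → ℝ) : Prop :=
  ∀ I : Fin (d + 1) → ι, orientDet A I ≠ 0 →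
    SignType.sign (orientDet A' I) = SignType.sign (orientDet A I)

/-- General position: no determinant of `d + 1` different points vanishes. -/
def InGeneralPosition (A : ι → Fin d → ℝ) : Prop :=
  ∀ I : Fin (d + 1) → ι, Function.Injective I → orientDet A I ≠ 0

/-- The simplicial complex with facets `K` is contained in the one with facets `T`. -/
def ContainsComplex (T K : Finset (Finset ι)) : Prop :=
  ∀ σ ∈ K, ∃ τ ∈ T, σ ⊆ τ

/-- `K` is (the set of facets of) a triangulation of the boundary of the `d`-polytope `conv A`. -/
structure IsBoundaryTriangulation [DecidableEq ι] (A : ι → Fin d → ℝ)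
    (K : Finset (Finset ι)) : Prop where
  card : ∀ σ ∈ K, σ.card = d
  indep : ∀ σ ∈ K, Indep A σ
  inter : ∀ σ ∈ K, ∀ τ ∈ K, hull A σ ∩ hull A τ = hull A (σ ∩ τ)
  cover : (⋃ σ ∈ K, hull A σ) = frontier (convexHull ℝ (Set.range A))

/-- `T` induces `K` on the boundary of `conv A`: the elements of `K` are exactly the
`(d - 1)`-dimensional faces of `T` that lie in the boundary. -/
def InducesOnBoundary (A : ι → Fin d → ℝ) (T K : Finset (Finset ι)) : Prop :=
  ∀ σ : Finset ι, σ ∈ K ↔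
    σ.card = d ∧ (∃ τ ∈ T, σ ⊆ τ) ∧ hull A σ ⊆ frontier (convexHull ℝ (Set.range A))

/-- `K` is a triangulation of the boundary of `conv A` that is induced by some triangulation of
`A`, and no flip in a triangulation of `A` inducing `K` affects the boundary. -/
structure IsFrozenBoundary [Fintype ι] [DecidableEq ι] (A : ι → Fin d → ℝ)
    (K : Finset (Finset ι)) : Prop where
  boundary : IsBoundaryTriangulation A K
  extends_to_interior : ∃ T, IsTriangulation A T ∧ InducesOnBoundary A T K
  frozen : ∀ T T', IsTriangulation A T → InducesOnBoundary A T K → IsFlip A T T' →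
    InducesOnBoundary A T' K

/-- Some triangulations of `A` contain the complex `K`, some do not, and every flip of a
triangulation that contains `K` yields a triangulation that contains `K`; the graph of flips of
`A` is not connected. -/
structure IsSeparatedBy [Fintype ι] [DecidableEq ι] (A : ι → Fin d → ℝ)
    (K : Finset (Finset ι)) : Prop where
  exists_containing : ∃ T, IsTriangulation A T ∧ ContainsComplex T K
  exists_not_containing : ∃ T, IsTriangulation A T ∧ ¬ ContainsComplex T K
  flip_containing : ∀ T T', IsTriangulation A T → ContainsComplex T K → IsFlip A T T' →
    ContainsComplex T' K
  not_connected : ¬ (flipGraph A).Preconnected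

/-- The coordinates of the `17` points `A(t)` in `ℝ⁶`, as columns in the order
`O, a₁⁺, …, a₈⁺, a₁⁻, …, a₈⁻` (the homogenizing row of ones is omitted). -/
def coords (t : ℝ) : Matrix (Fin 6) (Fin 17) ℝ :=
  let s := Real.sqrt 2
  !![0,  1, -t,  0,  0,  1,  t,  0,  0,   -1,  t,  0,  0, -1, -t,  0,  0;
     0,  t,  1,  0,  0, -t,  1,  0,  0,   -t, -1,  0,  0,  t, -1,  0,  0;
     0,  0,  0,  1, -t,  0,  0,  1,  t,    0,  0, -1,  t,  0,  0, -1, -t;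
     0,  0,  0,  t,  1,  0,  0, -t,  1,    0,  0, -t, -1,  0,  0,  t, -1;
     0,  s,  1,  0, -1, -s, -1,  0,  1,    s,  1,  0, -1, -s, -1,  0,  1;
     0,  0,  1,  s,  1,  0, -1, -s, -1,    0,  1,  s,  1,  0, -1, -s, -1]

/-- The configuration `A(t)`. -/
def config (t : ℝ) (j : Fin 17) : Fin 6 → ℝ := fun i => coords t i j

end PointConfig

end

open scoped Topology

namespace PointConfig

variable {ι : Type*} {d : ℕ}

/-! ### Barycentric coordinates -/

/-! At `t = 0` the points `a_i` and `a_{i+4}` of equal sign share their first four coordinates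
`±e_i`, while their last two coordinates are opposite vertices of an octagon. Hence, besides
simplicial facets, `conv A(0)` has facets with eight vertices, one in each of the 16 hyperplanes
`±x₁ ± x₂ ± x₃ ± x₄ = 1`. The complex `K` consists of the simplicial facets (`stableFacets`) and of
suitable triangulations of the others (`innerFacets`).

For small `t > 0` the simplicial facets stay facets, but every simplex `f` of `innerFacets` sinks
into the interior: the two other vertices of its eight-vertex facet come to lie strictly beyond it,
all remaining points strictly on the side of `O`. Coning `K` from `O` and filling the gap below the
new boundary with `outerCells` gives a triangulation containing `K`; coning the whole new boundary
gives one that does not.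

No flip destroys a simplex of `K`. For a facet of the hull, the circuit would have to lie in the
hyperplane of a simplex (`not_lost_of_isFacet`). If `f` in `innerFacets` is lost, with adjacent
cells `f ∪ {x}` and `f ∪ {y}`, then the circuit `(P, Q)` lies in `f ∪ {x, y}`, and all sets `f ∪ {x,
y} \ {c}` with `c ∈ P` must already be cells (`of_lost_wall`). But for every possible `x` and `y`
another simplex of `K` pierces one of these cells (`killOK_inner`, `crossing_false`). So the
simplices of `K` protect each other, and since flips are reversible the flip graph is disconnected.

All this depends only on signs of determinants. `chi` is the sign of the constant term or, if this
vanishes, of the `t`-derivative at `0`, computed exactly in `ℤ[√2]`. The arguments apply to every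
configuration with the nonzero signs prescribed by `chi` (`Realizes`), thus to `A(t)` for small `t >
0` and to all its perturbations at once.

That a list of simplices is a triangulation is reduced to a check of walls
(`isTriangulation_of_walls`): the number of cells containing a generic point is constant along
generic segments (`sum_weight_eq`), and it is one near a strictly supporting wall.

At `t = 0`, a flip that affects the boundary has its circuit in a supporting hyperplane. Simplicial
facets contain no circuits; in an eight-vertex facet there are four up to sign
(`IsCircuit.eq_of_inFacet`), and none has the equal links that a flip needs (`circuitOK_false`). -/

theorem affineMap_sum {E : Type*} [AddCommGroup E] [Module ℝ E] (f : E →ᵃ[ℝ] ℝ) (s : Finset ι)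
    (w : ι → ℝ) (p : ι → E) (hw : ∑ i ∈ s, w i = 1) :
    f (∑ i ∈ s, w i • p i) = ∑ i ∈ s, w i * f (p i) := by
  have h : ∀ x, f x = f.linear x + f 0 := fun x => by
    rw [AffineMap.decomp' f]; simp
  rw [h, map_sum]
  simp_rw [map_smul, smul_eq_mul, fun i => h (p i), mul_add, Finset.sum_add_distrib,
    ← Finset.sum_mul, hw, one_mul]

theorem affineMap_add_smul_sub {E : Type*} [AddCommGroup E] [Module ℝ E] (f : E →ᵃ[ℝ] ℝ)
    (x y : E) (s : ℝ) : f (x + s • (y - x)) = f x + s * (f y - f x) := by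
  have h : ∀ x, f x = f.linear x + f 0 := fun x => by
    rw [AffineMap.decomp' f]; simp
  rw [h, h x, h y]; simp; ring

theorem mem_hull_iff {A : ι → Fin d → ℝ} {σ : Finset ι} {x : Fin d → ℝ} :
    x ∈ hull A σ ↔
      ∃ w : ι → ℝ, (∀ i ∈ σ, 0 ≤ w i) ∧ ∑ i ∈ σ, w i = 1 ∧ ∑ i ∈ σ, w i • A i = x := by
  constructor
  · intro hx
    refine convexHull_min (t := {x | ∃ w : ι → ℝ, (∀ i ∈ σ, 0 ≤ w i) ∧ ∑ i ∈ σ, w i = 1 ∧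
      ∑ i ∈ σ, w i • A i = x}) ?_ ?_ hx
    · classical
      rintro _ ⟨i, hi, rfl⟩
      have hi' : i ∈ σ := hi
      refine ⟨Pi.single i 1, fun j _ => ?_, ?_, ?_⟩
      · by_cases h : j = i
        · subst h; simp
        · simp [h]
      · simp [Pi.single_apply, hi']
      · simp [Pi.single_apply, hi']
    · rintro x ⟨w, hw, hw1, rfl⟩ y ⟨v, hv, hv1, rfl⟩ a b ha hb hab
      refine ⟨fun i => a * w i + b * v i, fun i hi => ?_, ?_, ?_⟩
      · have := hw i hi; have := hv i hi; positivity
      · rw [Finset.sum_add_distrib, ← Finset.mul_sum, ← Finset.mul_sum, hw1, hv1]; linarith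
      · simp_rw [add_smul, mul_smul, Finset.sum_add_distrib, Finset.smul_sum]
  · rintro ⟨w, hw, hw1, rfl⟩
    exact (convex_convexHull ℝ _).sum_mem hw hw1
      fun i hi => subset_convexHull ℝ _ ⟨i, hi, rfl⟩

theorem isClosed_hull (A : ι → Fin d → ℝ) (σ : Finset ι) : IsClosed (hull A σ) :=
  ((σ.finite_toSet.image A).isCompact_convexHull (𝕜 := ℝ)).isClosed

theorem hull_mono (A : ι → Fin d → ℝ) {σ τ : Finset ι} (h : σ ⊆ τ) : hull A σ ⊆ hull A τ :=
  convexHull_mono (Set.image_mono (by exact_mod_cast h))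

theorem mem_hull_self (A : ι → Fin d → ℝ) {σ : Finset ι} {i : ι} (hi : i ∈ σ) :
    A i ∈ hull A σ := subset_convexHull ℝ _ ⟨i, hi, rfl⟩

theorem hull_subset_convexHull_range (A : ι → Fin d → ℝ) (σ : Finset ι) :
    hull A σ ⊆ convexHull ℝ (Set.range A) := convexHull_mono (Set.image_subset_range A _)

/-- The points with labels in `σ` are the vertices of a full-dimensional simplex. -/
def IsSimplex (A : ι → Fin d → ℝ) (σ : Finset ι) : Prop :=
  Indep A σ ∧ affineSpan ℝ (A '' (σ : Set ι)) = ⊤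

/-- The vertices of a simplex as an affine basis. -/
noncomputable def IsSimplex.basis {A : ι → Fin d → ℝ} {σ : Finset ι} (h : IsSimplex A σ) :
    AffineBasis {i // i ∈ σ} ℝ (Fin d → ℝ) :=
  ⟨fun i => A i, h.1, by
    rw [← h.2]; congr 1; ext x; simp⟩

open Classical in
/-- The barycentric coordinate with respect to the vertex `i` of the simplex `σ`. -/
noncomputable def coord (A : ι → Fin d → ℝ) (σ : Finset ι) (i : ι) : (Fin d → ℝ) →ᵃ[ℝ] ℝ :=
  if h : IsSimplex A σ ∧ i ∈ σ then h.1.basis.coord ⟨i, h.2⟩ else 0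

namespace IsSimplex

variable {A : ι → Fin d → ℝ} {σ : Finset ι}

theorem coord_eq (h : IsSimplex A σ) (i : {i // i ∈ σ}) :
    coord A σ i = h.basis.coord i := by
  rw [coord, dif_pos ⟨h, i.2⟩]

theorem card (h : IsSimplex A σ) : σ.card = d + 1 := by
  have := h.basis.card_eq_finrank_add_one
  simpa using this

theorem sum_coord (h : IsSimplex A σ) (x : Fin d → ℝ) : ∑ i ∈ σ, coord A σ i x = 1 := by
  rw [← Finset.sum_coe_sort]
  simp_rw [h.coord_eq]
  exact h.basis.sum_coord_apply_eq_one x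

theorem sum_coord_smul (h : IsSimplex A σ) (x : Fin d → ℝ) :
    ∑ i ∈ σ, coord A σ i x • A i = x := by
  rw [← Finset.sum_coe_sort]
  simp_rw [h.coord_eq]
  exact h.basis.linear_combination_coord_eq_self x

theorem coord_vertex [DecidableEq ι] (h : IsSimplex A σ) {i j : ι} (hi : i ∈ σ) (hj : j ∈ σ) :
    coord A σ i (A j) = if i = j then 1 else 0 := by
  have := h.basis.coord_apply ⟨i, hi⟩ ⟨j, hj⟩
  rw [← h.coord_eq, show h.basis ⟨j, hj⟩ = A j from rfl] at this
  simpa [Subtype.ext_iff] using this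

theorem coord_unique (h : IsSimplex A σ) {w : ι → ℝ} {x : Fin d → ℝ} (hw : ∑ i ∈ σ, w i = 1)
    (hx : ∑ i ∈ σ, w i • A i = x) {i : ι} (hi : i ∈ σ) : coord A σ i x = w i := by
  classical
  rw [← hx, affineMap_sum _ _ _ _ hw, Finset.sum_congr rfl
    (fun j hj => by rw [h.coord_vertex hi hj])]
  simp [hi]

/-- An affine function in barycentric coordinates. -/
theorem affineMap_apply (h : IsSimplex A σ) (f : (Fin d → ℝ) →ᵃ[ℝ] ℝ) (x : Fin d → ℝ) :
    f x = ∑ i ∈ σ, coord A σ i x * f (A i) := by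
  conv_lhs => rw [← h.sum_coord_smul x]
  exact affineMap_sum f σ _ _ (h.sum_coord x)

/-- Convex weights on `ρ`, extended by zero, are the barycentric coordinates in `σ`. Thus membership
in every face is read off in the coordinates of one simplex. -/
theorem mem_hull_of_subset (h : IsSimplex A σ) {ρ : Finset ι} (hρ : ρ ⊆ σ) {x : Fin d → ℝ} :
    x ∈ hull A ρ ↔ (∀ i ∈ σ, 0 ≤ coord A σ i x) ∧ ∀ i ∈ σ, i ∉ ρ → coord A σ i x = 0 := by
  classical
  rw [mem_hull_iff]
  constructor
  · rintro ⟨w, hw, hw1, hx⟩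
    have key : ∀ i ∈ σ, coord A σ i x = if i ∈ ρ then w i else 0 := fun i hi => by
      refine h.coord_unique (w := fun i => if i ∈ ρ then w i else 0) ?_ ?_ hi
      · rw [← Finset.sum_filter, Finset.filter_mem_eq_inter, Finset.inter_eq_right.2 hρ, hw1]
      · simp_rw [ite_smul, zero_smul]
        rw [← Finset.sum_filter, Finset.filter_mem_eq_inter, Finset.inter_eq_right.2 hρ, hx]
    refine ⟨fun i hi => ?_, fun i hi hiρ => by rw [key i hi, if_neg hiρ]⟩
    rw [key i hi]
    split_ifs with hiρ
    · exact hw i hiρ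
    · exact le_rfl
  · rintro ⟨h0, h1⟩
    refine ⟨fun i => coord A σ i x, fun i hi => h0 i (hρ hi), ?_, ?_⟩
    · rw [Finset.sum_subset hρ (fun i hi hiρ => h1 i hi hiρ), h.sum_coord]
    · rw [Finset.sum_subset hρ (fun i hi hiρ => by simp only [h1 i hi hiρ, zero_smul]),
        h.sum_coord_smul]

theorem mem_hull (h : IsSimplex A σ) {x : Fin d → ℝ} :
    x ∈ hull A σ ↔ ∀ i ∈ σ, 0 ≤ coord A σ i x := by
  rw [h.mem_hull_of_subset subset_rfl]
  exact ⟨fun h => h.1, fun h => ⟨h, fun i hi hi' => absurd hi hi'⟩⟩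

theorem continuous_coord (A : ι → Fin d → ℝ) (σ : Finset ι) (i : ι) :
    Continuous (coord A σ i) := (coord A σ i).continuous_of_finiteDimensional

theorem isOpen_coord_pos (A : ι → Fin d → ℝ) (σ : Finset ι) :
    IsOpen {x | ∀ i ∈ σ, 0 < coord A σ i x} := by
  simp only [Set.ofPred_forall]
  exact isOpen_biInter_finset
    fun i _ => isOpen_lt continuous_const (continuous_coord A σ i)

theorem nonempty (h : IsSimplex A σ) : σ.Nonempty := by
  rw [← Finset.card_pos, h.card]; omega

end IsSimplex

/-- The barycenter of the points with labels in `σ`. -/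
noncomputable def barycenter (A : ι → Fin d → ℝ) (σ : Finset ι) : Fin d → ℝ :=
  ∑ i ∈ σ, (σ.card : ℝ)⁻¹ • A i

theorem barycenter_weights {σ : Finset ι} (hσ : σ.Nonempty) :
    ∑ _i ∈ σ, (σ.card : ℝ)⁻¹ = 1 := by
  have : (σ.card : ℝ) ≠ 0 := by exact_mod_cast hσ.card_pos.ne'
  simp [this]

theorem affineMap_barycenter (f : (Fin d → ℝ) →ᵃ[ℝ] ℝ) (A : ι → Fin d → ℝ) {σ : Finset ι}
    (hσ : σ.Nonempty) : f (barycenter A σ) = (σ.card : ℝ)⁻¹ * ∑ i ∈ σ, f (A i) := by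
  rw [barycenter, affineMap_sum f σ _ _ (barycenter_weights hσ), Finset.mul_sum]

theorem barycenter_mem_hull (A : ι → Fin d → ℝ) {σ : Finset ι} (hσ : σ.Nonempty) :
    barycenter A σ ∈ hull A σ :=
  mem_hull_iff.2 ⟨fun _ => (σ.card : ℝ)⁻¹, fun _ _ => by positivity, barycenter_weights hσ, rfl⟩

theorem IsSimplex.coord_barycenter [DecidableEq ι] {A : ι → Fin d → ℝ} {σ ρ : Finset ι}
    (h : IsSimplex A σ) (hρ : ρ ⊆ σ) (hne : ρ.Nonempty) {i : ι} (hi : i ∈ σ) :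
    coord A σ i (barycenter A ρ) = if i ∈ ρ then (ρ.card : ℝ)⁻¹ else 0 := by
  rw [affineMap_barycenter _ _ hne, Finset.sum_congr rfl
    (fun j hj => h.coord_vertex hi (hρ hj))]
  simp

variable {ι : Type*} {d : ℕ}

/-! ### Counting cells along a generic segment -/

/-- Each function is nonzero on an open dense set: from a zero, a small step towards a point `p`
where it does not vanish leaves the zero set. One function at a time is absorbed into the open set.
-/
theorem exists_mem_forall_ne_zero {κ : Type*} (s : Finset κ) (g : κ → (Fin d → ℝ) →ᵃ[ℝ] ℝ)
    (hg : ∀ k ∈ s, ∃ p, g k p ≠ 0) {V : Set (Fin d → ℝ)} (hV : IsOpen V) (hne : V.Nonempty) :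
    ∃ z ∈ V, ∀ k ∈ s, g k z ≠ 0 := by
  classical
  induction s using Finset.induction_on generalizing V with
  | empty => obtain ⟨z, hz⟩ := hne; exact ⟨z, hz, by simp⟩
  | insert a s has ih =>
    have hcont : Continuous (g a) := (g a).continuous_of_finiteDimensional
    obtain ⟨z, hz, hzs⟩ := ih (fun k hk => hg k (Finset.mem_insert_of_mem hk))
      (hV.inter (isOpen_ne_fun hcont continuous_const)) (by
        obtain ⟨x, hx⟩ := hne
        obtain ⟨p, hp⟩ := hg a (Finset.mem_insert_self _ _)
        by_cases h0 : g a x = 0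
        · have ht : Filter.Tendsto (fun ε : ℝ => x + ε • (p - x)) (𝓝[>] 0) (𝓝 x) := by
            have : Continuous fun ε : ℝ => x + ε • (p - x) := by fun_prop
            simpa using (this.tendsto 0).mono_left nhdsWithin_le_nhds
          obtain ⟨ε, hε, hεV⟩ := ((ht.eventually (hV.mem_nhds hx)).and
            self_mem_nhdsWithin).exists
          refine ⟨_, hε, ?_⟩
          have : g a (x + ε • (p - x)) = ε * g a p := by
            rw [affineMap_add_smul_sub, h0]; ring
          show g a (x + ε • (p - x)) ≠ 0
          rw [this]
          exact mul_ne_zero (ne_of_gt hεV) hp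
        · exact ⟨x, hx, h0⟩)
    refine ⟨z, hz.1, fun k hk => ?_⟩
    rcases Finset.mem_insert.1 hk with rfl | hk
    · exact hz.2
    · exact hzs k hk

/-- The point `z` lies on no wall of a cell of `T`, and the segment from `y` to `z` meets no
intersection of two walls of a cell. -/
def IsGenericFrom (A : ι → Fin d → ℝ) (T : Finset (Finset ι)) (y z : Fin d → ℝ) : Prop :=
  ∀ σ ∈ T, ∀ v ∈ σ, coord A σ v z ≠ 0 ∧
    ∀ v' ∈ σ, v ≠ v' → coord A σ v y * coord A σ v' z ≠ coord A σ v' y * coord A σ v z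

/-- Genericity excludes the zeros of finitely many affine functions. None of them vanishes
identically: the function for two walls `v ≠ v'` takes the value `-coord A σ v' y ≠ 0` at the vertex
`v`. Two starting points are treated simultaneously. -/
theorem exists_isGenericFrom [Fintype ι] {A : ι → Fin d → ℝ}
    {T : Finset (Finset ι)} (hT : ∀ σ ∈ T, IsSimplex A σ) {y : Bool → Fin d → ℝ}
    (hy : ∀ b, ∀ σ ∈ T, ∀ v ∈ σ, coord A σ v (y b) ≠ 0) {V : Set (Fin d → ℝ)} (hV : IsOpen V)
    (hne : V.Nonempty) : ∃ z ∈ V, ∀ b, IsGenericFrom A T (y b) z := by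
  classical
  set S := ((Finset.univ : Finset Bool) ×ˢ T ×ˢ (Finset.univ : Finset (ι × ι))).filter
    fun k => k.2.2.1 ∈ k.2.1 ∧ k.2.2.2 ∈ k.2.1 with hS
  set g : Bool × Finset ι × ι × ι → (Fin d → ℝ) →ᵃ[ℝ] ℝ := fun k =>
    if k.2.2.1 = k.2.2.2 then coord A k.2.1 k.2.2.1 else
      coord A k.2.1 k.2.2.1 (y k.1) • coord A k.2.1 k.2.2.2 -
        coord A k.2.1 k.2.2.2 (y k.1) • coord A k.2.1 k.2.2.1 with hgdef
  have hg : ∀ k ∈ S, ∃ p, g k p ≠ 0 := by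
    rintro ⟨b, σ, v, v'⟩ hk
    simp only [hS, Finset.mem_filter, Finset.mem_product, Finset.mem_univ, true_and,
      and_true] at hk
    obtain ⟨hσ, hv, hv'⟩ := hk
    refine ⟨A v, ?_⟩
    simp only [hgdef]
    split_ifs with hvv
    · rw [(hT σ hσ).coord_vertex hv hv]; simp
    · have h1 := (hT σ hσ).coord_vertex hv hv
      have h2 := (hT σ hσ).coord_vertex hv' hv
      rw [if_pos rfl] at h1
      rw [if_neg (Ne.symm hvv)] at h2
      simpa [h1, h2] using hy b σ hσ v' hv'
  obtain ⟨z, hz, h⟩ := exists_mem_forall_ne_zero S g hg hV hne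
  refine ⟨z, hz, fun b σ hσ v hv => ⟨?_, fun v' hv' hne => ?_⟩⟩
  · have := h (b, σ, v, v) (by simp [hS, hσ, hv])
    simpa [hgdef] using this
  · have := h (b, σ, v, v') (by simp [hS, hσ, hv, hv'])
    simp only [hgdef, if_neg hne] at this
    intro heq
    apply this
    simp [heq]

/-! ### Coordinates in two simplices with a common wall -/

section Exchange

variable [DecidableEq ι] {A : ι → Fin d → ℝ} {σ : Finset ι} {u v : ι}

/-- Both coordinates vanish on the common wall, so they are proportional; the factor is found by
evaluating at `u`. -/
theorem coord_eq_mul_coord_exchange (hσ : IsSimplex A σ)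
    (hσ' : IsSimplex A (insert u (σ.erase v))) (hv : v ∈ σ) (hu : u ∉ σ) (x : Fin d → ℝ) :
    coord A σ v x = coord A (insert u (σ.erase v)) u x * coord A σ v (A u) := by
  rw [hσ'.affineMap_apply (coord A σ v) x,
    Finset.sum_insert (fun h => hu (Finset.mem_of_mem_erase h)), Finset.sum_eq_zero, add_zero]
  intro i hi
  rw [hσ.coord_vertex hv (Finset.mem_of_mem_erase hi), if_neg (Finset.ne_of_mem_erase hi).symm,
    mul_zero]

/-- In particular the two simplices assign the same coordinates to a point on the common wall, where
the coordinate of `u` is zero. -/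
theorem coord_eq_coord_exchange_add (hσ : IsSimplex A σ)
    (hσ' : IsSimplex A (insert u (σ.erase v))) (hu : u ∉ σ) {i : ι}
    (hi : i ∈ σ.erase v) (x : Fin d → ℝ) :
    coord A σ i x = coord A (insert u (σ.erase v)) i x +
      coord A (insert u (σ.erase v)) u x * coord A σ i (A u) := by
  rw [hσ'.affineMap_apply (coord A σ i) x,
    Finset.sum_insert (fun h => hu (Finset.mem_of_mem_erase h)), add_comm]
  congr 1
  rw [Finset.sum_congr rfl (fun j hj => by
    rw [hσ.coord_vertex (Finset.mem_of_mem_erase hi) (Finset.mem_of_mem_erase hj)])]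
  simp only [mul_ite, mul_one, mul_zero, Finset.sum_ite_eq, hi, if_true]

end Exchange

/-- The wall of `σ` opposite to `v` belongs to exactly one other cell of `T`, which lies on
the other side. -/
def HasNeighbor [DecidableEq ι] (A : ι → Fin d → ℝ) (T : Finset (Finset ι)) (σ : Finset ι)
    (v u : ι) : Prop :=
  u ∉ σ ∧ insert u (σ.erase v) ∈ T ∧ coord A σ v (A u) < 0 ∧
    ∀ τ ∈ T, σ.erase v ⊆ τ → τ = σ ∨ τ = insert u (σ.erase v)

open Classical in
/-- A weighted count of the cells containing a point does not change along a generic segment, if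
the weights agree across the walls that it may meet. -/
theorem sum_weight_eq [DecidableEq ι] {A : ι → Fin d → ℝ}
    {T : Finset (Finset ι)} (hT : ∀ σ ∈ T, IsSimplex A σ) {V : Set (Fin d → ℝ)}
    (hV : Convex ℝ V) (ω : Finset ι → ℤ)
    (hwall : ∀ σ ∈ T, ∀ v ∈ σ, ∀ x ∈ V, coord A σ v x = 0 →
      (∀ i ∈ σ, i ≠ v → 0 < coord A σ i x) →
      ∃ u, HasNeighbor A T σ v u ∧ ω (insert u (σ.erase v)) = ω σ)
    {y z : Fin d → ℝ} (hyV : y ∈ V) (hzV : z ∈ V)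
    (hy : ∀ σ ∈ T, ∀ v ∈ σ, coord A σ v y ≠ 0) (hz : IsGenericFrom A T y z) :
    ∑ σ ∈ T, (if y ∈ hull A σ then ω σ else 0) =
      ∑ σ ∈ T, (if z ∈ hull A σ then ω σ else 0) := by
  set c : Finset ι → ι → ℝ → ℝ := fun σ i s =>
    coord A σ i y + s * (coord A σ i z - coord A σ i y) with hc
  have hcγ : ∀ σ i s, coord A σ i (y + s • (z - y)) = c σ i s := fun σ i s =>
    affineMap_add_smul_sub _ _ _ _
  have hcc : ∀ σ i, Continuous (c σ i) := fun σ i => by simp only [hc]; fun_prop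
  -- Half-open membership: a point on a wall counts as belonging to the cell that the motion is
  -- entering, so that a crossing is counted exactly once.
  set mem : Finset ι → ℝ → Prop := fun σ s =>
    ∀ i ∈ σ, 0 < c σ i s ∨ (c σ i s = 0 ∧ 0 < coord A σ i z - coord A σ i y) with hmem
  set h : ℝ → ℤ := fun s => ∑ σ ∈ T, if mem σ s then ω σ else 0 with hh
  have h0 : h 0 = ∑ σ ∈ T, (if y ∈ hull A σ then ω σ else 0) := by
    refine Finset.sum_congr rfl fun σ hσ => ?_
    have : mem σ 0 ↔ y ∈ hull A σ := by
      rw [(hT σ hσ).mem_hull]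
      refine forall₂_congr fun i hi => ?_
      have hne := hy σ hσ i hi
      simp only [hc, zero_mul, add_zero, hne, false_and, or_false]
      exact ⟨le_of_lt, fun h => lt_of_le_of_ne h hne.symm⟩
    simp only [this]
  have h1 : h 1 = ∑ σ ∈ T, (if z ∈ hull A σ then ω σ else 0) := by
    refine Finset.sum_congr rfl fun σ hσ => ?_
    have : mem σ 1 ↔ z ∈ hull A σ := by
      rw [(hT σ hσ).mem_hull]
      refine forall₂_congr fun i hi => ?_
      have hne := (hz σ hσ i hi).1
      simp only [hc, one_mul, add_sub_cancel, hne, false_and, or_false]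
      exact ⟨le_of_lt, fun h => lt_of_le_of_ne h hne.symm⟩
    simp only [this]
  have hloc : ∀ s ∈ Set.Icc (0 : ℝ) 1, ∀ᶠ s' in 𝓝 s, h s' = h s := by
    intro s hs
    have hγV : y + s • (z - y) ∈ V := by
      have := hV.add_smul_sub_mem hyV hzV hs
      simpa using this
    -- `γ s` lies in the relative interior of the wall of `σ` opposite to `v`
    set W : Finset ι → ι → Prop := fun σ v =>
      v ∈ σ ∧ c σ v s = 0 ∧ ∀ i ∈ σ, i ≠ v → 0 < c σ i s with hW
    have hWuniq : ∀ σ v v', W σ v → W σ v' → v = v' := by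
      rintro σ v v' ⟨hv, hv0, hvp⟩ ⟨hv', hv0', -⟩
      by_contra hne
      exact (hvp v' hv' (Ne.symm hne)).ne' hv0'
    have htri : ∀ σ ∈ T, (∃ i ∈ σ, c σ i s < 0) ∨ (∀ i ∈ σ, 0 < c σ i s) ∨ ∃ v, W σ v := by
      intro σ hσ
      by_cases hneg : ∃ i ∈ σ, c σ i s < 0
      · exact Or.inl hneg
      push Not at hneg
      by_cases hpos : ∀ i ∈ σ, 0 < c σ i s
      · exact Or.inr (Or.inl hpos)
      push Not at hpos
      obtain ⟨v, hv, hv0⟩ := hpos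
      have hv0 : c σ v s = 0 := le_antisymm hv0 (hneg v hv)
      refine Or.inr (Or.inr ⟨v, hv, hv0, fun i hi hiv => ?_⟩)
      refine lt_of_le_of_ne (hneg i hi) fun hi0 => ?_
      -- Two coordinates vanishing at the same parameter `s` are excluded by genericity; eliminating
      -- `s ≠ 0` gives the forbidden proportion.
      refine (hz σ hσ v hv).2 i hi hiv.symm ?_
      have hs0 : s ≠ 0 := by
        rintro rfl
        exact hy σ hσ v hv (by simpa [hc] using hv0)
      simp only [hc] at hv0 hi0
      apply mul_left_cancel₀ hs0
      linear_combination (coord A σ i y) * (-hv0) - (coord A σ v y) * hi0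
    set N : Finset ι → Finset ι → Prop := fun σ τ => ∃ v u, W σ v ∧ HasNeighbor A T σ v u ∧
      ω τ = ω σ ∧ τ = insert u (σ.erase v) with hN
    have hNuniq : ∀ σ τ τ', N σ τ → N σ τ' → τ' = τ := by
      rintro σ _ _ ⟨v, u, hv, hvu, -, rfl⟩ ⟨v', u', hv', hvu', -, rfl⟩
      obtain rfl := hWuniq σ v v' hv hv'
      rcases hvu.2.2.2 _ hvu'.2.1 (Finset.subset_insert _ _) with h | h
      · exact absurd (h ▸ Finset.mem_insert_self _ _) hvu'.1
      · exact h
    have hNne : ∀ σ τ, N σ τ → τ ≠ σ := by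
      rintro σ _ ⟨v, u, -, hvu, -, rfl⟩ h
      exact hvu.1 (h ▸ Finset.mem_insert_self _ _)
    have hNT : ∀ σ τ, N σ τ → τ ∈ T := by
      rintro σ _ ⟨v, u, -, hvu, -, rfl⟩; exact hvu.2.1
    have hWex : ∀ σ ∈ T, ∀ v, W σ v → ∃ τ, N σ τ := by
      intro σ hσ v hv
      obtain ⟨u, hu, hω⟩ := hwall σ hσ v hv.1 _ hγV (by rw [hcγ]; exact hv.2.1)
        (fun i hi hiv => by rw [hcγ]; exact hv.2.2 i hi hiv)
      exact ⟨_, v, u, hv, hu, hω, rfl⟩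
    have herase : ∀ (σ : Finset ι) (v u : ι), u ∉ σ → (insert u (σ.erase v)).erase u = σ.erase v := fun σ v u hu =>
      Finset.erase_insert (fun h => hu (Finset.mem_of_mem_erase h))
    have hWN : ∀ σ ∈ T, ∀ v u, W σ v → HasNeighbor A T σ v u → W (insert u (σ.erase v)) u := by
      intro σ hσ v u hv hu
      have hσ' := hT _ hu.2.1
      have h0 : c (insert u (σ.erase v)) u s = 0 := by
        have := coord_eq_mul_coord_exchange (hT σ hσ) hσ' hv.1 hu.1 (y + s • (z - y))
        rw [hcγ, hcγ, hv.2.1] at this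
        exact (mul_eq_zero.1 this.symm).resolve_right hu.2.2.1.ne
      refine ⟨Finset.mem_insert_self _ _, h0, fun i hi hiu => ?_⟩
      have hi' := Finset.mem_of_mem_insert_of_ne hi hiu
      have := coord_eq_coord_exchange_add (hT σ hσ) hσ' hu.1 hi' (y + s • (z - y))
      rw [hcγ, hcγ, hcγ, h0, zero_mul, add_zero] at this
      rw [← this]
      exact hv.2.2 i (Finset.mem_of_mem_erase hi') (Finset.ne_of_mem_erase hi')
    have hNsymm : ∀ σ ∈ T, ∀ τ, N σ τ → N τ σ := by
      rintro σ hσ _ ⟨v, u, hv, hu, -, rfl⟩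
      have hW' := hWN σ hσ v u hv hu
      obtain ⟨τ, hτ⟩ := hWex _ hu.2.1 u hW'
      have hτ' := hτ
      obtain ⟨v', u', hv', hvu', -, rfl⟩ := hτ
      obtain rfl := hWuniq _ _ _ hW' hv'
      rcases hvu'.2.2.2 σ hσ (by rw [herase _ _ _ hu.1]; exact Finset.erase_subset _ _) with h | h
      · exact absurd (h ▸ Finset.mem_insert_self _ _) hu.1
      · rw [← h] at hτ'; exact hτ'
    have hmemW : ∀ σ v, W σ v → ∀ᶠ s' in 𝓝 s,
        (mem σ s' ↔ 0 < c σ v s' ∨ (c σ v s' = 0 ∧ 0 < coord A σ v z - coord A σ v y)) := by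
      intro σ v hv
      have : ∀ᶠ s' in 𝓝 s, ∀ i ∈ σ, i ≠ v → 0 < c σ i s' := by
        rw [Filter.eventually_all_finset]
        intro i hi
        by_cases hiv : i = v
        · simp [hiv]
        · filter_upwards [(hcc σ i).continuousAt.eventually (lt_mem_nhds (hv.2.2 i hi hiv))]
            with s' hs' _ using hs'
      filter_upwards [this] with s' hs'
      refine ⟨fun hm => hm v hv.1, fun hm i hi => ?_⟩
      by_cases hiv : i = v
      · subst hiv; exact hm
      · exact Or.inl (hs' i hi hiv)
    -- The coordinates of adjacent cells at the common wall differ by a negative factor, so near `s`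
    -- the moving point is in exactly one of the two half-open cells.
    have hxor : ∀ σ ∈ T, ∀ τ, N σ τ → ∀ᶠ s' in 𝓝 s, (mem τ s' ↔ ¬ mem σ s') := by
      rintro σ hσ _ ⟨v, u, hv, hu, -, rfl⟩
      filter_upwards [hmemW σ v hv, hmemW _ u (hWN σ hσ v u hv hu)] with s' h1 h2
      rw [h1, h2]
      have hex := coord_eq_mul_coord_exchange (hT σ hσ) (hT _ hu.2.1) hv.1 hu.1
      have e1 : c σ v s' = c (insert u (σ.erase v)) u s' * coord A σ v (A u) := by
        rw [← hcγ, ← hcγ]; exact hex _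
      have e2 : coord A σ v z - coord A σ v y = (coord A (insert u (σ.erase v)) u z -
          coord A (insert u (σ.erase v)) u y) * coord A σ v (A u) := by
        rw [hex z, hex y]; ring
      have hκ := hu.2.2.1
      -- With slope zero the coordinate of `v` would be constant along the segment, hence zero
      -- already at `y`.
      have hslope : coord A (insert u (σ.erase v)) u z -
          coord A (insert u (σ.erase v)) u y ≠ 0 := by
        intro hsl
        rw [hsl, zero_mul] at e2
        have := hv.2.1
        simp only [hc, e2, mul_zero, add_zero] at this
        exact hy σ hσ v hv.1 this
      rw [e1, e2]
      have hm : ∀ x : ℝ, 0 < x * coord A σ v (A u) ↔ x < 0 := fun x => by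
        constructor
        · intro h; by_contra hx; push Not at hx; nlinarith
        · intro h; nlinarith
      rw [hm, hm, mul_eq_zero, or_iff_left hκ.ne]
      rcases lt_trichotomy (c (insert u (σ.erase v)) u s') 0 with h | h | h
      · simp [h, h.not_gt, h.ne]
      · simp only [h, lt_irrefl, true_and, false_or, not_lt]
        exact ⟨le_of_lt, fun h => lt_of_le_of_ne h hslope.symm⟩
      · simp [h, h.not_gt, h.ne']
    set D : Finset ι → ℝ → ℤ := fun σ s' =>
      (if mem σ s' then ω σ else 0) - (if mem σ s then ω σ else 0) with hD
    have hDN : ∀ σ ∈ T, ∀ᶠ s' in 𝓝 s, ∀ τ ∈ T, N σ τ → D σ s' + D τ s' = 0 := by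
      intro σ hσ
      rw [Filter.eventually_all_finset]
      intro τ _
      by_cases hστ : N σ τ
      · have hs := (hxor σ hσ τ hστ).self_of_nhds
        filter_upwards [hxor σ hσ τ hστ] with s' hs' _
        obtain ⟨v, u, -, -, hω, -⟩ := hστ
        simp only [hD, hs, hs', hω]
        by_cases h1 : mem σ s <;> by_cases h2 : mem σ s' <;> simp [h1, h2]
      · simp [hστ]
    have hD0 : ∀ σ ∈ T, ∀ᶠ s' in 𝓝 s, (¬ ∃ τ, N σ τ) → D σ s' = 0 := by
      intro σ hσ
      rcases htri σ hσ with ⟨i, hi, hneg⟩ | hpos | ⟨v, hv⟩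
      · have hn : ∀ s', c σ i s' < 0 → ¬ mem σ s' := fun s' hs' hm => by
          rcases hm i hi with h | h
          · exact h.not_gt hs'
          · exact hs'.ne h.1
        filter_upwards [(hcc σ i).continuousAt.eventually (gt_mem_nhds hneg)] with s' hs' _
        simp [hD, hn s' hs', hn s hneg]
      · have : ∀ᶠ s' in 𝓝 s, ∀ i ∈ σ, 0 < c σ i s' := by
          rw [Filter.eventually_all_finset]
          exact fun i hi => (hcc σ i).continuousAt.eventually (lt_mem_nhds (hpos i hi))
        filter_upwards [this] with s' hs' _
        have m1 : mem σ s' := fun i hi => Or.inl (hs' i hi)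
        have m2 : mem σ s := fun i hi => Or.inl (hpos i hi)
        simp [hD, m1, m2]
      · exact Filter.Eventually.of_forall fun _ h => absurd (hWex σ hσ v hv) h
    filter_upwards [(Filter.eventually_all_finset T).2 hDN,
      (Filter.eventually_all_finset T).2 hD0] with s' hs1 hs2
    rw [← sub_eq_zero, hh]
    simp only
    rw [← Finset.sum_sub_distrib]
    -- The change of the sum cancels in pairs: a cell that is left is matched with its neighbor of
    -- equal weight that is entered, and a cell with no wall being met contributes no change.
    refine Finset.sum_involution (fun σ _ => if hσ : ∃ τ, N σ τ then hσ.choose else σ)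
      ?_ ?_ ?_ ?_
    · intro σ hσ
      by_cases hex : ∃ τ, N σ τ
      · simp only [dif_pos hex]
        exact hs1 σ hσ _ (hNT _ _ hex.choose_spec) hex.choose_spec
      · have := hs2 σ hσ hex
        simp only [dif_neg hex]
        simp only [hD] at this
        rw [this, add_zero]
    · intro σ hσ hne
      by_cases hex : ∃ τ, N σ τ
      · simp only [dif_pos hex]
        exact hNne _ _ hex.choose_spec
      · exact absurd (hs2 σ hσ hex) hne
    · intro σ hσ
      by_cases hex : ∃ τ, N σ τ
      · simp only [dif_pos hex]
        exact hNT _ _ hex.choose_spec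
      · simpa only [dif_neg hex] using hσ
    · intro σ hσ
      by_cases hex : ∃ τ, N σ τ
      · have hback := hNsymm σ hσ _ hex.choose_spec
        have hex' : ∃ τ, N hex.choose τ := ⟨σ, hback⟩
        simp only [dif_pos hex, dif_pos hex']
        exact hNuniq _ _ _ hback hex'.choose_spec
      · simp [hex]
  rw [← h0, ← h1]
  refine isPreconnected_Icc.constant (s := Set.Icc (0 : ℝ) 1) (fun s hs => ?_)
    (by simp) (by simp)
  exact (continuousAt_const.congr (Filter.EventuallyEq.symm (hloc s hs))).continuousWithinAt

variable {ι : Type*} {d : ℕ}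

/-! ### A local criterion for triangulations -/

/-- The points strictly on the inner side of all walls of cells of `T` that support `conv A`. -/
def innerRegion (A : ι → Fin d → ℝ) (T : Finset (Finset ι)) : Set (Fin d → ℝ) :=
  {x | ∀ σ ∈ T, ∀ v ∈ σ, (∀ j, 0 ≤ coord A σ v (A j)) → 0 < coord A σ v x}

theorem affineMap_nonneg_of_mem_convexHull {A : ι → Fin d → ℝ} (f : (Fin d → ℝ) →ᵃ[ℝ] ℝ)
    (hf : ∀ j, 0 ≤ f (A j)) {x : Fin d → ℝ} (hx : x ∈ convexHull ℝ (Set.range A)) : 0 ≤ f x := by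
  have hc : Convex ℝ {x | 0 ≤ f x} := (convex_Ici (0 : ℝ)).affine_preimage f
  exact convexHull_min (by rintro _ ⟨j, rfl⟩; exact hf j) hc hx

theorem convex_innerRegion (A : ι → Fin d → ℝ) (T : Finset (Finset ι)) :
    Convex ℝ (innerRegion A T) := by
  simp only [innerRegion, Set.ofPred_forall]
  refine convex_iInter fun σ => convex_iInter fun _ => convex_iInter fun v =>
    convex_iInter fun _ => convex_iInter fun _ => ?_
  exact (convex_Ioi (0 : ℝ)).affine_preimage (coord A σ v)

theorem isOpen_innerRegion (A : ι → Fin d → ℝ) (T : Finset (Finset ι)) :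
    IsOpen (innerRegion A T) := by
  simp only [innerRegion, Set.ofPred_forall]
  refine isOpen_biInter_finset fun σ _ => isOpen_biInter_finset fun v _ => ?_
  exact isOpen_iInter_of_finite
    fun _ => isOpen_lt continuous_const (IsSimplex.continuous_coord A σ v)

/-- A supporting coordinate that is zero at the barycenter is zero at all vertices of `σ`. These
affinely span the space, but the coordinate is `1` at its own vertex. -/
theorem barycenter_mem_innerRegion {A : ι → Fin d → ℝ} {T : Finset (Finset ι)}
    (hT : ∀ σ ∈ T, IsSimplex A σ) {σ : Finset ι} (hσ : σ ∈ T) :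
    barycenter A σ ∈ innerRegion A T := by
  classical
  intro κ hκ w hw hpos
  have hne := (hT σ hσ).nonempty
  rw [affineMap_barycenter _ _ hne]
  refine mul_pos (inv_pos.2 (by exact_mod_cast hne.card_pos)) ?_
  refine lt_of_le_of_ne (Finset.sum_nonneg fun i _ => hpos i) fun h0 => ?_
  have hz := (Finset.sum_eq_zero_iff_of_nonneg (fun i _ => hpos i)).1 h0.symm
  have h1 := (hT κ hκ).coord_vertex hw hw
  rw [(hT σ hσ).affineMap_apply, Finset.sum_eq_zero (fun i hi => by rw [hz i hi, mul_zero])] at h1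
  simp at h1

/-- Each supporting coordinate is nonnegative at `x` and positive at `q`, hence positive after any
positive step from `x` towards `q`. -/
theorem add_smul_sub_mem_innerRegion {A : ι → Fin d → ℝ} {T : Finset (Finset ι)}
    {x q : Fin d → ℝ} (hx : x ∈ convexHull ℝ (Set.range A)) (hq : q ∈ innerRegion A T) {ε : ℝ}
    (hε : 0 < ε) (hε1 : ε ≤ 1) : x + ε • (q - x) ∈ innerRegion A T := by
  intro σ hσ v hv hpos
  have h1 := affineMap_nonneg_of_mem_convexHull _ hpos hx
  have h2 := hq σ hσ v hv hpos
  rw [affineMap_add_smul_sub]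
  nlinarith

theorem tendsto_add_smul_sub (x q : Fin d → ℝ) :
    Filter.Tendsto (fun ε : ℝ => x + ε • (q - x)) (𝓝[>] 0) (𝓝 x) := by
  have : Continuous fun ε : ℝ => x + ε • (q - x) := by fun_prop
  simpa using (this.tendsto 0).mono_left nhdsWithin_le_nhds

theorem eventually_mem_Ioc : ∀ᶠ ε : ℝ in 𝓝[>] 0, 0 < ε ∧ ε ≤ 1 := by
  filter_upwards [Ioc_mem_nhdsGT (zero_lt_one' ℝ)] with ε hε using hε

/-- Near a point of a cell there are interior points of this cell in the inner region. -/
theorem nonempty_inter_interior [DecidableEq ι] {A : ι → Fin d → ℝ} {T : Finset (Finset ι)}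
    (hT : ∀ σ ∈ T, IsSimplex A σ) {σ : Finset ι} (hσ : σ ∈ T) {x : Fin d → ℝ}
    (hx : x ∈ hull A σ) {V : Set (Fin d → ℝ)} (hV : V ∈ 𝓝 x) :
    ((V ∩ innerRegion A T) ∩ {x | ∀ i ∈ σ, 0 < coord A σ i x}).Nonempty := by
  obtain ⟨ε, hεV, hε, hε1⟩ := (((tendsto_add_smul_sub x (barycenter A σ)).eventually hV).and
    eventually_mem_Ioc).exists
  refine ⟨_, ⟨hεV, add_smul_sub_mem_innerRegion (hull_subset_convexHull_range A σ hx)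
    (barycenter_mem_innerRegion hT hσ) hε hε1⟩, fun i hi => ?_⟩
  have h1 := (hT σ hσ).mem_hull.1 hx i hi
  have h2 := (hT σ hσ).coord_barycenter subset_rfl (hT σ hσ).nonempty hi
  rw [if_pos hi] at h2
  have h3 : (0 : ℝ) < (σ.card : ℝ)⁻¹ :=
    inv_pos.2 (by exact_mod_cast (hT σ hσ).nonempty.card_pos)
  rw [affineMap_add_smul_sub, h2]
  nlinarith

open Classical in
theorem existsUnique_of_sum_eq_one {A : ι → Fin d → ℝ} {T : Finset (Finset ι)}
    {p : Fin d → ℝ}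
    (h : ∑ σ ∈ T, (if p ∈ hull A σ then (1 : ℤ) else 0) = 1) :
    ∃ σ ∈ T, p ∈ hull A σ ∧ ∀ τ ∈ T, p ∈ hull A τ → τ = σ := by
  rw [Finset.sum_boole] at h
  have h' : (T.filter fun σ => p ∈ hull A σ).card = 1 := by exact_mod_cast h
  obtain ⟨σ, hσ⟩ := Finset.card_eq_one.1 h'
  have hσ' : σ ∈ T.filter fun σ => p ∈ hull A σ := hσ ▸ Finset.mem_singleton_self σ
  refine ⟨σ, (Finset.mem_filter.1 hσ').1, (Finset.mem_filter.1 hσ').2, fun τ hτ hp => ?_⟩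
  have : τ ∈ T.filter fun σ => p ∈ hull A σ := Finset.mem_filter.2 ⟨hτ, hp⟩
  rw [hσ] at this
  exact Finset.mem_singleton.1 this

open Classical in
theorem sum_eq_of_existsUnique (ω : Finset ι → ℤ) {A : ι → Fin d → ℝ} {T : Finset (Finset ι)}
    {p : Fin d → ℝ} {σ : Finset ι} (hσ : σ ∈ T)
    (hp : p ∈ hull A σ) (hu : ∀ τ ∈ T, p ∈ hull A τ → τ = σ) :
    ∑ τ ∈ T, (if p ∈ hull A τ then ω τ else 0) = ω σ := by
  rw [Finset.sum_eq_single σ, if_pos hp]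
  · intro τ hτ hne
    rw [if_neg fun h => hne (hu τ hτ h)]
  · exact fun h => absurd hσ h

section Criterion

variable [Fintype ι] [DecidableEq ι] {A : ι → Fin d → ℝ} {T : Finset (Finset ι)}

/-- Near a strictly supporting wall there is a point that is covered by only one cell. -/
theorem exists_covered_once (hd : 0 < d) (hT : ∀ σ ∈ T, IsSimplex A σ)
    (hs : ∃ σ ∈ T, ∃ v ∈ σ, (∀ j ∉ σ.erase v, 0 < coord A σ v (A j)) ∧
      ∀ τ ∈ T, σ.erase v ⊆ τ → τ = σ) :
    ∃ p ∈ innerRegion A T, (∀ σ ∈ T, ∀ v ∈ σ, coord A σ v p ≠ 0) ∧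
      ∃ σ ∈ T, p ∈ hull A σ ∧ ∀ τ ∈ T, p ∈ hull A τ → τ = σ := by
  obtain ⟨σ, hσ, v, hv, hpos, huniq⟩ := hs
  have hW : (σ.erase v).Nonempty := by
    rw [← Finset.card_pos, Finset.card_erase_of_mem hv, (hT σ hσ).card]; omega
  set b := barycenter A (σ.erase v) with hb
  have hbσ : b ∈ hull A σ := hull_mono A (Finset.erase_subset _ _) (barycenter_mem_hull A hW)
  -- If `τ` contains `b`, only vertices of `τ` on the strictly supporting hyperplane can have weight
  -- at `b`, and these belong to the wall. As `b` has positive weight at every vertex of the wall,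
  -- the whole wall lies in `τ`, which forces `τ = σ`.
  have hnot : ∀ τ ∈ T, τ ≠ σ → b ∉ hull A τ := by
    intro τ hτ hne hbτ
    have hb0 : coord A σ v b = 0 := by
      rw [hb, (hT σ hσ).coord_barycenter (Finset.erase_subset _ _) hW hv]
      simp
    have hnn : ∀ i, 0 ≤ coord A σ v (A i) := fun i => by
      by_cases hi : i ∈ σ.erase v
      · rw [(hT σ hσ).coord_vertex hv (Finset.mem_of_mem_erase hi),
          if_neg (Finset.ne_of_mem_erase hi).symm]
      · exact (hpos i hi).le
    have hcτ := (hT τ hτ).mem_hull.1 hbτ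
    rw [(hT τ hτ).affineMap_apply] at hb0
    have hz := (Finset.sum_eq_zero_iff_of_nonneg
      (fun i hi => mul_nonneg (hcτ i hi) (hnn i))).1 hb0
    have hbint : b ∈ hull A (τ ∩ σ.erase v) := by
      rw [(hT τ hτ).mem_hull_of_subset Finset.inter_subset_left]
      refine ⟨hcτ, fun i hi hi' => ?_⟩
      have hi'' : i ∉ σ.erase v := fun h => hi' (Finset.mem_inter.2 ⟨hi, h⟩)
      exact (mul_eq_zero.1 (hz i hi)).resolve_right (hpos i hi'').ne'
    refine hne (huniq τ hτ fun i hi => ?_)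
    by_contra hiτ
    have := ((hT σ hσ).mem_hull_of_subset
      (Finset.inter_subset_right.trans (Finset.erase_subset _ _))).1 hbint
    have h0 := this.2 i (Finset.mem_of_mem_erase hi) (fun h => hiτ (Finset.mem_inter.1 h).1)
    rw [hb, (hT σ hσ).coord_barycenter (Finset.erase_subset _ _) hW
      (Finset.mem_of_mem_erase hi), if_pos hi] at h0
    have : (0 : ℝ) < ((σ.erase v).card : ℝ)⁻¹ := inv_pos.2 (by exact_mod_cast hW.card_pos)
    exact this.ne' h0
  set V : Set (Fin d → ℝ) := {x | ∀ τ ∈ T, τ ≠ σ → x ∉ hull A τ} with hVdef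
  have hV : IsOpen V := by
    simp only [hVdef, Set.ofPred_forall]
    exact isOpen_biInter_finset fun τ _ => isOpen_iInter_of_finite
      fun _ => (isClosed_hull A τ).isOpen_compl
  have hne := nonempty_inter_interior hT hσ hbσ (hV.mem_nhds hnot)
  obtain ⟨p, ⟨⟨hpV, hpU⟩, hpσ⟩, hp⟩ := exists_mem_forall_ne_zero
    ((T ×ˢ (Finset.univ : Finset ι)).filter fun k => k.2 ∈ k.1)
    (fun k => coord A k.1 k.2) (fun k hk => ⟨A k.2, by
      simp only [Finset.mem_filter, Finset.mem_product, Finset.mem_univ, and_true] at hk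
      rw [(hT _ hk.1).coord_vertex hk.2 hk.2]; simp⟩)
    ((hV.inter (isOpen_innerRegion A T)).inter (IsSimplex.isOpen_coord_pos A σ)) hne
  refine ⟨p, hpU, fun τ hτ i hi => hp (τ, i) (by simp [hτ, hi]), σ, hσ,
    (hT σ hσ).mem_hull.2 fun i hi => (hpσ i hi).le, fun τ hτ hpτ => ?_⟩
  by_contra hne
  exact hpV τ hτ hne hpτ

/-- Full-dimensional simplices form a triangulation if each wall either supports `conv A` or
separates exactly two of them, and if some supporting wall is strict. -/
theorem isTriangulation_of_walls (hd : 0 < d) (hT : ∀ σ ∈ T, IsSimplex A σ)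
    (hw : ∀ σ ∈ T, ∀ v ∈ σ, (∃ u, HasNeighbor A T σ v u) ∨ ∀ j, 0 ≤ coord A σ v (A j))
    (hs : ∃ σ ∈ T, ∃ v ∈ σ, (∀ j ∉ σ.erase v, 0 < coord A σ v (A j)) ∧
      ∀ τ ∈ T, σ.erase v ⊆ τ → τ = σ) : IsTriangulation A T := by
  classical
  obtain ⟨p, hpU, hp, σp, hσp, hpσ, hpu⟩ := exists_covered_once hd hT hs
  have hnb : ∀ σ ∈ T, ∀ v ∈ σ, ∀ x ∈ innerRegion A T, coord A σ v x = 0 →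
      ∃ u, HasNeighbor A T σ v u := fun σ hσ v hv x hx h0 =>
    (hw σ hσ v hv).resolve_right fun hpos => (hx σ hσ v hv hpos).ne' h0
  have hcnt : ∀ y : Fin d → ℝ, (∀ σ ∈ T, ∀ v ∈ σ, coord A σ v y ≠ 0) →
      ∀ V : Set (Fin d → ℝ), IsOpen V → V.Nonempty → V ⊆ innerRegion A T →
      ∃ z ∈ V, IsGenericFrom A T y z ∧ ∃ σ ∈ T, z ∈ hull A σ ∧ ∀ τ ∈ T, z ∈ hull A τ → τ = σ := by
    intro y hy V hV hne hVU
    -- Genericity from `p` transports the count of cells to `z`; genericity from `y` is needed later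
    -- to compare two points near `x`.
    obtain ⟨z, hz, hg⟩ := exists_isGenericFrom hT (y := fun b => if b then p else y)
      (fun b => by cases b <;> simpa) hV hne
    refine ⟨z, hz, by simpa using hg false, existsUnique_of_sum_eq_one ?_⟩
    rw [← sum_weight_eq hT (convex_innerRegion A T) (fun _ => 1)
      (fun σ hσ v hv x hx h0 _ => (hnb σ hσ v hv x hx h0).imp fun u hu => ⟨hu, rfl⟩)
      hpU (hVU hz) hp (by simpa using hg true)]
    exact sum_eq_of_existsUnique (fun _ => 1) hσp hpσ hpu
  refine ⟨fun σ hσ => (hT σ hσ).1, fun σ hσ => (hT σ hσ).2, fun σ hσ τ hτ => ?_, ?_⟩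
  · refine Set.Subset.antisymm ?_ (Set.subset_inter (hull_mono A Finset.inter_subset_left)
      (hull_mono A Finset.inter_subset_right))
    rintro x ⟨hxσ, hxτ⟩
    -- In a small ball around `x` only walls that contain `x` can be met.
    have hnear : ∀ᶠ q in 𝓝 x, ∀ κ ∈ T, ∀ v ∈ κ, x ∉ hull A (κ.erase v) →
        q ∉ hull A (κ.erase v) := by
      rw [Filter.eventually_all_finset]
      intro κ _
      rw [Filter.eventually_all_finset]
      intro v _
      by_cases hx : x ∈ hull A (κ.erase v)
      · simp [hx]
      · filter_upwards [(isClosed_hull A (κ.erase v)).isOpen_compl.mem_nhds hx] with q hq _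
          using hq
    obtain ⟨r, hr, hball⟩ := Metric.eventually_nhds_iff_ball.1 hnear
    set V := Metric.ball x r ∩ innerRegion A T with hVdef
    have hVo : IsOpen V := Metric.isOpen_ball.inter (isOpen_innerRegion A T)
    -- The weight selects the cells in which `x` has the same carrier, the set of labels with
    -- positive coordinate, as in `σ`.
    set ω : Finset ι → ℤ := fun κ => if x ∈ hull A κ ∧
      ∀ i, (i ∈ κ ∧ 0 < coord A κ i x) ↔ (i ∈ σ ∧ 0 < coord A σ i x) then 1 else 0 with hω
    have hwall : ∀ κ ∈ T, ∀ v ∈ κ, ∀ q ∈ V, coord A κ v q = 0 →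
        (∀ i ∈ κ, i ≠ v → 0 < coord A κ i q) →
        ∃ u, HasNeighbor A T κ v u ∧ ω (insert u (κ.erase v)) = ω κ := by
      intro κ hκ v hv q hq h0 hpos
      obtain ⟨u, hu⟩ := hnb κ hκ v hv q hq.2 h0
      refine ⟨u, hu, ?_⟩
      have hqW : q ∈ hull A (κ.erase v) := by
        rw [(hT κ hκ).mem_hull_of_subset (Finset.erase_subset _ _)]
        refine ⟨fun i hi => ?_, fun i hi hi' => ?_⟩
        · by_cases hiv : i = v
          · rw [hiv, h0]
          · exact (hpos i hi hiv).le
        · have : i = v := by_contra fun h => hi' (Finset.mem_erase.2 ⟨h, hi⟩)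
          rw [this, h0]
      have hxW : x ∈ hull A (κ.erase v) := by
        by_contra hx
        exact hball q hq.1 κ hκ v hv hx hqW
      have hxκ : x ∈ hull A κ := hull_mono A (Finset.erase_subset _ _) hxW
      have hxκ' : x ∈ hull A (insert u (κ.erase v)) := hull_mono A (Finset.subset_insert _ _) hxW
      have hv0 : coord A κ v x = 0 :=
        (((hT κ hκ).mem_hull_of_subset (Finset.erase_subset _ _)).1 hxW).2 v hv (by simp)
      have hu0 : coord A (insert u (κ.erase v)) u x = 0 :=
        (((hT _ hu.2.1).mem_hull_of_subset (Finset.subset_insert _ _)).1 hxW).2 u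
          (Finset.mem_insert_self _ _) fun h => hu.1 (Finset.mem_of_mem_erase h)
      -- A point on the common wall has the same positive coordinates in both cells, so the weight
      -- agrees across each wall near `x`.
      have hsame : ∀ i, (i ∈ insert u (κ.erase v) ∧ 0 < coord A (insert u (κ.erase v)) i x) ↔
          (i ∈ κ ∧ 0 < coord A κ i x) := by
        intro i
        by_cases hi : i ∈ κ.erase v
        · have := coord_eq_coord_exchange_add (hT κ hκ) (hT _ hu.2.1) hu.1 hi x
          rw [hu0, zero_mul, add_zero] at this
          rw [this]
          simp [Finset.mem_of_mem_erase hi, hi]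
        · constructor
          · rintro ⟨hi', hpos⟩
            obtain rfl := (Finset.mem_insert.1 hi').resolve_right hi
            exact absurd hu0 hpos.ne'
          · rintro ⟨hi', hlt⟩
            have : i = v := by_contra fun h => hi (Finset.mem_erase.2 ⟨h, hi'⟩)
            subst this
            exact absurd hv0 hlt.ne'
      simp only [hω, hxκ, hxκ', true_and, hsame]
    have hball : Metric.ball x r ∈ 𝓝 x := Metric.ball_mem_nhds x hr
    obtain ⟨y, ⟨⟨hyV, hyσ⟩, hyg, κ, hκ, hyκ, hyu⟩⟩ := hcnt p hp _
      (hVo.inter (IsSimplex.isOpen_coord_pos A σ)) (nonempty_inter_interior hT hσ hxσ hball)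
      (fun q hq => hq.1.2)
    obtain rfl := hyu σ hσ ((hT σ hσ).mem_hull.2 fun i hi => (hyσ i hi).le)
    have hyoff : ∀ τ ∈ T, ∀ v ∈ τ, coord A τ v y ≠ 0 := fun τ hτ v hv => (hyg τ hτ v hv).1
    obtain ⟨z, ⟨⟨hzV, hzτ⟩, hzg, κ, hκ, hzκ, hzu⟩⟩ := hcnt y hyoff _
      (hVo.inter (IsSimplex.isOpen_coord_pos A τ)) (nonempty_inter_interior hT hτ hxτ hball)
      (fun q hq => hq.1.2)
    obtain rfl := hzu τ hτ ((hT τ hτ).mem_hull.2 fun i hi => (hzτ i hi).le)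
    -- The points `y` and `z` are covered only by `σ` and `τ`, so the weights of these two cells are
    -- equal. Hence `x` has the same carrier in both, and it lies in the face of the common
    -- vertices.
    have key := sum_weight_eq hT ((convex_ball x r).inter (convex_innerRegion A T)) ω hwall
      hyV hzV hyoff hzg
    rw [sum_eq_of_existsUnique ω hσ hyκ hyu, sum_eq_of_existsUnique ω hτ hzκ hzu] at key
    have hτω : x ∈ hull A τ ∧
        ∀ i, (i ∈ τ ∧ 0 < coord A τ i x) ↔ (i ∈ σ ∧ 0 < coord A σ i x) := by
      by_contra hne
      simp [hω, hne, hxσ] at key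
    rw [(hT σ hσ).mem_hull_of_subset Finset.inter_subset_left]
    refine ⟨(hT σ hσ).mem_hull.1 hxσ, fun i hi hi' => ?_⟩
    by_contra h0
    have hlt := lt_of_le_of_ne ((hT σ hσ).mem_hull.1 hxσ i hi) (Ne.symm h0)
    exact hi' (Finset.mem_inter.2 ⟨hi, ((hτω.2 i).2 ⟨hi, hlt⟩).1⟩)
  · refine Set.Subset.antisymm (Set.iUnion₂_subset fun σ _ => hull_subset_convexHull_range A σ) ?_
    intro x hx
    have hclosed : IsClosed (⋃ σ ∈ T, hull A σ) :=
      T.finite_toSet.isClosed_biUnion fun σ _ => isClosed_hull A σ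
    -- The union of the cells is closed, so it suffices to find covered points arbitrarily near `x`;
    -- these are generic points of the inner region.
    rw [← hclosed.closure_eq, mem_closure_iff]
    intro V hV hxV
    obtain ⟨ε, hεV, hε, hε1⟩ := (((tendsto_add_smul_sub x (barycenter A σp)).eventually
      (hV.mem_nhds hxV)).and eventually_mem_Ioc).exists
    obtain ⟨z, hz, -, σ, hσ, hzσ, -⟩ := hcnt p hp (V ∩ innerRegion A T)
      (hV.inter (isOpen_innerRegion A T)) ⟨_, hεV, add_smul_sub_mem_innerRegion hx
        (barycenter_mem_innerRegion hT hσp) hε hε1⟩ Set.inter_subset_right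
    exact ⟨z, hz.1, Set.mem_biUnion hσ hzσ⟩

end Criterion

variable {ι : Type*} {d : ℕ}

/-! ### Faces of triangulations -/

theorem Indep.mono {A : ι → Fin d → ℝ} {σ τ : Finset ι} (h : Indep A τ) (hστ : σ ⊆ τ) :
    Indep A σ :=
  AffineIndependent.comp_embedding
    ⟨fun i : {i // i ∈ σ} => (⟨i, hστ i.2⟩ : {i // i ∈ τ}), fun i j hij => by
      exact Subtype.ext (congrArg (fun k : {i // i ∈ τ} => (k : ι)) hij)⟩ h

namespace IsTriangulation

variable [DecidableEq ι] {A : ι → Fin d → ℝ} {T : Finset (Finset ι)}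

theorem isSimplex (hT : IsTriangulation A T) {σ : Finset ι} (hσ : σ ∈ T) : IsSimplex A σ :=
  ⟨hT.indep σ hσ, hT.spanning σ hσ⟩

/-- A cell that meets the relative interior of a face contains the face. -/
theorem subset_of_mem_hull (hT : IsTriangulation A T) {σ τ ρ : Finset ι} (hσ : σ ∈ T)
    (hτ : τ ∈ T) (hρ : ρ ⊆ σ) {w : ι → ℝ} (hw : ∀ i ∈ ρ, 0 < w i) (hw1 : ∑ i ∈ ρ, w i = 1)
    (hx : ∑ i ∈ ρ, w i • A i ∈ hull A τ) : ρ ⊆ τ := by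
  intro i hi
  by_contra hiτ
  have hs := hT.isSimplex hσ
  have hxρ : ∑ i ∈ ρ, w i • A i ∈ hull A ρ :=
    mem_hull_iff.2 ⟨w, fun i hi => (hw i hi).le, hw1, rfl⟩
  have hmem : ∑ i ∈ ρ, w i • A i ∈ hull A (σ ∩ τ) := by
    rw [← hT.inter σ hσ τ hτ]
    exact ⟨hull_mono A hρ hxρ, hx⟩
  have h0 := ((hs.mem_hull_of_subset Finset.inter_subset_left).1 hmem).2 i (hρ hi)
    fun h => hiτ (Finset.mem_inter.1 h).2
  have := hs.coord_unique (w := fun i => if i ∈ ρ then w i else 0)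
    (by rw [← Finset.sum_filter, Finset.filter_mem_eq_inter, Finset.inter_eq_right.2 hρ, hw1])
    (x := ∑ i ∈ ρ, w i • A i) (by
      simp_rw [ite_smul, zero_smul]
      rw [← Finset.sum_filter, Finset.filter_mem_eq_inter, Finset.inter_eq_right.2 hρ]) (hρ hi)
  rw [h0, if_pos hi] at this
  exact (hw i hi).ne this

/-- A wall of a cell with a point of the configuration beyond it belongs to a cell beyond it. -/
theorem exists_neighbor (hT : IsTriangulation A T) (hd : 0 < d) {σ : Finset ι} (hσ : σ ∈ T)
    {v j : ι} (hv : v ∈ σ) (hj : coord A σ v (A j) < 0) :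
    ∃ u ∉ σ, insert u (σ.erase v) ∈ T ∧ coord A σ v (A u) < 0 := by
  have hs := hT.isSimplex hσ
  have hW : (σ.erase v).Nonempty := by
    rw [← Finset.card_pos, Finset.card_erase_of_mem hv, hs.card]; omega
  set b := barycenter A (σ.erase v) with hb
  have hb0 : coord A σ v b = 0 := by
    rw [hb, hs.coord_barycenter (Finset.erase_subset _ _) hW hv]; simp
  have hbc : b ∈ convexHull ℝ (Set.range A) :=
    hull_subset_convexHull_range A _ (barycenter_mem_hull A hW)
  have hseg : ∀ ε : ℝ, 0 < ε ∧ ε ≤ 1 → ∃ τ ∈ T, b + ε • (A j - b) ∈ hull A τ := by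
    intro ε hε
    have : b + ε • (A j - b) ∈ convexHull ℝ (Set.range A) :=
      (convex_convexHull ℝ _).add_smul_sub_mem hbc (subset_convexHull ℝ _ ⟨j, rfl⟩)
        ⟨hε.1.le, hε.2⟩
    rw [← hT.cover] at this
    simpa using this
  -- There are finitely many cells, so one of them contains points arbitrarily near `b` on the
  -- segment to `A j`. Being closed it contains `b`, and therefore the whole wall.
  obtain ⟨τ, hτ, hfreq⟩ : ∃ τ ∈ T, ∃ᶠ ε : ℝ in 𝓝[>] 0, 0 < ε ∧ b + ε • (A j - b) ∈ hull A τ := by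
    by_contra hcon
    push Not at hcon
    have hall : ∀ᶠ ε : ℝ in 𝓝[>] 0, ∀ τ ∈ T, ¬ (0 < ε ∧ b + ε • (A j - b) ∈ hull A τ) := by
      rw [Filter.eventually_all_finset]
      intro τ hτ
      filter_upwards [hcon τ hτ] with ε h h' using h h'.1 h'.2
    obtain ⟨ε, h1, h2⟩ := (hall.and eventually_mem_Ioc).exists
    obtain ⟨τ, hτ, hmem⟩ := hseg ε h2
    exact h1 τ hτ ⟨h2.1, hmem⟩
  have hbτ : b ∈ hull A τ :=
    (isClosed_hull A τ).mem_of_frequently_of_tendsto (hfreq.mono fun ε h => h.2)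
      (tendsto_add_smul_sub b (A j))
  have hsub : σ.erase v ⊆ τ :=
    hT.subset_of_mem_hull hσ hτ (Finset.erase_subset _ _)
      (fun i _ => inv_pos.2 (by exact_mod_cast hW.card_pos)) (barycenter_weights hW) hbτ
  obtain ⟨ε, hε, hετ⟩ := hfreq.exists
  have hst := hT.isSimplex hτ
  have hcard : (τ \ σ.erase v).card = 1 := by
    rw [Finset.card_sdiff_of_subset hsub, Finset.card_erase_of_mem hv, hs.card, hst.card]; omega
  obtain ⟨u, hu⟩ := Finset.card_eq_one.1 hcard
  have huτ : u ∈ τ ∧ u ∉ σ.erase v := by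
    rw [← Finset.mem_sdiff, hu]; exact Finset.mem_singleton_self u
  have hτeq : τ = insert u (σ.erase v) := by
    rw [← Finset.sdiff_union_of_subset hsub, hu]; rfl
  have hval : coord A σ v (b + ε • (A j - b)) = ε * coord A σ v (A j) := by
    rw [affineMap_add_smul_sub, hb0]; ring
  have hval' : coord A σ v (b + ε • (A j - b)) =
      coord A τ u (b + ε • (A j - b)) * coord A σ v (A u) := by
    rw [hst.affineMap_apply (coord A σ v)]
    refine Finset.sum_eq_single_of_mem u huτ.1 fun i hi hiu => ?_
    have hi' : i ∈ σ.erase v :=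
      Finset.mem_of_mem_insert_of_ne (hτeq ▸ hi) hiu
    rw [hs.coord_vertex hv (Finset.mem_of_mem_erase hi'),
      if_neg (Finset.ne_of_mem_erase hi').symm, mul_zero]
  have hneg : coord A σ v (A u) < 0 := by
    have h1 := hst.mem_hull.1 hετ u huτ.1
    have h2 : ε * coord A σ v (A j) < 0 := mul_neg_of_pos_of_neg hε hj
    rw [← hval, hval'] at h2
    by_contra hcon
    push Not at hcon
    nlinarith
  refine ⟨u, fun huσ => ?_, hτeq ▸ hτ, hneg⟩
  rw [hs.coord_vertex hv huσ] at hneg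
  split_ifs at hneg <;> linarith

/-- A face of a cell cannot enter the interior of another cell through one of its faces. -/
theorem not_crossing (hT : IsTriangulation A T) {τ τ' κ : Finset ι} (hτ : τ ∈ T) (hτ' : τ' ∈ T)
    (hκ : κ ⊆ τ') {z : ι} (hz : z ∈ κ) (hzτ : z ∉ τ) (hsub : κ.erase z ⊆ τ)
    (hne : (κ.erase z).Nonempty) (hpos : ∀ i ∈ τ, i ∉ κ → 0 < coord A τ i (A z)) : False := by
  have hs := hT.isSimplex hτ
  set n : ℝ := ((κ.erase z).card : ℝ)⁻¹ with hn
  have hn0 : 0 < n := inv_pos.2 (by exact_mod_cast hne.card_pos)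
  set b := barycenter A (κ.erase z) with hb
  have hev : ∀ᶠ ε : ℝ in 𝓝[>] 0, ∀ i ∈ κ.erase z, 0 < coord A τ i (b + ε • (A z - b)) := by
    rw [Filter.eventually_all_finset]
    intro i hi
    refine (((IsSimplex.continuous_coord A τ i).tendsto b).comp
      (tendsto_add_smul_sub b (A z))).eventually (lt_mem_nhds ?_)
    rw [hb, hs.coord_barycenter hsub hne (hsub hi), if_pos hi]
    exact hn0
  obtain ⟨ε, hε, hε0, hε1⟩ := (hev.and (Ioo_mem_nhdsGT (zero_lt_one' ℝ))).exists
  have hmem : b + ε • (A z - b) ∈ hull A τ := by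
    rw [hs.mem_hull]
    intro i hi
    by_cases hi' : i ∈ κ.erase z
    · exact (hε i hi').le
    · have hiκ : i ∉ κ := fun h => hi' (Finset.mem_erase.2 ⟨fun h => hzτ (h ▸ hi), h⟩)
      rw [affineMap_add_smul_sub, hb, hs.coord_barycenter hsub hne hi, if_neg hi']
      have := hpos i hi hiκ
      nlinarith
  have hsum : ∀ f : ι → ℝ, (∑ i ∈ κ, f i) = f z + ∑ i ∈ κ.erase z, f i := fun f =>
    (Finset.add_sum_erase κ f hz).symm
  -- The point `b + ε (A z - b)` of `τ` has positive weight at every vertex of `κ`, so all of `κ`,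
  -- including `z`, would have to belong to `τ`.
  refine hzτ (hT.subset_of_mem_hull hτ' hτ hκ
    (w := fun i => if i = z then ε else (1 - ε) * n) (fun i _ => ?_) ?_ ?_ hz)
  · split_ifs
    · exact hε0
    · exact mul_pos (by linarith) hn0
  · rw [hsum, if_pos rfl, Finset.sum_congr rfl
      (fun i hi => by rw [if_neg (Finset.ne_of_mem_erase hi)]), ← Finset.mul_sum,
      barycenter_weights hne]
    ring
  · have : ∑ i ∈ κ, (if i = z then ε else (1 - ε) * n) • A i = b + ε • (A z - b) := by
      rw [← Finset.add_sum_erase κ _ hz, if_pos rfl, Finset.sum_congr rfl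
        (fun i hi => by rw [if_neg (Finset.ne_of_mem_erase hi), mul_smul]), ← Finset.smul_sum]
      rw [hb, barycenter]
      module
    rw [this]
    exact hmem

end IsTriangulation

/-! ### Circuits and flips -/

theorem sum_mul_affineMap {E : Type*} [AddCommGroup E] [Module ℝ E] [Fintype ι]
    (f : E →ᵃ[ℝ] ℝ) {w : ι → ℝ} {p : ι → E} (hw : ∑ i, w i = 0) (hp : ∑ i, w i • p i = 0) :
    ∑ i, w i * f (p i) = 0 := by
  have h : ∀ x, f x = f.linear x + f 0 := fun x => by
    rw [AffineMap.decomp' f]; simp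
  simp_rw [fun i => h (p i), mul_add, Finset.sum_add_distrib, ← Finset.sum_mul, hw, zero_mul,
    add_zero]
  simp_rw [← smul_eq_mul, ← map_smul, ← map_sum, hp, map_zero]

namespace IsCircuit

variable [Fintype ι] [DecidableEq ι] {A : ι → Fin d → ℝ} {P Q : Finset ι}

theorem symm (h : IsCircuit A P Q) : IsCircuit A Q P := by
  refine ⟨by rw [Finset.union_comm]; exact h.dependent,
    fun S hS => h.minimal S (by rwa [Finset.union_comm]), ?_⟩
  obtain ⟨w, h1, h2, h3, h4⟩ := h.sign
  exact ⟨fun i => -w i, by simp [h1], by simp [h2], by simpa using h4, by simpa using h3⟩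

theorem disjoint (h : IsCircuit A P Q) : Disjoint P Q := by
  obtain ⟨w, -, -, h3, h4⟩ := h.sign
  rw [Finset.disjoint_left]
  intro i hi hi'
  exact lt_asymm ((h3 i).2 hi) ((h4 i).2 hi')

theorem nonempty (h : IsCircuit A P Q) : P.Nonempty := by
  rw [Finset.nonempty_iff_ne_empty]
  intro hP
  obtain ⟨w, h1, -, h3, h4⟩ := h.sign
  have hle : ∀ i ∈ Finset.univ, w i ≤ 0 := fun i _ => by
    by_contra hi
    push Not at hi
    have := (h3 i).1 hi
    rw [hP] at this
    exact absurd this (Finset.notMem_empty i)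
  have h0 := (Finset.sum_eq_zero_iff_of_nonpos hle).1 h1
  have hQ : Q = ∅ := by
    rw [Finset.eq_empty_iff_forall_notMem]
    intro i hi
    exact ((h4 i).2 hi).ne (h0 i (Finset.mem_univ i))
  apply h.dependent
  rw [hP, hQ]
  have : Subsingleton {i // i ∈ (∅ ∪ ∅ : Finset ι)} := ⟨fun i => by simp at i; exact absurd i.2 (by simp)⟩
  exact affineIndependent_of_subsingleton ℝ _

/-- If a supporting affine function vanishes on one side of a circuit, then also on the other. -/
theorem eq_zero_of_nonneg (h : IsCircuit A P Q) {f : (Fin d → ℝ) →ᵃ[ℝ] ℝ}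
    (hf : ∀ j, 0 ≤ f (A j)) (hQ : ∀ j ∈ Q, f (A j) = 0) : ∀ j ∈ P, f (A j) = 0 := by
  obtain ⟨w, h1, h2, h3, h4⟩ := h.sign
  have hnn : ∀ i ∈ Finset.univ, 0 ≤ w i * f (A i) := fun i _ => by
    by_cases hi : i ∈ Q
    · rw [hQ i hi, mul_zero]
    · exact mul_nonneg (not_lt.1 fun h => hi ((h4 i).1 h)) (hf i)
  intro j hj
  have := (Finset.sum_eq_zero_iff_of_nonneg hnn).1 (sum_mul_affineMap f h1 h2) j
    (Finset.mem_univ j)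
  exact (mul_eq_zero.1 this).resolve_left ((h3 j).2 hj).ne'

/-- The normalized dependence gives a common point of the relative interiors of `P` and `Q`. Hence a
cell containing `Q` also contains `P`, and so a dependent set. -/
theorem not_faces (h : IsCircuit A P Q) {T : Finset (Finset ι)} (hT : IsTriangulation A T)
    {σ τ : Finset ι} (hσ : σ ∈ T) (hτ : τ ∈ T) (hP : P ⊆ σ) (hQ : Q ⊆ τ) : False := by
  obtain ⟨w, h1, h2, h3, h4⟩ := h.sign
  have hw0 : ∀ i, i ∉ P → i ∉ Q → w i = 0 := fun i hi hi' =>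
    le_antisymm (not_lt.1 fun h => hi ((h3 i).1 h)) (not_lt.1 fun h => hi' ((h4 i).1 h))
  have hsplit : ∀ {E : Type} [AddCommGroup E] [Module ℝ E] (p : ι → E), ∑ i, w i • p i =
      ∑ i ∈ P, w i • p i + ∑ i ∈ Q, w i • p i := by
    intro E _ _ p
    rw [← Finset.sum_union h.disjoint]
    refine (Finset.sum_subset (Finset.subset_univ _) fun i _ hi => ?_).symm
    rw [Finset.mem_union, not_or] at hi
    rw [hw0 i hi.1 hi.2, zero_smul]
  set s := ∑ i ∈ P, w i with hs
  have hs0 : 0 < s := Finset.sum_pos (fun i hi => (h3 i).2 hi) h.nonempty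
  have hQs : ∑ i ∈ Q, w i = -s := by
    have := hsplit (fun _ => (1 : ℝ))
    simp only [smul_eq_mul, mul_one, h1] at this
    linarith
  have hQA : ∑ i ∈ Q, w i • A i = -∑ i ∈ P, w i • A i := by
    have := hsplit A
    rw [h2] at this
    exact (neg_eq_of_add_eq_zero_right this.symm).symm
  have hPτ : P ⊆ τ := by
    refine hT.subset_of_mem_hull hσ hτ hP (w := fun i => s⁻¹ * w i)
      (fun i hi => mul_pos (inv_pos.2 hs0) ((h3 i).2 hi)) ?_ (hull_mono A hQ ?_)
    · rw [← Finset.mul_sum, ← hs, inv_mul_cancel₀ hs0.ne']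
    · refine mem_hull_iff.2 ⟨fun i => s⁻¹ * -w i, fun i hi => ?_, ?_, ?_⟩
      · have := (h4 i).2 hi
        exact mul_nonneg (inv_nonneg.2 hs0.le) (by linarith)
      · rw [← Finset.mul_sum, Finset.sum_neg_distrib, hQs, neg_neg, inv_mul_cancel₀ hs0.ne']
      · simp_rw [mul_smul, neg_smul]
        rw [← Finset.smul_sum, Finset.sum_neg_distrib, hQA, neg_neg, Finset.smul_sum]
  exact h.dependent ((hT.indep τ hτ).mono (Finset.union_subset hPτ hQ))

/-- Applying the coordinate of `c` to the dependence gives `w x * coord A τ c (A x) + w c = 0`, and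
here `w x > 0`. -/
theorem mem_of_coord_neg (h : IsCircuit A P Q) {τ : Finset ι} (hτ : IsSimplex A τ) {x c : ι}
    (hx : x ∈ P) (hsub : P ∪ Q ⊆ insert x τ) (hxτ : x ∉ τ) (hc : c ∈ τ)
    (hneg : coord A τ c (A x) < 0) : c ∈ P := by
  obtain ⟨w, h1, h2, h3, h4⟩ := h.sign
  have hw0 : ∀ i, i ∉ P ∪ Q → w i = 0 := fun i hi =>
    le_antisymm (not_lt.1 fun h => hi (Finset.mem_union_left _ ((h3 i).1 h)))
      (not_lt.1 fun h => hi (Finset.mem_union_right _ ((h4 i).1 h)))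
  have hsum := sum_mul_affineMap (coord A τ c) h1 h2
  rw [← Finset.sum_subset (Finset.subset_univ (insert x τ)) (fun i _ hi => by
    rw [hw0 i fun h => hi (hsub h), zero_mul]), Finset.sum_insert hxτ,
    Finset.sum_eq_single_of_mem c hc (fun i hi hic => by
      rw [hτ.coord_vertex hc hi, if_neg hic.symm, mul_zero]),
    hτ.coord_vertex hc hc, if_pos rfl] at hsum
  refine (h3 c).1 ?_
  have := (h3 x).2 hx
  nlinarith

end IsCircuit

theorem mem_join [DecidableEq ι] {L S : Finset (Finset ι)} {σ : Finset ι} :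
    σ ∈ join L S ↔ ∃ ρ ∈ L, ∃ τ ∈ S, ρ ∪ τ = σ := by
  simp only [join, Finset.mem_image, Finset.mem_product, Prod.exists]
  exact ⟨fun ⟨ρ, τ, h, e⟩ => ⟨ρ, h.1, τ, h.2, e⟩, fun ⟨ρ, h, τ, h', e⟩ => ⟨ρ, τ, ⟨h, h'⟩, e⟩⟩

theorem mem_join_circuit [DecidableEq ι] {L : Finset (Finset ι)} {P Q σ : Finset ι} :
    σ ∈ join L (circuitTriangulation P Q) ↔ ∃ ρ ∈ L, ∃ c ∈ P, ρ ∪ (P ∪ Q).erase c = σ := by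
  simp [mem_join, circuitTriangulation]

/-! ### Flips: reversibility, and the faces that they destroy -/

section Flips

variable [Fintype ι] [DecidableEq ι] {A : ι → Fin d → ℝ}

theorem mem_link {T : Finset (Finset ι)} {τ ρ : Finset ι} :
    ρ ∈ link T τ ↔ Disjoint ρ τ ∧ ρ ∪ τ ∈ T := by simp [link]

/-- The circuit `(P, Q)` together with the common link `L` supports a flip of `T`. -/
structure SupportsFlip (A : ι → Fin d → ℝ) (T : Finset (Finset ι)) (P Q : Finset ι)
    (L : Finset (Finset ι)) : Prop where
  circuit : IsCircuit A P Q
  nonempty : L.Nonempty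
  link_eq : ∀ c ∈ P, link T ((P ∪ Q).erase c) = L

/-- The result of a flip. -/
def flipped (T : Finset (Finset ι)) (P Q : Finset ι) (L : Finset (Finset ι)) :
    Finset (Finset ι) :=
  (T \ join L (circuitTriangulation P Q)) ∪ join L (circuitTriangulation Q P)

theorem isFlip_iff {T T' : Finset (Finset ι)} :
    IsFlip A T T' ↔ ∃ P Q L, SupportsFlip A T P Q L ∧ T' = flipped T P Q L := by
  constructor
  · rintro ⟨P, Q, hC, L, hL, hlink, rfl⟩
    exact ⟨P, Q, L, ⟨hC, hL, fun c hc => hlink _ (Finset.mem_image_of_mem _ hc)⟩, rfl⟩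
  · rintro ⟨P, Q, L, ⟨hC, hL, hlink⟩, rfl⟩
    refine ⟨P, Q, hC, L, hL, fun τ hτ => ?_, rfl⟩
    obtain ⟨c, hc, rfl⟩ := Finset.mem_image.1 hτ
    exact hlink c hc

namespace SupportsFlip

variable {T : Finset (Finset ι)} {P Q : Finset ι} {L : Finset (Finset ι)}

theorem union_mem (h : SupportsFlip A T P Q L) {ρ : Finset ι} (hρ : ρ ∈ L) {c : ι} (hc : c ∈ P) :
    ρ ∪ (P ∪ Q).erase c ∈ T := by
  rw [← h.link_eq c hc, mem_link] at hρ
  exact hρ.2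

/-- An element of the link avoids `(P ∪ Q).erase c` by definition; if it contained `c`, the whole
circuit would lie in a cell. -/
theorem disjoint (h : SupportsFlip A T P Q L) (hT : IsTriangulation A T) {ρ : Finset ι}
    (hρ : ρ ∈ L) : Disjoint ρ (P ∪ Q) := by
  obtain ⟨c, hc⟩ := h.circuit.nonempty
  have h1 := h.union_mem hρ hc
  have h2 : Disjoint ρ ((P ∪ Q).erase c) := by
    rw [← h.link_eq c hc, mem_link] at hρ
    exact hρ.1
  rw [Finset.disjoint_right]
  intro i hi hiρ
  by_cases hic : i = c
  · subst hic
    refine h.circuit.dependent ((hT.indep _ h1).mono fun j hj => ?_)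
    by_cases hji : j = i
    · subst hji; exact Finset.mem_union_left _ hiρ
    · exact Finset.mem_union_right _ (Finset.mem_erase.2 ⟨hji, hj⟩)
  · exact Finset.disjoint_left.1 h2 hiρ (Finset.mem_erase.2 ⟨hic, hi⟩)

theorem exists_mem (h : SupportsFlip A T P Q L) {c : ι} (hc : c ∈ P) :
    ∃ τ ∈ T, (P ∪ Q).erase c ⊆ τ := by
  obtain ⟨ρ, hρ⟩ := h.nonempty
  exact ⟨_, h.union_mem hρ hc, Finset.subset_union_right⟩

theorem subset_erase_left (h : SupportsFlip A T P Q L) {q : ι} (hq : q ∈ Q) :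
    P ⊆ (P ∪ Q).erase q := fun _ hi => Finset.mem_erase.2
  ⟨fun e => Finset.disjoint_left.1 h.circuit.disjoint hi (e ▸ hq), Finset.mem_union_left _ hi⟩

theorem subset_erase_right (h : SupportsFlip A T P Q L) {c : ι} (hc : c ∈ P) :
    Q ⊆ (P ∪ Q).erase c := fun _ hi => Finset.mem_erase.2
  ⟨fun e => Finset.disjoint_left.1 h.circuit.disjoint hc (e ▸ hi), Finset.mem_union_right _ hi⟩

/-- Before the flip `Q` is a face, being contained in every simplex that is removed, and the two
sides of a circuit are not both faces. -/
theorem not_subset (h : SupportsFlip A T P Q L) (hT : IsTriangulation A T) {σ : Finset ι}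
    (hσ : σ ∈ T) : ¬ P ⊆ σ := by
  intro hP
  obtain ⟨c, hc⟩ := h.circuit.nonempty
  obtain ⟨τ, hτ, hsub⟩ := h.exists_mem hc
  exact h.circuit.not_faces hT hσ hτ hP ((h.subset_erase_right hc).trans hsub)

/-- Flips are reversible. -/
theorem reverse (h : SupportsFlip A T P Q L) (hT : IsTriangulation A T)
    (hT' : IsTriangulation A (flipped T P Q L)) :
    SupportsFlip A (flipped T P Q L) Q P L ∧ T = flipped (flipped T P Q L) Q P L := by
  have hnew : ∀ σ ∈ join L (circuitTriangulation Q P), P ⊆ σ := by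
    intro σ hσ
    obtain ⟨ρ, hρ, q, hq, rfl⟩ := mem_join_circuit.1 hσ
    rw [Finset.union_comm Q P]
    exact (h.subset_erase_left hq).trans Finset.subset_union_right
  have hold : join L (circuitTriangulation P Q) ⊆ T := by
    intro σ hσ
    obtain ⟨ρ, hρ, c, hc, rfl⟩ := mem_join_circuit.1 hσ
    exact h.union_mem hρ hc
  refine ⟨⟨h.circuit.symm, h.nonempty, fun q hq => ?_⟩, ?_⟩
  · rw [Finset.union_comm Q P]
    ext ρ
    rw [mem_link]
    constructor
    · rintro ⟨hdis, hmem⟩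
      have hqρ : q ∉ ρ := by
        intro hqρ
        refine h.circuit.dependent ((hT'.indep _ hmem).mono fun j hj => ?_)
        by_cases hjq : j = q
        · subst hjq; exact Finset.mem_union_left _ hqρ
        · exact Finset.mem_union_right _ (Finset.mem_erase.2 ⟨hjq, hj⟩)
      have hdis' : Disjoint ρ (P ∪ Q) := by
        rw [Finset.disjoint_left] at hdis ⊢
        intro i hi hi'
        exact hdis hi (Finset.mem_erase.2 ⟨fun e => hqρ (e ▸ hi), hi'⟩)
      rcases Finset.mem_union.1 hmem with h1 | h1
      · exact absurd ((h.subset_erase_left hq).trans Finset.subset_union_right)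
          (h.not_subset hT (Finset.mem_sdiff.1 h1).1)
      · obtain ⟨ρ', hρ', q', hq', he⟩ := mem_join_circuit.1 h1
        have hd := h.disjoint hT hρ'
        rw [Finset.union_comm Q P] at he
        have key : ∀ (α : Finset ι) (e : ι), Disjoint α (P ∪ Q) →
            (α ∪ (P ∪ Q).erase e) \ (P ∪ Q) = α := by
          intro α e hα
          rw [Finset.union_sdiff_distrib, Finset.sdiff_eq_empty_iff_subset.2
            (Finset.erase_subset _ _), Finset.union_empty, Finset.sdiff_eq_self_of_disjoint hα]
        have : ρ = ρ' := by rw [← key ρ q hdis', ← key ρ' q' hd, he]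
        exact this ▸ hρ'
    · intro hρ
      refine ⟨(h.disjoint hT hρ).mono_right (Finset.erase_subset _ _),
        Finset.mem_union_right _ (mem_join_circuit.2 ⟨ρ, hρ, q, hq, ?_⟩)⟩
      rw [Finset.union_comm Q P]
  · ext σ
    simp only [flipped, Finset.mem_union, Finset.mem_sdiff]
    constructor
    · intro hσ
      by_cases h1 : σ ∈ join L (circuitTriangulation P Q)
      · exact Or.inr h1
      · exact Or.inl ⟨Or.inl ⟨hσ, h1⟩, fun h2 => h.not_subset hT hσ (hnew σ h2)⟩
    · rintro (⟨⟨h1, -⟩ | h1, h2⟩ | h1)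
      · exact h1
      · exact absurd h1 h2
      · exact hold h1

/-- If some `q ∈ Q` were missing in `σ`, the new cell `ρ ∪ (P ∪ Q).erase q` would still contain `σ`.
-/
theorem subset_of_lost {σ τ : Finset ι}
    (hτ : τ ∈ T) (hσ : σ ⊆ τ) (hlost : ∀ τ' ∈ flipped T P Q L, ¬ σ ⊆ τ') : Q ⊆ σ ∧
      ∃ ρ ∈ L, ∃ c ∈ P, ρ ∪ (P ∪ Q).erase c = τ := by
  have hmem : τ ∈ join L (circuitTriangulation P Q) := by
    by_contra hn
    exact hlost τ (Finset.mem_union_left _ (Finset.mem_sdiff.2 ⟨hτ, hn⟩)) hσ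
  obtain ⟨ρ, hρ, c, hc, rfl⟩ := mem_join_circuit.1 hmem
  refine ⟨fun q hq => ?_, ρ, hρ, c, hc, rfl⟩
  by_contra hqσ
  refine hlost (ρ ∪ (P ∪ Q).erase q) (Finset.mem_union_right _ (mem_join_circuit.2
    ⟨ρ, hρ, q, hq, by rw [Finset.union_comm Q P]⟩)) fun i hi => ?_
  rcases Finset.mem_union.1 (hσ hi) with h1 | h1
  · exact Finset.mem_union_left _ h1
  · exact Finset.mem_union_right _ (Finset.mem_erase.2
      ⟨fun e => hqσ (e ▸ hi), Finset.mem_of_mem_erase h1⟩)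

/-- If a flip destroys an interior wall `σ`, then its circuit is contained in the union of the two
cells that contain `σ`. -/
theorem of_lost_wall (h : SupportsFlip A T P Q L) (hT : IsTriangulation A T) {σ : Finset ι}
    {x y : ι} (hxσ : x ∉ σ) (hyσ : y ∉ σ) (hxy : x ≠ y) (hx : insert x σ ∈ T)
    (hy : insert y σ ∈ T) (hoff : ∀ j ∉ σ, coord A (insert y σ) y (A j) ≠ 0)
    (hlost : ∀ τ' ∈ flipped T P Q L, ¬ σ ⊆ τ') :
    x ∈ P ∧ P ∪ Q ⊆ insert x (insert y σ) ∧
      ∀ c ∈ P, (insert x (insert y σ)).erase c ∈ T := by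
  obtain ⟨-, ρ, hρ, cx, hcx, hey⟩ := subset_of_lost hy (Finset.subset_insert _ _) hlost
  obtain ⟨-, ρ', hρ', cy, hcy, hex⟩ := subset_of_lost hx (Finset.subset_insert _ _) hlost
  have hCy : (P ∪ Q).erase cx ⊆ insert y σ := hey ▸ Finset.subset_union_right
  have hCx : (P ∪ Q).erase cy ⊆ insert x σ := hex ▸ Finset.subset_union_right
  have hny : ¬ P ∪ Q ⊆ insert y σ := fun hs => h.circuit.dependent ((hT.indep _ hy).mono hs)
  have hnx : ¬ P ∪ Q ⊆ insert x σ := fun hs => h.circuit.dependent ((hT.indep _ hx).mono hs)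
  -- Otherwise all points of the circuit except `cx` would lie on the hyperplane of `σ`, while `cx`
  -- is off it. The dependence, evaluated with the coordinate of `y`, forbids this.
  have hne : cx ≠ cy := by
    rintro rfl
    have hsub : (P ∪ Q).erase cx ⊆ σ := fun i hi => by
      rcases Finset.mem_insert.1 (hCy hi) with rfl | h1
      · exact (Finset.mem_insert.1 (hCx hi)).resolve_left (Ne.symm hxy)
      · exact h1
    have hcσ : cx ∉ σ := fun hc => hny fun i hi => by
      by_cases hic : i = cx
      · subst hic; exact Finset.mem_insert_of_mem hc
      · exact Finset.mem_insert_of_mem (hsub (Finset.mem_erase.2 ⟨hic, hi⟩))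
    obtain ⟨w, h1, h2, h3, h4⟩ := h.circuit.sign
    have hsum := sum_mul_affineMap (coord A (insert y σ) y) h1 h2
    rw [Finset.sum_eq_single cx] at hsum
    · exact (mul_ne_zero ((h3 cx).2 hcx).ne' (hoff cx hcσ)) hsum
    · intro i _ hi
      by_cases hiC : i ∈ P ∪ Q
      · have hiσ := hsub (Finset.mem_erase.2 ⟨hi, hiC⟩)
        rw [(hT.isSimplex hy).coord_vertex (Finset.mem_insert_self _ _)
          (Finset.mem_insert_of_mem hiσ), if_neg (fun e : y = i => hyσ (e ▸ hiσ)), mul_zero]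
      · rw [Finset.mem_union, not_or] at hiC
        rw [le_antisymm (not_lt.1 fun h => hiC.1 ((h3 i).1 h))
          (not_lt.1 fun h => hiC.2 ((h4 i).1 h)), zero_mul]
    · exact fun hn => absurd (Finset.mem_univ _) hn
  have hC : P ∪ Q ⊆ insert x (insert y σ) := by
    intro i hi
    by_cases hic : i = cx
    · have := hCx (Finset.mem_erase.2 ⟨fun e => hne (hic.symm.trans e), hi⟩)
      rcases Finset.mem_insert.1 this with h1 | h1
      · exact h1 ▸ Finset.mem_insert_self _ _
      · exact Finset.mem_insert_of_mem (Finset.mem_insert_of_mem h1)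
    · exact Finset.mem_insert_of_mem (hCy (Finset.mem_erase.2 ⟨hic, hi⟩))
  have hxC : x ∈ P ∪ Q := by
    by_contra hxC
    exact hny fun i hi => (Finset.mem_insert.1 (hC hi)).resolve_left fun e => hxC (e ▸ hi)
  have hxcx : x = cx := by
    by_contra hne'
    have := hCy (Finset.mem_erase.2 ⟨hne', hxC⟩)
    rcases Finset.mem_insert.1 this with h1 | h1
    · exact hxy h1
    · exact hxσ h1
  subst hxcx
  -- The two adjacent cells have the same `ρ` in the link, so the other sets obtained by omitting a
  -- point of `P` are cells for the same reason.
  have hD : insert x (insert y σ) = ρ ∪ (P ∪ Q) := by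
    rw [← hey, ← Finset.union_insert, Finset.insert_erase hxC]
  refine ⟨hcx, hC, fun c hc => ?_⟩
  have hcρ : c ∉ ρ := fun hcρ => Finset.disjoint_left.1 (h.disjoint hT hρ) hcρ
    (Finset.mem_union_left _ hc)
  rw [hD, Finset.erase_union_distrib, Finset.erase_eq_of_notMem hcρ]
  exact h.union_mem hρ hc

end SupportsFlip

/-- Flips between triangulations are reversible. -/
theorem IsFlip.symm {T T' : Finset (Finset ι)} (h : IsFlip A T T') (hT : IsTriangulation A T)
    (hT' : IsTriangulation A T') : IsFlip A T' T := by
  obtain ⟨P, Q, L, hS, rfl⟩ := isFlip_iff.1 h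
  obtain ⟨h1, h2⟩ := hS.reverse hT hT'
  exact isFlip_iff.2 ⟨Q, P, L, h1, h2⟩

/-- A property that is preserved by flips and that only some triangulations have disconnects the
graph of flips. -/
theorem not_preconnected_flipGraph {p : Finset (Finset ι) → Prop}
    (hp : ∀ T T', IsTriangulation A T → p T → IsFlip A T T' → p T')
    (h1 : ∃ T, IsTriangulation A T ∧ p T) (h2 : ∃ T, IsTriangulation A T ∧ ¬ p T) :
    ¬ (flipGraph A).Preconnected := by
  intro hcon
  obtain ⟨T₁, hT₁, hp₁⟩ := h1
  obtain ⟨T₂, hT₂, hp₂⟩ := h2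
  obtain ⟨walk⟩ := hcon ⟨T₁, hT₁⟩ ⟨T₂, hT₂⟩
  have key : ∀ S S' : {T : Finset (Finset ι) // IsTriangulation A T},
      (flipGraph A).Walk S S' → p S.1 → p S'.1 := by
    intro S S' w
    induction w with
    | nil => exact id
    | cons hadj _ ih =>
      intro hpS
      apply ih
      rw [flipGraph, SimpleGraph.fromRel_adj] at hadj
      -- An edge is a flip in one of the two directions; in the second case reversibility is needed.
      rcases hadj.2 with hf | hf
      · exact hp _ _ (Subtype.property _) hpS hf
      · exact hp _ _ (Subtype.property _) hpS (hf.symm (Subtype.property _) (Subtype.property _))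
  exact hp₂ (key _ _ walk hp₁)

end Flips

end PointConfig

noncomputable section

namespace PointConfig

/-! ### Fast list operations -/

/-- `List.filter`, written with the recursor so that the kernel evaluates it quickly. -/
def filt (p : ℕ → Bool) (l : List ℕ) : List ℕ :=
  List.rec [] (fun a _ ih => Bool.rec ih (a :: ih) (p a)) l

/-- `List.all`, written with the recursor. -/
def alls (p : ℕ → Bool) (l : List ℕ) : Bool :=
  List.rec true (fun a _ ih => Bool.rec false ih (p a)) l

/-- `List.any`, written with the recursor. -/
def anys (p : ℕ → Bool) (l : List ℕ) : Bool :=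
  List.rec false (fun a _ ih => Bool.rec ih true (p a)) l

/-! ### The `1`-jet at `t = 0` of a determinant of homogenized points -/

/-- The integer pair `(a, b)` stands for `a + b √2`. -/
def addPair (x y : ℤ × ℤ) : ℤ × ℤ :=
  Prod.rec (fun a b => Prod.rec (fun c d => (Int.add a c, Int.add b d)) y) x

/-- Entry `j` of a row of digits `0, 1, -1`, packed into a number in base `4`. -/
def digit (row j : ℕ) : ℕ := Nat.land (Nat.shiftRight row (Nat.mul 2 j)) 3

/-- The sum of the terms `± row[c] * g (cols.erase c)` of a Laplace expansion. -/
def laplace (row : ℕ) (g : Bool → List ℕ → ℤ × ℤ) (cols : List ℕ) :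
    Bool → (List ℕ → List ℕ) → ℤ × ℤ :=
  List.rec (motive := fun _ => Bool → (List ℕ → List ℕ) → ℤ × ℤ) (fun _ _ => (0, 0))
    (fun c cs ih s k =>
      Nat.rec (ih (Bool.not s) (fun l => k (c :: l)))
        (fun n _ => addPair (g (Bool.xor s (Bool.not (Nat.beq n 0))) (k cs))
          (ih (Bool.not s) (fun l => k (c :: l)))) (digit row c)) cols

/-- `x 0, x 1, ...` -/
def lookup (l : List (ℤ × ℤ)) (n : ℕ) : ℤ × ℤ :=
  List.rec (motive := fun _ => ℕ → ℤ × ℤ) (fun _ => (0, 0))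
    (fun a _ ih n => Nat.rec a (fun n _ => ih n) n) l n

/-- The determinant of two of the vertices of the octagon. -/
def cross (i j : ℕ) : ℤ × ℤ :=
  Nat.rec (0, 0) (fun _ _ => Nat.rec (0, 0) (fun _ _ =>
    lookup [(0, 0), (0, 1), (2, 0), (0, 1), (0, 0), (0, -1), (-2, 0), (0, -1)]
      (Nat.land (Nat.sub (Nat.add j 16) i) 7)) j) i

/-- The pair of `-x`. -/
def negPair (x : ℤ × ℤ) : ℤ × ℤ := Prod.rec (fun a b => (Int.neg a, Int.neg b)) x

/-- The determinant of three columns `(1, z₁, z₂)`, negated if `s` holds. -/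
def baseDet (s : Bool) (l : List ℕ) : ℤ × ℤ :=
  List.rec (0, 0) (fun i l _ => List.rec (0, 0) (fun j l _ => List.rec (0, 0) (fun k l _ =>
    List.rec (Bool.rec (addPair (cross i j) (addPair (cross j k) (cross k i)))
      (negPair (addPair (cross i j) (addPair (cross j k) (cross k i)))) s)
      (fun _ _ _ => (0, 0)) l) l) l) l

/-- The `t ^ 0` and `t ^ 1` entries of the first four coordinates. -/
def rows : List (ℕ × ℕ) :=
  [(134743044, 537923616), (538972176, 67635204), (2155888704, 8606777856),
    (8623554816, 1082163264)]

/-- The constant coefficient of a determinant. -/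
def det0 (rs : List (ℕ × ℕ)) : Bool → List ℕ → ℤ × ℤ :=
  List.rec baseDet (fun r _ ih s cols => laplace r.1 ih cols s (fun l => l)) rs

/-- The coefficient of `t` in a determinant. -/
def det1 (rs : List (ℕ × ℕ)) : Bool → List ℕ → ℤ × ℤ :=
  List.rec (fun _ _ => (0, 0)) (fun r rs ih s cols =>
    addPair (laplace r.1 ih cols s (fun l => l)) (laplace r.2 (det0 rs) cols s (fun l => l))) rs

/-- The sign of `s * (a - b √2)`. -/
def cmpSq (a b : ℕ) (s : SignType) : SignType :=
  Bool.rec (Bool.rec 0 s (Nat.blt (Nat.mul 2 (Nat.mul b b)) (Nat.mul a a))) (-s)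
    (Nat.blt (Nat.mul a a) (Nat.mul 2 (Nat.mul b b)))

/-- The sign of `a + b √2`. -/
def signPair (x : ℤ × ℤ) : SignType :=
  Prod.rec (fun a b => Int.rec
    (fun a => Int.rec (fun b => Bool.rec 1 0 (Nat.beq (Nat.add a b) 0))
      (fun b => cmpSq a (Nat.succ b) 1) b)
    (fun a => Int.rec (fun b => cmpSq (Nat.succ a) b (-1)) (fun _ => -1) b) a) x

/-- The sign of the constant coefficient. -/
def chi0 (l : List ℕ) : SignType := signPair (det0 rows false l)

/-- The sign of the first nonvanishing one of the coefficients of `1` and `t`. -/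
def chi (l : List ℕ) : SignType :=
  SignType.rec (signPair (det1 rows false l)) (-1) 1 (chi0 l)

/-! ### Sets of labels as bit masks -/

/-- Bit `i` of `w`. -/
def testb (w i : ℕ) : Bool := Nat.beq (Nat.land (Nat.shiftRight w i) 1) 1

/-- The labels. -/
def labels : List ℕ := [0, 1, 2, 3, 4, 5, 6, 7, 8, 9, 10, 11, 12, 13, 14, 15, 16]

/-- The list of the elements of a bit mask. -/
def elems (w : ℕ) : List ℕ := filt (testb w) labels

/-- Inclusion of bit masks. -/
def subMask (w c : ℕ) : Bool :=
  Nat.beq (Nat.land (Nat.land w c) 131071) (Nat.land w 131071)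

/-- The symmetric difference of `w` and `{i}`. -/
def flipBit (w i : ℕ) : ℕ := Nat.xor w (Nat.shiftLeft 1 i)

/-- `w \ c`. -/
def diffMask (w c : ℕ) : ℕ := Nat.xor w (Nat.land w c)

/-- The parity of the number of elements of `w` below `v`. -/
def par (w v : ℕ) : Bool :=
  List.rec false (fun a _ ih => Bool.rec ih (Bool.not ih) (Nat.blt a v)) (elems w)

/-- `± x * y`. -/
def mulSign (s : Bool) (x y : SignType) : SignType :=
  SignType.rec 0 (SignType.rec 0 (Bool.rec 1 (-1) s) (Bool.rec (-1) 1 s) y)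
    (SignType.rec 0 (Bool.rec (-1) 1 s) (Bool.rec 1 (-1) s) y) x

/-- `w` has six elements, and `a` and `b` are not among them. -/
def validWall (w a b : ℕ) : Bool :=
  and (Nat.beq (List.rec 0 (fun _ _ n => Nat.succ n) (elems w)) 6)
    (and (Bool.not (testb w a)) (Bool.not (testb w b)))

/-- The position of `b` relative to the hyperplane `w`: positive on the side of `a`. -/
def rel (χ : List ℕ → SignType) (w a b : ℕ) : SignType :=
  Bool.rec 0 (mulSign (Bool.xor (par w a) (par w b)) (χ (elems (flipBit w a)))
    (χ (elems (flipBit w b)))) (validWall w a b)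

def isNeg (x : SignType) : Bool := SignType.rec false true false x

def isPos (x : SignType) : Bool := SignType.rec false false true x

def isZero (x : SignType) : Bool := SignType.rec true false false x

/-! ### Checks -/

/-- The masks in `T` other than `c` that contain `w`. -/
def others (T : List ℕ) (c w : ℕ) : List ℕ :=
  filt (fun c' => Bool.rec false (Bool.not (Nat.beq c' c)) (subMask w c')) T

/-- The wall of the cell `c` opposite to `v` is a facet in `bd` that lies in no other cell,
or separates `c` from exactly one other cell. -/
def wallOK (χ : List ℕ → SignType) (bd T : List ℕ) (c v : ℕ) : Bool :=
  let w := flipBit c v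
  List.rec (anys (Nat.beq w) bd) (fun c' l _ =>
    let u := Nat.log2 (Nat.xor c' w)
    List.rec (and (and (Nat.blt u 17) (Bool.not (testb c u)))
      (and (Nat.beq (flipBit w u) c') (isNeg (rel χ w v u))))
      (fun _ _ _ => false) l) (others T c w)

def cellsOK (χ : List ℕ → SignType) (bd T : List ℕ) : Bool :=
  alls (fun c => alls (wallOK χ bd T c) (elems c)) T

/-- The cone with apex `0`. -/
def cone (l : List ℕ) : List ℕ := List.rec [] (fun a _ ih => Nat.lor 1 a :: ih) l

/-- `f` does not contain `0`, and all points that are not in `f` lie strictly on the side of `0`. -/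
def facetOK (χ : List ℕ → SignType) (f : ℕ) : Bool :=
  and (Bool.not (testb f 0)) (alls (fun j => Bool.rec (isPos (rel χ f 0 j)) true (testb f j)) labels)

/-- No point except those in `f` lies on the hyperplane of `f`. -/
def offOK (χ : List ℕ → SignType) (f : ℕ) : Bool :=
  and (Bool.not (testb f 0))
    (alls (fun j => Bool.rec (Bool.not (isZero (rel χ f 0 j))) true (testb f j)) labels)

/-- The face `k` crosses the cell `t ∪ {x}`, where `t = g \ {c}`. -/
def crossing (g x k c : ℕ) : Bool :=
  let t := flipBit g c
  let z := Nat.log2 (diffMask k g)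
  let i := Nat.log2 (diffMask t k)
  and (and (and (and (testb g c) (Nat.blt c 17)) (and (Nat.blt z 17) (Nat.blt i 17)))
      (and (Bool.not (Nat.beq x z)) (testb t i)))
    (and (Nat.beq (flipBit (flipBit t i) z) k) (and (isNeg (rel chi t c x))
      (and (isPos (rel chi t x z)) (isPos (rel chi (flipBit (flipBit t i) x) i z)))))

/-- This exchanges `a_i` and `a_{i+4}` of equal sign, the points that share their first four
coordinates at `t = 0`. It only guides the search in `killAll`. -/
def twin (j : ℕ) : ℕ := Nat.succ (Nat.xor (Nat.pred j) 4)

/-- For each `x` on the side of `0` of `f`, a face in `ks` crosses a cell obtained by a flip at `f`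
from the cells `f ∪ {y}` and `f ∪ {x}`. -/
def killAll (ks : List ℕ) (f y v : ℕ) : Bool :=
  let g := flipBit f y
  let r := twin v
  let cs := filt (fun k => Bool.rec false (Bool.not (testb k r))
    (Nat.beq (Nat.shiftLeft 1 (Nat.log2 (diffMask k g))) (diffMask k g))) ks
  alls (fun x => Bool.rec (Bool.rec true (Bool.rec
      (anys (fun k => Bool.rec (crossing g x k (Nat.log2 (diffMask (flipBit g r) k))) true
        (crossing g x k r)) cs)
      (anys (fun k => crossing g x k (Nat.log2 (diffMask (flipBit g r) k)))
        (filt (fun k => testb k v) cs)) (anys (fun k => testb k v) cs))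
    (isPos (rel chi f 0 x))) true (testb f x)) labels

/-- The pattern demands exactly two points beyond `f`. Either can be the vertex `y` of the outer
cell at `f`, and the other one then guides the search. -/
def killOK (ks : List ℕ) (f : ℕ) : Bool :=
  List.rec false (fun u l _ => List.rec false (fun v l _ =>
    List.rec (and (killAll ks f u v) (killAll ks f v u)) (fun _ _ _ => false) l) l)
    (filt (fun j => Bool.rec (isNeg (rel chi f 0 j)) false (testb f j)) labels)

/-- The facets of `conv A(0)` that are simplices. -/
def stableFacets : List ℕ := [910, 1310, 1806, 1820, 1930, 2110, 3102, 3130, 3350, 3612, 3846,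
  3860, 4220, 6190, 6204, 6260, 7182, 7210, 7224, 7692, 8440, 10780, 11800, 12380, 12408, 12520,
  14364, 14420, 14448, 14860, 15384, 15880, 16880, 21560, 23600, 24760, 24816, 25040, 28728,
  28840, 28896, 29720, 30768, 31760, 33250, 35590, 36610, 41920, 43120, 47200, 49520, 49570,
  49632, 57456, 57680, 57792, 58240, 59440, 61536, 63520, 65990, 66190, 66438, 66500, 67086,
  67210, 67458, 69126, 70670, 71180, 72710, 73220, 83330, 83840, 86240, 94400, 98530, 98630,
  98754, 99078, 99140, 99264, 100098, 100870, 101890, 107200, 114850, 114912, 115074, 115584,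
  115970, 116480, 118880, 123072, 123520, 127040]

/-- The simplices of the frozen triangulation in the other facets of `conv A(0)`. -/
def innerFacets : List ℕ := [190, 252, 414, 438, 486, 500, 732, 924, 980, 1434, 1944, 2358, 2420,
  2900, 8796, 8920, 9168, 9880, 10128, 10836, 11088, 12048, 12876, 14916, 16570, 16818, 17466,
  17562, 17810, 18738, 19506, 19730, 21546, 23586, 25752, 26000, 26496, 27920, 33126, 35110,
  35172, 35184, 35652, 38950, 39012, 39492, 43344, 43840, 44800, 47680, 48640, 51490, 51504,
  52482, 55330, 56322, 59136, 59664, 60672, 64512, 65710, 65766, 65772, 66252, 69678, 69740,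
  69864, 70220, 74440, 75400, 78024, 78408, 79368, 82090, 83082, 86058, 86184, 87050, 91272,
  91776, 94344, 95240, 98406, 102438, 102500, 102980, 104454, 104964, 105474, 105984, 111168,
  112128, 118818, 119810, 124416, 128000]

/-- The simplices in the other facets of `conv A(0)` that become facets of `conv A(t)`. -/
def outerFacets : List ℕ := [126, 350, 378, 462, 490, 504, 1338, 1450, 2166, 4206, 4302, 4330,
  5290, 6246, 8540, 8652, 8664, 8988, 9100, 9156, 12492, 12940, 16824, 17720, 17826, 17832,
  18200, 18312, 21672, 22152, 24984, 25368, 25480, 26136, 28176, 29320, 30216, 32256, 33110,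
  33138, 34098, 34902, 34930, 35094, 35604, 35890, 36114, 36624, 41300, 41748, 41796, 43092,
  43540, 50466, 50480, 50960, 52272, 52752, 58128, 59920, 69774, 69830, 69858, 70284, 70794,
  70818, 71304, 71750, 71778, 72738, 74436, 78020, 78468, 79940, 80388, 83106, 87200, 87680,
  89120, 89600, 94848, 96768, 100422, 100450, 101410, 104544, 107076, 108612, 109060, 112704,
  115746, 117792, 118272, 120864, 125440, 129024]

/-- The cells of `A(t)` between the inner and the outer boundary. -/
def outerCells : List ℕ := [382, 446, 494, 508, 988, 4334, 9052, 9164, 9176, 10136, 13004, 16826,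
  17722, 17818, 17834, 21674, 26008, 26392, 26504, 30344, 33142, 34934, 35126, 35188, 35668,
  41812, 43604, 43856, 44816, 50482, 51506, 52274, 52498, 59152, 60688, 60944, 69806, 69862,
  69868, 70348, 71782, 78532, 78536, 79496, 80452, 86186, 87178, 87202, 89122, 95368, 95872,
  97792, 100454, 104486, 104548, 105028, 109124, 113216, 114176, 117794, 120866, 121858, 126464,
  130048]

end PointConfig

end

namespace PointConfig

/-! ### The value of a determinant -/

/-- The real number `a + b √2`. -/
noncomputable def val (x : ℤ × ℤ) : ℝ := x.1 + x.2 * Real.sqrt 2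

@[simp] theorem val_addPair (x y : ℤ × ℤ) : val (addPair x y) = val x + val y := by
  obtain ⟨a, b⟩ := x
  obtain ⟨c, d⟩ := y
  change ((a + c : ℤ) : ℝ) + ((b + d : ℤ) : ℝ) * _ = (a + b * _) + (c + d * _)
  push_cast
  ring

@[simp] theorem val_negPair (x : ℤ × ℤ) : val (negPair x) = -val x := by
  obtain ⟨a, b⟩ := x
  change ((-a : ℤ) : ℝ) + ((-b : ℤ) : ℝ) * _ = -(a + b * _)
  push_cast
  ring

@[simp] theorem val_zero : val (0, 0) = 0 := by simp [val]

/-- Both `a` and `b √2` are nonnegative, so they compare like their squares `a²` and `2 b²`. -/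
theorem sign_cmpSq (a b : ℕ) :
    cmpSq a b 1 = SignType.sign ((a : ℝ) - b * Real.sqrt 2) ∧
    cmpSq a b (-1) = SignType.sign (-((a : ℝ) - b * Real.sqrt 2)) := by
  have h2 : Real.sqrt 2 * Real.sqrt 2 = 2 := Real.mul_self_sqrt (by norm_num)
  have h0 : 0 ≤ Real.sqrt 2 := Real.sqrt_nonneg 2
  have hb0 : 0 ≤ (b : ℝ) * Real.sqrt 2 := by positivity
  have ha0 : (0 : ℝ) ≤ a := by positivity
  have hsq : ((b : ℝ) * Real.sqrt 2) * ((b : ℝ) * Real.sqrt 2) = 2 * (b * b) := by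
    rw [mul_mul_mul_comm, h2]; ring
  rcases lt_trichotomy (a * a) (2 * (b * b)) with h | h | h
  · have hneg : (a : ℝ) - b * Real.sqrt 2 < 0 := by
      have : (a : ℝ) * a < 2 * (b * b) := by exact_mod_cast h
      rw [← hsq] at this
      linarith [lt_of_mul_self_lt_mul_self₀ hb0 this]
    have e : Nat.blt (Nat.mul a a) (Nat.mul 2 (Nat.mul b b)) = true := by
      simpa [Nat.blt_eq] using h
    rw [sign_neg hneg, sign_pos (neg_pos.2 hneg)]
    constructor <;> (simp only [cmpSq, e]; try rfl)
  · have hz : (a : ℝ) - b * Real.sqrt 2 = 0 := by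
      have : (a : ℝ) * a = 2 * (b * b) := by exact_mod_cast h
      rw [← hsq] at this
      linarith [(mul_self_inj ha0 hb0).1 this]
    have e1 : Nat.blt (Nat.mul a a) (Nat.mul 2 (Nat.mul b b)) = false := by
      rw [Bool.eq_false_iff, ne_eq, Nat.blt_eq]
      exact fun h' => h'.ne h
    have e2 : Nat.blt (Nat.mul 2 (Nat.mul b b)) (Nat.mul a a) = false := by
      rw [Bool.eq_false_iff, ne_eq, Nat.blt_eq]
      exact fun h' => h'.ne' h
    rw [hz, neg_zero, sign_zero]
    constructor <;> (simp only [cmpSq, e1, e2]; try rfl)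
  · have hpos : 0 < (a : ℝ) - b * Real.sqrt 2 := by
      have : 2 * ((b : ℝ) * b) < a * a := by exact_mod_cast h
      rw [← hsq] at this
      linarith [lt_of_mul_self_lt_mul_self₀ ha0 this]
    have e1 : Nat.blt (Nat.mul a a) (Nat.mul 2 (Nat.mul b b)) = false := by
      rw [Bool.eq_false_iff, ne_eq, Nat.blt_eq]
      exact fun h' => lt_asymm h h'
    have e2 : Nat.blt (Nat.mul 2 (Nat.mul b b)) (Nat.mul a a) = true := by
      simpa [Nat.blt_eq] using h
    rw [sign_pos hpos, sign_neg (neg_neg_of_pos hpos)]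
    constructor <;> (simp only [cmpSq, e1, e2]; try rfl)

theorem sign_val (x : ℤ × ℤ) : signPair x = SignType.sign (val x) := by
  have h0 : 0 < Real.sqrt 2 := by positivity
  obtain ⟨a, b⟩ := x
  rcases a with a | a <;> rcases b with b | b
  · change (Bool.rec 1 0 (Nat.beq (a + b) 0) : SignType) = _
    have e : val (Int.ofNat a, Int.ofNat b) = a + b * Real.sqrt 2 := by simp [val]
    rw [e]
    by_cases h : a + b = 0
    · obtain ⟨rfl, rfl⟩ : a = 0 ∧ b = 0 := by omega
      simp
    · have : Nat.beq (a + b) 0 = false := by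
        rw [Bool.eq_false_iff, ne_eq, Nat.beq_eq]
        exact h
      rw [this, sign_pos]
      rcases Nat.eq_zero_or_pos a with rfl | ha
      · have : 0 < b := by omega
        positivity
      · positivity
  · have e : val (Int.ofNat a, Int.negSucc b) = a - (Nat.succ b : ℕ) * Real.sqrt 2 := by
      simp [val, Int.cast_negSucc]; ring
    rw [e]
    exact (sign_cmpSq a (Nat.succ b)).1
  · have e : val (Int.negSucc a, Int.ofNat b) = -(((Nat.succ a : ℕ) : ℝ) - b * Real.sqrt 2) := by
      simp [val, Int.cast_negSucc]; ring
    rw [e]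
    exact (sign_cmpSq (Nat.succ a) b).2
  · have e : val (Int.negSucc a, Int.negSucc b) < 0 := by
      simp only [val, Int.cast_negSucc]
      have : (0 : ℝ) < ((a + 1 : ℕ) : ℝ) := by positivity
      have : (0 : ℝ) < ((b + 1 : ℕ) : ℝ) * Real.sqrt 2 := by positivity
      linarith
    rw [sign_neg e]
    rfl

/-- The real number `-1` or `1`. -/
def boolSign (s : Bool) : ℝ := if s then -1 else 1

/-- The digits `0, 1, 2` stand for `0, 1, -1`. -/
def digitVal (n : ℕ) : ℝ := if n = 0 then 0 else if n = 1 then 1 else -1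

/-- Laplace expansion along a row. -/
def laplaceSum (row : ℕ → ℝ) (G : List ℕ → ℝ) : List ℕ → (List ℕ → List ℕ) → ℝ
  | [], _ => 0
  | c :: cs, k => row c * G (k cs) - laplaceSum row G cs fun l => k (c :: l)

/-- The continuation `k` restores the columns already passed; the induction needs it arbitrary. The
flag `s` carries the alternating sign. -/
theorem val_laplace {row : ℕ} {g : Bool → List ℕ → ℤ × ℤ} {G : List ℕ → ℝ}
    (hg : ∀ s l, val (g s l) = boolSign s * G l) (cols : List ℕ) (s : Bool)
    (k : List ℕ → List ℕ) :
    val (laplace row g cols s k) =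
      boolSign s * laplaceSum (fun c => digitVal (digit row c)) G cols k := by
  induction cols generalizing s k with
  | nil => simp [laplace, laplaceSum]
  | cons c cs ih =>
    have hneg : ∀ s, boolSign (!s) = -boolSign s := by
      rintro (_ | _) <;> simp [boolSign]
    have key : laplace row g (c :: cs) s k =
        Nat.rec (laplace row g cs (!s) fun l => k (c :: l))
          (fun n _ => addPair (g (Bool.xor s (Bool.not (Nat.beq n 0))) (k cs))
            (laplace row g cs (!s) fun l => k (c :: l))) (digit row c) := rfl
    rw [key, laplaceSum]
    rcases h : digit row c with _ | _ | n
    · simp [digitVal, ih, hneg]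
    · simp [digitVal, ih, hneg, hg]; ring
    · have : (Bool.xor s (Bool.not (Nat.beq (n + 1) 0))) = !s := by
        change (s ^^ true) = !s
        simp
      simp only [this, val_addPair, hg, ih, hneg, digitVal]
      simp
      ring

theorem laplaceSum_ofFn {n : ℕ} (row : ℕ → ℝ) (G : List ℕ → ℝ) (f : Fin (n + 1) → ℕ)
    (k : List ℕ → List ℕ) :
    laplaceSum row G (List.ofFn f) k =
      ∑ j : Fin (n + 1), (-1) ^ (j : ℕ) * row (f j) * G (k (List.ofFn (f ∘ j.succAbove))) := by
  induction n generalizing k with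
  | zero => simp [laplaceSum]
  | succ n ih =>
    rw [List.ofFn_succ, laplaceSum, ih, Fin.sum_univ_succ (n := n + 1), sub_eq_add_neg,
      ← Finset.sum_neg_distrib]
    congr 1
    · simp [Function.comp_def]
    · refine Finset.sum_congr rfl fun j _ => ?_
      rw [List.ofFn_succ (f := f ∘ j.succ.succAbove)]
      simp [Function.comp_def, pow_succ]

/-- Determinants by repeated Laplace expansion. -/
def listDet (B : List ℕ → ℝ) : List (ℕ → ℝ) → List ℕ → ℝ
  | [], cols => B cols
  | r :: rs, cols => laplaceSum r (listDet B rs) cols id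

/-- The predicate `p` confines the columns to genuine labels, since the tabulated `3 × 3`
determinants are meaningful only for these. -/
theorem det_eq_laplaceSum {n : ℕ} (R : Fin (n + 1) → ℕ → ℝ) (G : List ℕ → ℝ) (p : ℕ → Prop)
    (hG : ∀ g : Fin n → ℕ, (∀ i, p (g i)) →
      G (List.ofFn g) = Matrix.det (Matrix.of fun i j => R (Fin.succ i) (g j)))
    (f : Fin (n + 1) → ℕ) (hf : ∀ i, p (f i)) :
    laplaceSum (R 0) G (List.ofFn f) id = Matrix.det (Matrix.of fun i j => R i (f j)) := by
  rw [laplaceSum_ofFn, Matrix.det_succ_row_zero]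
  refine Finset.sum_congr rfl fun j _ => ?_
  have := hG (f ∘ j.succAbove) fun i => hf _
  rw [id, this]
  rfl

/-! ### First order Taylor expansion of determinants -/

theorem hasDerivAt_laplaceSum {r : ℝ → ℕ → ℝ} {r' : ℕ → ℝ} {G : ℝ → List ℕ → ℝ}
    {G' : List ℕ → ℝ} {t : ℝ} (hr : ∀ c, HasDerivAt (fun t => r t c) (r' c) t)
    (hG : ∀ l, HasDerivAt (fun t => G t l) (G' l) t) (cols : List ℕ) (k : List ℕ → List ℕ) :
    HasDerivAt (fun t => laplaceSum (r t) (G t) cols k)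
      (laplaceSum (r t) G' cols k + laplaceSum r' (G t) cols k) t := by
  induction cols generalizing k with
  | nil => simpa [laplaceSum] using hasDerivAt_const t (0 : ℝ)
  | cons c cs ih =>
    have := ((hr c).mul (hG (k cs))).sub (ih fun l => k (c :: l))
    refine this.congr_deriv ?_
    simp only [laplaceSum]
    ring

/-- The row with the `t ^ 0` and `t ^ 1` entries given by `r`. -/
def jetRow (r : ℕ × ℕ) (t : ℝ) (c : ℕ) : ℝ := digitVal (digit r.1 c) + t * digitVal (digit r.2 c)

theorem hasDerivAt_jetRow (r : ℕ × ℕ) (c : ℕ) (t : ℝ) :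
    HasDerivAt (fun t => jetRow r t c) (digitVal (digit r.2 c)) t := by
  simpa [jetRow] using ((hasDerivAt_id t).mul_const (digitVal (digit r.2 c))).const_add
    (digitVal (digit r.1 c))

theorem jetRow_zero (r : ℕ × ℕ) : jetRow r 0 = fun c => digitVal (digit r.1 c) := by
  funext c; simp [jetRow]

theorem boolSign_mul_self (s : Bool) : boolSign s * boolSign s = 1 := by
  cases s <;> simp [boolSign]

theorem baseDet_true (l : List ℕ) : val (baseDet true l) = -val (baseDet false l) := by
  rcases l with _ | ⟨i, _ | ⟨j, _ | ⟨k, _ | ⟨m, l⟩⟩⟩⟩ <;> simp [baseDet]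

theorem val_baseDet (s : Bool) (l : List ℕ) :
    val (baseDet s l) = boolSign s * val (baseDet false l) := by
  cases s
  · simp [boolSign]
  · simp [boolSign, baseDet_true]

theorem val_det0 (rs : List (ℕ × ℕ)) (s : Bool) (cols : List ℕ) :
    val (det0 rs s cols) =
      boolSign s * listDet (fun l => val (baseDet false l)) (rs.map fun r => jetRow r 0) cols := by
  induction rs generalizing s cols with
  | nil => exact val_baseDet s cols
  | cons r rs ih =>
    rw [List.map_cons, listDet, jetRow_zero]
    exact val_laplace ih cols s id

/-- The recursion of `det1` is the product rule for a Laplace expansion: either the minor or the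
entry is differentiated. -/
theorem hasDerivAt_listDet (rs : List (ℕ × ℕ)) (s : Bool) (cols : List ℕ) :
    HasDerivAt
      (fun t => listDet (fun l => val (baseDet false l)) (rs.map fun r => jetRow r t) cols)
      (boolSign s * val (det1 rs s cols)) 0 := by
  induction rs generalizing s cols with
  | nil =>
    simpa [det1, listDet] using hasDerivAt_const (0 : ℝ) (val (baseDet false cols))
  | cons r rs ih =>
    -- The induction hypothesis for `s` and for `false` describes the same derivative, so the flag
    -- can only change the sign.
    have h1 : ∀ s l, val (det1 rs s l) = boolSign s * val (det1 rs false l) := fun s l => by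
      have := (ih s l).unique (ih false l)
      rw [← one_mul (val (det1 rs s l)), ← boolSign_mul_self s, mul_assoc, this]
      simp [boolSign]
    have key : val (det1 (r :: rs) s cols) =
        val (laplace r.1 (det1 rs) cols s id) + val (laplace r.2 (det0 rs) cols s id) :=
      val_addPair _ _
    rw [key, val_laplace h1, val_laplace (val_det0 rs), ← mul_add, ← mul_assoc, boolSign_mul_self,
      one_mul, ← jetRow_zero]
    refine hasDerivAt_laplaceSum (r := jetRow r) (fun c => hasDerivAt_jetRow r c 0) (fun l => ?_) cols id
    simpa [boolSign] using ih false l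

/-! ### The determinants of the configuration -/

/-- Multiplication in `ℤ[√2]`. -/
def mulPair (x y : ℤ × ℤ) : ℤ × ℤ := (x.1 * y.1 + 2 * (x.2 * y.2), x.1 * y.2 + x.2 * y.1)

theorem val_mulPair (x y : ℤ × ℤ) : val (mulPair x y) = val x * val y := by
  have h2 : Real.sqrt 2 * Real.sqrt 2 = 2 := Real.mul_self_sqrt (by norm_num)
  simp only [val, mulPair]
  push_cast
  linear_combination (-(x.2 : ℝ) * y.2) * h2

/-- The last two coordinates. -/
def zPair (i : Bool) (n : ℕ) : ℤ × ℤ :=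
  (if i then [(0, 0), (0, 0), (1, 0), (0, 1), (1, 0), (0, 0), (-1, 0), (0, -1), (-1, 0),
      (0, 0), (1, 0), (0, 1), (1, 0), (0, 0), (-1, 0), (0, -1), (-1, 0)]
    else [(0, 0), (0, 1), (1, 0), (0, 0), (-1, 0), (0, -1), (-1, 0), (0, 0), (1, 0),
      (0, 1), (1, 0), (0, 0), (-1, 0), (0, -1), (-1, 0), (0, 0), (1, 0)]).getD n (0, 0)

/-- The octagon has circumradius `√2`, so the determinant of two vertices is `2 sin(kπ/4)`, where
`k` is the difference of the labels modulo `8`. -/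
theorem cross_eq : ∀ i < 17, ∀ j < 17, cross i j =
    addPair (mulPair (zPair false i) (zPair true j))
      (negPair (mulPair (zPair true i) (zPair false j))) := by decide +kernel

theorem val_cross {i j : ℕ} (hi : i < 17) (hj : j < 17) : val (cross i j) =
    val (zPair false i) * val (zPair true j) - val (zPair true i) * val (zPair false j) := by
  rw [cross_eq i hi j hj, val_addPair, val_negPair, val_mulPair, val_mulPair, sub_eq_add_neg]

/-- The rows of the homogenized configuration, the row of ones being the fifth. -/
noncomputable def homRows (t : ℝ) : Fin 7 → ℕ → ℝ :=
  ![jetRow (134743044, 537923616) t, jetRow (538972176, 67635204) t,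
    jetRow (2155888704, 8606777856) t, jetRow (8623554816, 1082163264) t,
    fun _ => 1, fun j => val (zPair false j), fun j => val (zPair true j)]

theorem val_baseDet_ofFn (t : ℝ) (g : Fin 3 → ℕ) (hg : ∀ i, g i < 17) :
    val (baseDet false (List.ofFn g)) =
      Matrix.det (Matrix.of fun i j : Fin 3 => homRows t i.succ.succ.succ.succ (g j)) := by
  have h : val (baseDet false (List.ofFn g)) =
      val (cross (g 0) (g 1)) + (val (cross (g 1) (g 2)) + val (cross (g 2) (g 0))) := by
    rw [← val_addPair, ← val_addPair]
    rfl
  have e0 : ∀ n, homRows t (Fin.succ (Fin.succ (Fin.succ (Fin.succ (0 : Fin 3))))) n = 1 :=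
    fun _ => rfl
  have e1 : ∀ n, homRows t (Fin.succ (Fin.succ (Fin.succ (Fin.succ (1 : Fin 3))))) n =
    val (zPair false n) := fun _ => rfl
  have e2 : ∀ n, homRows t (Fin.succ (Fin.succ (Fin.succ (Fin.succ (2 : Fin 3))))) n =
    val (zPair true n) := fun _ => rfl
  rw [h, val_cross (hg _) (hg _), val_cross (hg _) (hg _), val_cross (hg _) (hg _),
    Matrix.det_fin_three]
  simp only [Matrix.of_apply, e0, e1, e2]
  ring

/-- Expansion along the four rows that depend on `t` leaves the `3 × 3` determinants formed by the
ones and the octagon coordinates. -/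
theorem listDet_homRows (t : ℝ) (f : Fin 7 → ℕ) (hf : ∀ i, f i < 17) :
    listDet (fun l => val (baseDet false l)) (rows.map fun r => jetRow r t) (List.ofFn f) =
      Matrix.det (Matrix.of fun i j => homRows t i (f j)) := by
  refine det_eq_laplaceSum (homRows t) _ (· < 17) (fun f hf => ?_) f hf
  refine det_eq_laplaceSum (fun i => homRows t i.succ) _ (· < 17) (fun f hf => ?_) f hf
  refine det_eq_laplaceSum (fun i => homRows t i.succ.succ) _ (· < 17) (fun f hf => ?_) f hf
  refine det_eq_laplaceSum (fun i => homRows t i.succ.succ.succ) _ (· < 17) (fun f hf => ?_) f hf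
  exact val_baseDet_ofFn t f hf

theorem homRows_eq (t : ℝ) (j : Fin 17) :
    homRows t 0 j = config t j 0 ∧ homRows t 1 j = config t j 1 ∧ homRows t 2 j = config t j 2 ∧
      homRows t 3 j = config t j 3 ∧ homRows t 5 j = config t j 4 ∧
      homRows t 6 j = config t j 5 := by
  have e0 : ∀ n, homRows t 0 n = jetRow (134743044, 537923616) t n := fun _ => rfl
  have e1 : ∀ n, homRows t 1 n = jetRow (538972176, 67635204) t n := fun _ => rfl
  have e2 : ∀ n, homRows t 2 n = jetRow (2155888704, 8606777856) t n := fun _ => rfl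
  have e3 : ∀ n, homRows t 3 n = jetRow (8623554816, 1082163264) t n := fun _ => rfl
  have e5 : ∀ n, homRows t 5 n = val (zPair false n) := fun _ => rfl
  have e6 : ∀ n, homRows t 6 n = val (zPair true n) := fun _ => rfl
  rw [e0, e1, e2, e3, e5, e6]
  fin_cases j <;>
    simp [jetRow, digit, digitVal, Nat.shiftRight_eq_div_pow, config, coords, zPair, val]

theorem orientDet_config (t : ℝ) (I : Fin 7 → Fin 17) :
    orientDet (config t) I = listDet (fun l => val (baseDet false l))
      (rows.map fun r => jetRow r t) (List.ofFn fun k => (I k : ℕ)) := by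
  rw [listDet_homRows t _ fun i => (I i).2, orientDet, ← Matrix.det_transpose]
  -- Moving the row of ones from the first to the fifth place is a cycle of length five, an even
  -- permutation.
  have hsign : ((Equiv.Perm.sign (Fin.cycleRange (4 : Fin 7)) : ℤ) : ℝ) = 1 := by
    rw [Fin.sign_cycleRange]
    norm_num
  rw [← one_mul (Matrix.det (Matrix.transpose _)), ← congrArg (· * _) hsign,
    ← Matrix.det_permute]
  congr 1
  ext i j
  have h := homRows_eq t (I j)
  fin_cases i
  · exact h.1.symm
  · exact h.2.1.symm
  · exact h.2.2.1.symm
  · exact h.2.2.2.1.symm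
  · rfl
  · exact h.2.2.2.2.1.symm
  · exact h.2.2.2.2.2.symm

theorem sign_orientDet_config_zero (I : Fin 7 → Fin 17) :
    SignType.sign (orientDet (config 0) I) = chi0 (List.ofFn fun k => (I k : ℕ)) := by
  have := val_det0 rows false (List.ofFn fun k => (I k : ℕ))
  rw [orientDet_config, chi0, sign_val, this]
  simp [boolSign]

/-- `A` realizes all signs that `χ` determines. -/
def Realizes (χ : List ℕ → SignType) (A : Fin 17 → Fin 6 → ℝ) : Prop :=
  ∀ I : Fin 7 → Fin 17, χ (List.ofFn fun k => (I k : ℕ)) ≠ 0 →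
    SignType.sign (orientDet A I) = χ (List.ofFn fun k => (I k : ℕ))

/-- The quotient `F t / t` tends to `D`, and `t` is positive. -/
theorem eventually_sign_eq_of_hasDerivAt {F : ℝ → ℝ} {D : ℝ} (hF : HasDerivAt F D 0)
    (h0 : F 0 = 0) (hD : D ≠ 0) :
    ∀ᶠ t : ℝ in 𝓝[>] 0, SignType.sign (F t) = SignType.sign D := by
  have hlim : Filter.Tendsto (fun t : ℝ => t⁻¹ * F t) (𝓝[>] 0) (𝓝 D) := by
    have := hF.tendsto_slope_zero_right
    simpa [h0] using this
  have hpos : ∀ᶠ t : ℝ in 𝓝[>] 0, 0 < t := eventually_mem_nhdsWithin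
  rcases lt_or_gt_of_ne hD with h | h
  · filter_upwards [hlim.eventually (gt_mem_nhds h), hpos] with t h1 h2
    rw [sign_neg h, sign_neg]
    by_contra hcon
    push Not at hcon
    have := mul_nonneg (inv_nonneg.2 h2.le) hcon
    linarith
  · filter_upwards [hlim.eventually (lt_mem_nhds h), hpos] with t h1 h2
    rw [sign_pos h, sign_pos]
    by_contra hcon
    push Not at hcon
    have := mul_nonpos_of_nonneg_of_nonpos (inv_nonneg.2 h2.le) hcon
    linarith

theorem eventually_sign_eq {F : ℝ → ℝ} (hF : ContinuousAt F 0) (h0 : F 0 ≠ 0) :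
    ∀ᶠ t : ℝ in 𝓝[>] 0, SignType.sign (F t) = SignType.sign (F 0) := by
  have hlim : Filter.Tendsto F (𝓝[>] 0) (𝓝 (F 0)) := hF.tendsto.mono_left nhdsWithin_le_nhds
  rcases lt_or_gt_of_ne h0 with h | h
  · filter_upwards [hlim.eventually (gt_mem_nhds h)] with t h1
    rw [sign_neg h, sign_neg h1]
  · filter_upwards [hlim.eventually (lt_mem_nhds h)] with t h1
    rw [sign_pos h, sign_pos h1]

/-- There are finitely many tuples of labels. For each, the sign for small `t > 0` is that of the
constant term if this is nonzero, and otherwise that of the derivative if this is nonzero. -/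
theorem eventually_realizes_config : ∀ᶠ t : ℝ in 𝓝[>] 0, Realizes chi (config t) := by
  refine Filter.eventually_all.2 fun I => ?_
  set l := List.ofFn fun k => (I k : ℕ) with hl
  have hd := hasDerivAt_listDet rows false l
  simp only [← orientDet_config, hl] at hd
  rw [← hl] at hd
  have h0 : SignType.sign (orientDet (config 0) I) = chi0 l := sign_orientDet_config_zero I
  have h1 : SignType.sign (boolSign false * val (det1 rows false l)) =
      signPair (det1 rows false l) := by
    rw [sign_val]; simp [boolSign]
  by_cases hz : orientDet (config 0) I = 0
  · have hchi : chi l = signPair (det1 rows false l) := by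
      rw [hz, sign_zero] at h0
      rw [chi, ← h0]
      rfl
    rw [hchi, ← h1]
    by_cases hD : boolSign false * val (det1 rows false l) = 0
    · exact Filter.Eventually.of_forall fun t h => absurd (by rw [hD, sign_zero]) h
    · filter_upwards [eventually_sign_eq_of_hasDerivAt hd hz hD] with t ht _ using ht
  · have hchi : chi l = chi0 l := by
      rw [chi]
      rcases lt_or_gt_of_ne hz with h | h
      · rw [← h0, sign_neg h]; rfl
      · rw [← h0, sign_pos h]; rfl
    rw [hchi, ← h0]
    filter_upwards [eventually_sign_eq hd.continuousAt hz] with t ht _ using ht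

/-- Only nonzero signs are prescribed, and these are the signs that a perturbation keeps. -/
theorem Realizes.of_isPerturbation {A A' : Fin 17 → Fin 6 → ℝ} {χ : List ℕ → SignType}
    (h : Realizes χ A) (hA : IsPerturbation A A') : Realizes χ A' := by
  intro I hI
  have := h I hI
  rw [hA I fun h0 => hI (by rw [← this, h0, sign_zero]), this]

theorem Realizes.chi0 {A : Fin 17 → Fin 6 → ℝ} (h : Realizes chi A) : Realizes chi0 A := by
  intro I hI
  have : chi (List.ofFn fun k => (I k : ℕ)) = PointConfig.chi0 (List.ofFn fun k => (I k : ℕ)) := by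
    rw [chi]
    generalize PointConfig.chi0 (List.ofFn fun k => (I k : ℕ)) = x at hI
    cases x
    · exact absurd rfl hI
    · rfl
    · rfl
  rw [h I (this ▸ hI), this]

/-! ### Bit masks -/

theorem filt_eq (p : ℕ → Bool) (l : List ℕ) : filt p l = l.filter p := by
  induction l with
  | nil => rfl
  | cons a l ih =>
    rw [List.filter_cons, ← ih]
    change (Bool.rec (filt p l) (a :: filt p l) (p a) : List ℕ) = _
    cases p a <;> rfl

theorem alls_iff {p : ℕ → Bool} {l : List ℕ} : alls p l = true ↔ ∀ a ∈ l, p a = true := by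
  induction l with
  | nil => simp [alls]
  | cons a l ih =>
    rw [List.forall_mem_cons, ← ih]
    change Bool.rec false (alls p l) (p a) = true ↔ _
    cases p a <;> simp

theorem anys_iff {p : ℕ → Bool} {l : List ℕ} : anys p l = true ↔ ∃ a ∈ l, p a = true := by
  induction l with
  | nil => simp [anys]
  | cons a l ih =>
    rw [List.exists_mem_cons_iff, ← ih]
    change Bool.rec (anys p l) true (p a) = true ↔ _
    cases p a <;> simp

theorem testb_eq (w i : ℕ) : testb w i = w.testBit i := by
  rw [Nat.testBit_eq_decide_div_mod_eq, ← Nat.shiftRight_eq_div_pow, ← Nat.and_one_is_mod]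
  change Nat.beq ((w >>> i) &&& 1) 1 = _
  rw [Bool.eq_iff_iff, Nat.beq_eq, decide_eq_true_iff]

theorem testb_flipBit (w i j : ℕ) : testb (flipBit w i) j = (testb w j ^^ decide (i = j)) := by
  simp only [testb_eq]
  change (w ^^^ (1 <<< i)).testBit j = _
  rw [Nat.testBit_xor, Nat.one_shiftLeft, Nat.testBit_two_pow]

/-- The set of labels with bit mask `w`. -/
def bits (w : ℕ) : Finset (Fin 17) := Finset.univ.filter fun i => testb w i = true

@[simp] theorem mem_bits {w : ℕ} {i : Fin 17} : i ∈ bits w ↔ testb w i = true := by simp [bits]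

theorem bits_flipBit_of_mem {w : ℕ} {i : Fin 17} (h : testb w i = true) :
    bits (flipBit w i) = (bits w).erase i := by
  ext j
  rw [mem_bits, testb_flipBit, Finset.mem_erase, mem_bits]
  by_cases hij : i = j
  · subst hij; simp [h]
  · have : (i : ℕ) ≠ j := fun e => hij (Fin.ext e)
    simp [this, Ne.symm hij]

theorem bits_flipBit_of_notMem {w : ℕ} {i : Fin 17} (h : testb w i = false) :
    bits (flipBit w i) = insert i (bits w) := by
  ext j
  rw [mem_bits, testb_flipBit, Finset.mem_insert, mem_bits]
  by_cases hij : i = j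
  · subst hij; simp [h]
  · have : (i : ℕ) ≠ j := fun e => hij (Fin.ext e)
    simp [this, Ne.symm hij]

theorem subMask_iff {w c : ℕ} : subMask w c = true ↔ bits w ⊆ bits c := by
  have hb : ∀ x i, (Nat.land x 131071).testBit i = (x.testBit i && decide (i < 17)) := fun x i => by
    have := Nat.testBit_and x (2 ^ 17 - 1) i
    rwa [Nat.testBit_two_pow_sub_one] at this
  have hl : ∀ i, (Nat.land w c).testBit i = (w.testBit i && c.testBit i) := Nat.testBit_and w c
  rw [subMask, Nat.beq_eq]
  constructor
  · intro h i hi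
    rw [mem_bits, testb_eq] at hi ⊢
    have : (Nat.land (Nat.land w c) 131071).testBit i = (Nat.land w 131071).testBit i := by rw [h]
    rw [hb, hb, hl, hi] at this
    simpa using this
  · intro h
    refine Nat.eq_of_testBit_eq fun i => ?_
    rw [hb, hb, hl]
    by_cases hi : i < 17
    · have := @h ⟨i, hi⟩
      rw [mem_bits, mem_bits, testb_eq, testb_eq] at this
      cases h1 : w.testBit i
      · simp
      · simp [this h1]
    · simp [hi]

theorem mem_labels {i : ℕ} : i ∈ labels ↔ i < 17 := by
  have : labels = List.range 17 := by decide
  rw [this, List.mem_range]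

theorem mem_elems {w i : ℕ} : i ∈ elems w ↔ i < 17 ∧ testb w i = true := by
  rw [elems, filt_eq, List.mem_filter, mem_labels]

theorem boolSign_par (w v : ℕ) :
    boolSign (par w v) = (-1) ^ ((elems w).filter fun a => decide (a < v)).length := by
  have key : ∀ l : List ℕ,
      boolSign (List.rec false (fun a _ ih => Bool.rec ih (Bool.not ih) (Nat.blt a v)) l) =
        (-1) ^ (l.filter fun a => decide (a < v)).length := by
    intro l
    induction l with
    | nil => simp [boolSign]
    | cons a l ih =>
      have hneg : ∀ s, boolSign (!s) = -boolSign s := by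
        rintro (_ | _) <;> simp [boolSign]
      by_cases h : a < v
      · have h' : Nat.blt a v = true := by simpa [Nat.blt_eq] using h
        rw [List.filter_cons_of_pos (by simpa using h), List.length_cons, pow_succ, ← ih]
        simp only [h', hneg]
        ring
      · have h' : Nat.blt a v = false := by
          rw [Bool.eq_false_iff, ne_eq, Nat.blt_eq]; exact h
        rw [List.filter_cons_of_neg (by simpa using h), ← ih]
        simp only [h']
  exact key _

/-- The lists are sorted, so the label `v` is inserted after the smaller ones, whose number has the
parity `par w v`. -/
theorem exists_elems_eq_append {w : ℕ} {v : Fin 17} (hv : testb w v = false) :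
    ∃ l₁ l₂ : List ℕ, elems w = l₁ ++ l₂ ∧ elems (flipBit w v) = l₁ ++ (v : ℕ) :: l₂ ∧
      boolSign (par w v) = (-1) ^ l₁.length := by
  obtain ⟨m₁, m₂, hm⟩ := List.append_of_mem (mem_labels.2 v.2)
  have hsort : labels.Pairwise (· < ·) := by decide
  rw [hm, List.pairwise_append, List.pairwise_cons] at hsort
  obtain ⟨-, ⟨h2, -⟩, h1⟩ := hsort
  have h1' : ∀ a ∈ m₁, a < v := fun a ha => h1 a ha v (by simp)
  have hE : elems w = m₁.filter (testb w) ++ m₂.filter (testb w) := by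
    rw [elems, filt_eq, hm, List.filter_append, List.filter_cons_of_neg (by simp [hv])]
  have hcongr : ∀ l : List ℕ, (∀ a ∈ l, a ≠ v) →
      l.filter (testb (flipBit w v)) = l.filter (testb w) := fun l hl =>
    List.filter_congr fun a ha => by rw [testb_flipBit]; simp [(hl a ha).symm]
  refine ⟨_, _, hE, ?_, ?_⟩
  · rw [elems, filt_eq, hm, List.filter_append,
      List.filter_cons_of_pos (by rw [testb_flipBit]; simp [hv]),
      hcongr m₁ fun a ha => (h1' a ha).ne, hcongr m₂ fun a ha => (h2 a ha).ne']
  · have e1 : (m₁.filter (testb w)).filter (fun a => decide (a < (v : ℕ))) = m₁.filter (testb w) :=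
      List.filter_eq_self.2 fun a ha => by simpa using h1' a (List.mem_of_mem_filter ha)
    have e2 : (m₂.filter (testb w)).filter (fun a => decide (a < (v : ℕ))) = [] :=
      List.filter_eq_nil_iff.2 fun a ha => by simpa using (h2 a (List.mem_of_mem_filter ha)).le
    rw [boolSign_par, hE, List.filter_append, e1, e2, List.append_nil]

/-! ### Determinants and barycentric coordinates -/

theorem orientDet_insertNth {ι : Type*} {d : ℕ} (A : ι → Fin d → ℝ) (p : Fin (d + 1)) (v : ι)
    (g : Fin d → ι) :
    orientDet A (p.insertNth v g) = (-1) ^ (p : ℕ) * orientDet A (Fin.cons v g) := by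
  have hs : ((Equiv.Perm.sign p.cycleRange.symm : ℤ) : ℝ) = (-1) ^ (p : ℕ) := by
    rw [Equiv.Perm.sign_symm, Fin.sign_cycleRange]
    norm_num
  have h : (p.insertNth v g : Fin (d + 1) → ι) = (Fin.cons v g : Fin (d + 1) → ι) ∘ p.cycleRange :=
    (Fin.cons_comp_cycleRange v g p).symm
  rw [h, ← hs, Equiv.Perm.sign_symm]
  exact Matrix.det_permute p.cycleRange
    (Matrix.of fun k => (Fin.cons 1 (A ((Fin.cons v g : Fin (d + 1) → ι) k)) : Fin (d + 1) → ℝ))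

theorem ofFn_insertNth {α : Type*} {n : ℕ} (p : Fin (n + 1)) (v : α) (g : Fin n → α) :
    List.ofFn (p.insertNth v g : Fin (n + 1) → α) =
      (List.ofFn g).take p ++ v :: (List.ofFn g).drop p := by
  apply List.ext_getElem
  · simp; omega
  · intro i h1 h2
    have hi : i < n + 1 := by simpa using h1
    rw [List.getElem_ofFn]
    rcases lt_trichotomy i p with h | h | h
    · rw [List.getElem_append_left (by simp; omega), List.getElem_take, List.getElem_ofFn,
        Fin.insertNth_apply_below (show (⟨i, hi⟩ : Fin (n + 1)) < p from h)]
      simp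
      rfl
    · have : (⟨i, hi⟩ : Fin (n + 1)) = p := Fin.ext h
      rw [this, Fin.insertNth_apply_same, List.getElem_append_right (by simp; omega)]
      simp [h, Nat.min_eq_left (Nat.lt_succ_iff.1 p.2)]
    · rw [Fin.insertNth_apply_above (show p < (⟨i, hi⟩ : Fin (n + 1)) from h),
        List.getElem_append_right (by simp; omega), List.getElem_cons]
      simp
      rw [dif_neg (by omega)]
      congr 1
      ext
      simp
      omega

/-- In the expansion along the first row the cofactors do not depend on the first point. -/
theorem exists_affineMap_eq_orientDet {ι : Type*} {d : ℕ} (A : ι → Fin d → ℝ) (g : Fin d → ι) :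
    ∃ f : (Fin d → ℝ) →ᵃ[ℝ] ℝ, ∀ i, f (A i) = orientDet A (Fin.cons i g) := by
  set c : Fin (d + 1) → ℝ := fun j => (-1) ^ (j : ℕ) * Matrix.det
    ((Matrix.of fun k : Fin d => (Fin.cons 1 (A (g k)) : Fin (d + 1) → ℝ)).submatrix id
      j.succAbove) with hc
  refine ⟨AffineMap.const ℝ _ (c 0) +
    (∑ j : Fin d, c j.succ • (LinearMap.proj j : (Fin d → ℝ) →ₗ[ℝ] ℝ)).toAffineMap, fun i => ?_⟩
  rw [orientDet, Matrix.det_succ_row_zero, Fin.sum_univ_succ]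
  change c 0 + (∑ j : Fin d, c j.succ • (LinearMap.proj j : (Fin d → ℝ) →ₗ[ℝ] ℝ)) (A i) = _
  rw [LinearMap.sum_apply]
  congr 1
  · change (-1) ^ _ * _ = (-1) ^ _ * 1 * _
    rw [mul_one]
    rfl
  · refine Finset.sum_congr rfl fun j _ => ?_
    change (-1) ^ _ * _ * A i j = (-1) ^ _ * A i j * _
    rw [mul_right_comm]
    rfl

theorem orientDet_cons_of_mem {ι : Type*} {d : ℕ} (A : ι → Fin d → ℝ) (g : Fin d → ι) (k : Fin d) :
    orientDet A (Fin.cons (g k) g) = 0 :=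
  Matrix.det_zero_of_row_eq (Fin.succ_ne_zero k).symm (by ext j; simp)

theorem isSimplex_of_orientDet_ne_zero {ι : Type*} [DecidableEq ι] {d : ℕ} {A : ι → Fin d → ℝ}
    {I : Fin (d + 1) → ι} (h : orientDet A I ≠ 0) {σ : Finset ι} (hσ : σ = Finset.univ.image I) :
    IsSimplex A σ := by
  have hlin := Matrix.linearIndependent_rows_of_det_ne_zero h
  have hind : AffineIndependent ℝ fun k => A (I k) := by
    rw [affineIndependent_iff]
    intro s w hw hs
    refine (linearIndependent_iff'.1 hlin) s w ?_
    ext j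
    rw [Finset.sum_apply]
    refine Fin.cases ?_ (fun j => ?_) j
    · simpa [Matrix.row] using hw
    · have := congrFun hs j
      simpa [Matrix.row, Finset.sum_apply] using this
  have hinj : Function.Injective I := fun i j hij => hind.injective (congrArg A hij)
  have hmem : ∀ i, i ∈ σ ↔ ∃ k, I k = i := by simp [hσ]
  let e : Fin (d + 1) ≃ {i // i ∈ σ} := Equiv.ofBijective (fun k => ⟨I k, (hmem _).2 ⟨k, rfl⟩⟩)
    ⟨fun i j hij => hinj (congrArg Subtype.val hij),
      fun i => by obtain ⟨k, hk⟩ := (hmem i).1 i.2; exact ⟨k, Subtype.ext hk⟩⟩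
  refine ⟨(affineIndependent_equiv e).1 hind, ?_⟩
  have hr : A '' (σ : Set ι) = Set.range fun k => A (I k) := by
    ext x
    simp [hσ]
  rw [hr]
  exact hind.affineSpan_eq_top_iff_card_eq_finrank_add_one.2 (by simp)

/-- Cramer's rule: the determinant is affine in its first point and vanishes at the points of `g`.
-/
theorem coord_mul_orientDet {ι : Type*} [DecidableEq ι] {d : ℕ} {A : ι → Fin d → ℝ} {g : Fin d → ι}
    {a : ι} (hs : IsSimplex A (insert a (Finset.univ.image g))) (ha : ∀ k, g k ≠ a) (b : ι) :
    coord A (insert a (Finset.univ.image g)) a (A b) * orientDet A (Fin.cons a g) =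
      orientDet A (Fin.cons b g) := by
  obtain ⟨f, hf⟩ := exists_affineMap_eq_orientDet A g
  rw [← hf b, hs.affineMap_apply f (A b), Finset.sum_insert (by simpa using ha),
    Finset.sum_eq_zero, add_zero, hf]
  intro i hi
  obtain ⟨k, -, rfl⟩ := Finset.mem_image.1 hi
  rw [hf, orientDet_cons_of_mem, mul_zero]

/-! ### Positions relative to hyperplanes -/

theorem mulSign_eq (s : Bool) (x y : SignType) :
    mulSign s x y = (if s then -1 else 1) * (x * y) := by
  cases s <;> cases x <;> cases y <;> rfl

theorem validWall_iff {w a b : ℕ} : validWall w a b = true ↔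
    (elems w).length = 6 ∧ testb w a = false ∧ testb w b = false := by
  have hlen : ∀ l : List ℕ, (List.rec 0 (fun _ _ n => Nat.succ n) l : ℕ) = l.length := by
    intro l
    induction l with
    | nil => rfl
    | cons a l ih => rw [List.length_cons, ← ih]
  unfold validWall
  rw [hlen]
  simp [Nat.beq_eq]

/-- The hyperplane `w` in terms of a list of labels. -/
theorem exists_orientDet_cons {w : ℕ} (hw : (elems w).length = 6) :
    ∃ g : Fin 6 → Fin 17, Finset.univ.image g = bits w ∧ ∀ v : Fin 17, testb w v = false →
      ∃ I : Fin 7 → Fin 17, (List.ofFn fun k => (I k : ℕ)) = elems (flipBit w v) ∧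
        ∀ A : Fin 17 → Fin 6 → ℝ,
          orientDet A I = boolSign (par w v) * orientDet A (Fin.cons v g) := by
  have hg : ∀ k : Fin 6, (elems w)[(k : ℕ)]'(by rw [hw]; exact k.2) < 17 := fun k =>
    (mem_elems.1 (List.getElem_mem _)).1
  refine ⟨fun k => ⟨_, hg k⟩, ?_, fun v hv => ?_⟩
  · ext i
    simp only [Finset.mem_image, Finset.mem_univ, true_and, mem_bits]
    constructor
    · rintro ⟨k, rfl⟩
      exact (mem_elems.1 (List.getElem_mem _)).2
    · intro hi
      obtain ⟨n, hn, h⟩ := List.getElem_of_mem (mem_elems.2 ⟨i.2, hi⟩)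
      exact ⟨⟨n, hw ▸ hn⟩, Fin.ext h⟩
  · obtain ⟨l₁, l₂, h1, h2, h3⟩ := exists_elems_eq_append hv
    have hlen : l₁.length < 7 := by
      have := congrArg List.length h1
      rw [hw, List.length_append] at this
      omega
    refine ⟨(⟨l₁.length, hlen⟩ : Fin 7).insertNth v fun k => ⟨_, hg k⟩, ?_, fun A => ?_⟩
    · have hcoe : (fun k => (((⟨l₁.length, hlen⟩ : Fin 7).insertNth v
          (fun k => ⟨_, hg k⟩ : Fin 6 → Fin 17) : Fin 7 → Fin 17) k : ℕ)) =
          (⟨l₁.length, hlen⟩ : Fin 7).insertNth (v : ℕ)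
            fun k : Fin 6 => (elems w)[(k : ℕ)]'(by rw [hw]; exact k.2) := by
        funext k
        refine Fin.succAboveCases (⟨l₁.length, hlen⟩ : Fin 7) ?_ (fun k => ?_) k
        · simp
        · simp
      have hofn : List.ofFn (fun k : Fin 6 => (elems w)[(k : ℕ)]'(by rw [hw]; exact k.2)) =
          elems w := by
        apply List.ext_getElem
        · simp [hw]
        · intro i _ _
          rw [List.getElem_ofFn]
      rw [hcoe, ofFn_insertNth, hofn, h1, h2]
      simp
    · rw [h3, orientDet_insertNth]

theorem sign_boolSign (s : Bool) :
    SignType.sign (boolSign s) = if s then -1 else 1 := by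
  cases s <;> simp [boolSign]

/-- If `χ` determines the position of `w ∪ {a}` and of `w ∪ {b}` correctly, then `rel χ w a b` is
the sign of a barycentric coordinate. -/
theorem sign_coord_of_sign_orientDet {χ : List ℕ → SignType} {A : Fin 17 → Fin 6 → ℝ} {w : ℕ}
    {a b : Fin 17} (hv : validWall w a b = true)
    (hA : ∀ v : Fin 17, (v = a ∨ v = b) → ∀ I : Fin 7 → Fin 17,
      (List.ofFn fun k => (I k : ℕ)) = elems (flipBit w v) →
      SignType.sign (orientDet A I) = χ (elems (flipBit w v)))
    (ha : χ (elems (flipBit w a)) ≠ 0) :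
    IsSimplex A (insert a (bits w)) ∧
      SignType.sign (coord A (insert a (bits w)) a (A b)) = rel χ w a b := by
  have hrel : rel χ w a b = mulSign (Bool.xor (par w a) (par w b)) (χ (elems (flipBit w a)))
      (χ (elems (flipBit w b))) := by rw [rel, hv]
  obtain ⟨hlen, hta, htb⟩ := validWall_iff.1 hv
  obtain ⟨g, hg, hI⟩ := exists_orientDet_cons hlen
  obtain ⟨I, hIl, hIA⟩ := hI a hta
  obtain ⟨J, hJl, hJA⟩ := hI b htb
  have sI := hA a (Or.inl rfl) I hIl
  have sJ := hA b (Or.inr rfl) J hJl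
  rw [hIA, sign_mul, sign_boolSign] at sI
  rw [hJA, sign_mul, sign_boolSign] at sJ
  have hne : orientDet A (Fin.cons a g) ≠ 0 := by
    intro h0
    rw [h0, sign_zero, mul_zero] at sI
    exact ha sI.symm
  have him : insert a (Finset.univ.image g) =
      Finset.univ.image (Fin.cons a g : Fin 7 → Fin 17) := by
    ext i
    simp [Fin.exists_fin_succ, eq_comm]
  have hs : IsSimplex A (insert a (Finset.univ.image g)) :=
    isSimplex_of_orientDet_ne_zero hne him
  have hag : ∀ k, g k ≠ a := fun k hk => by
    have : a ∈ bits w := by rw [← hg, ← hk]; exact Finset.mem_image_of_mem g (Finset.mem_univ k)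
    rw [mem_bits, hta] at this
    exact Bool.noConfusion this
  have hc := congrArg SignType.sign (coord_mul_orientDet hs hag b)
  rw [sign_mul] at hc
  rw [← hg]
  refine ⟨hs, ?_⟩
  rw [hrel, mulSign_eq, ← sI, ← sJ, ← hc]
  have hD : SignType.sign (orientDet A (Fin.cons a g : Fin 7 → Fin 17)) ≠ 0 := by
    rwa [ne_eq, sign_eq_zero_iff]
  generalize SignType.sign (orientDet A (Fin.cons a g : Fin 7 → Fin 17)) = x at hD
  generalize SignType.sign (coord A (insert a (Finset.univ.image g)) a (A b)) = y
  revert hD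
  generalize par w a = p
  generalize par w b = q
  -- The parity signs and the nonzero sign `x` of the common determinant occur squared, so `y`
  -- remains.
  cases p <;> cases q <;> cases x <;> cases y <;> decide

theorem Realizes.sign_coord {χ : List ℕ → SignType} {A : Fin 17 → Fin 6 → ℝ} (h : Realizes χ A)
    {w : ℕ} {a b : Fin 17} (hr : rel χ w a b ≠ 0) :
    testb w a = false ∧ testb w b = false ∧ IsSimplex A (insert a (bits w)) ∧
      SignType.sign (coord A (insert a (bits w)) a (A b)) = rel χ w a b := by
  have hv : validWall w a b = true := by
    by_contra hv
    rw [Bool.not_eq_true] at hv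
    exact hr (by rw [rel, hv])
  have hrel : rel χ w a b = mulSign (Bool.xor (par w a) (par w b)) (χ (elems (flipBit w a)))
      (χ (elems (flipBit w b))) := by rw [rel, hv]
  rw [hrel, mulSign_eq] at hr
  have ha : χ (elems (flipBit w a)) ≠ 0 := fun h0 => hr (by rw [h0, zero_mul, mul_zero])
  have hb : χ (elems (flipBit w b)) ≠ 0 := fun h0 => hr (by rw [h0, mul_zero, mul_zero])
  refine ⟨(validWall_iff.1 hv).2.1, (validWall_iff.1 hv).2.2,
    sign_coord_of_sign_orientDet hv (fun v hv I hI => ?_) ha⟩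
  rw [← hI]
  refine h I ?_
  rw [hI]
  rcases hv with rfl | rfl
  · exact ha
  · exact hb

/-! ### Supporting hyperplanes -/

/-- The affine function that vanishes on `f` and is `1` at the point `0`. -/
noncomputable def height (A : Fin 17 → Fin 6 → ℝ) (f : Finset (Fin 17)) :
    (Fin 6 → ℝ) →ᵃ[ℝ] ℝ := coord A (insert 0 f) 0

/-- The hyperplane spanned by `f` supports the configuration `A`. -/
structure IsSupporting (A : Fin 17 → Fin 6 → ℝ) (f : Finset (Fin 17)) : Prop where
  isSimplex : IsSimplex A (insert 0 f)
  zero_notMem : 0 ∉ f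
  nonneg : ∀ j, 0 ≤ height A f (A j)

/-- `f` spans a facet of the configuration `A`. -/
structure IsFacet (A : Fin 17 → Fin 6 → ℝ) (f : Finset (Fin 17)) : Prop
    extends IsSupporting A f where
  pos : ∀ j ∉ f, 0 < height A f (A j)

theorem height_zero {A : Fin 17 → Fin 6 → ℝ} {f : Finset (Fin 17)}
    (h : IsSimplex A (insert 0 f)) : height A f (A 0) = 1 := by
  rw [height, h.coord_vertex (Finset.mem_insert_self _ _) (Finset.mem_insert_self _ _), if_pos rfl]

theorem height_of_mem {A : Fin 17 → Fin 6 → ℝ} {f : Finset (Fin 17)}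
    (h : IsSimplex A (insert 0 f)) (h0 : 0 ∉ f) {i : Fin 17} (hi : i ∈ f) :
    height A f (A i) = 0 := by
  rw [height, h.coord_vertex (Finset.mem_insert_self _ _) (Finset.mem_insert_of_mem hi),
    if_neg fun e : 0 = i => h0 (e ▸ hi)]

/-- Both functions vanish on the wall `f`, so they are proportional, with factor given by the value
at `v`. -/
theorem coord_mul_height {A : Fin 17 → Fin 6 → ℝ} {f σ : Finset (Fin 17)} {v : Fin 17}
    (h : IsSimplex A (insert 0 f)) (h0 : 0 ∉ f) (hσ : IsSimplex A σ) (hv : v ∈ σ)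
    (hf : σ.erase v = f) (x : Fin 6 → ℝ) :
    coord A σ v x * height A f (A v) = height A f x := by
  rw [hσ.affineMap_apply (height A f) x]
  symm
  refine Finset.sum_eq_single_of_mem v hv fun i hi hiv => ?_
  rw [height_of_mem h h0 (hf ▸ Finset.mem_erase.2 ⟨hiv, hi⟩), mul_zero]

namespace IsSupporting

variable {A : Fin 17 → Fin 6 → ℝ} {f : Finset (Fin 17)}

theorem height_of_mem (h : IsSupporting A f) {i : Fin 17} (hi : i ∈ f) : height A f (A i) = 0 :=
  PointConfig.height_of_mem h.isSimplex h.zero_notMem hi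

theorem height_pos (h : IsSupporting A f) {σ : Finset (Fin 17)} {v : Fin 17}
    (hσ : IsSimplex A σ) (hv : v ∈ σ) (hf : σ.erase v = f) : 0 < height A f (A v) := by
  refine lt_of_le_of_ne (h.nonneg v) fun h0 => ?_
  have := coord_mul_height h.isSimplex h.zero_notMem hσ hv hf (A 0)
  rw [← h0, mul_zero, height_zero h.isSimplex] at this
  exact zero_ne_one this

theorem coord_nonneg (h : IsSupporting A f) {σ : Finset (Fin 17)} {v : Fin 17}
    (hσ : IsSimplex A σ) (hv : v ∈ σ) (hf : σ.erase v = f) (j : Fin 17) :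
    0 ≤ coord A σ v (A j) := by
  have h1 := coord_mul_height h.isSimplex h.zero_notMem hσ hv hf (A j)
  have h2 := h.height_pos hσ hv hf
  have h3 := h.nonneg j
  rw [← h1] at h3
  exact nonneg_of_mul_nonneg_left h3 h2

theorem card (h : IsSupporting A f) : f.card = 6 := by
  have := h.isSimplex.card
  rw [Finset.card_insert_of_notMem h.zero_notMem] at this
  omega

theorem nonneg_of_mem_convexHull (h : IsSupporting A f) {x : Fin 6 → ℝ}
    (hx : x ∈ convexHull ℝ (Set.range A)) : 0 ≤ height A f x :=
  affineMap_nonneg_of_mem_convexHull _ h.nonneg hx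

theorem _root_.PointConfig.IsFacet.coord_pos (h : IsFacet A f) {σ : Finset (Fin 17)} {v : Fin 17}
    (hσ : IsSimplex A σ) (hv : v ∈ σ) (hf : σ.erase v = f) {j : Fin 17} (hj : j ∉ f) :
    0 < coord A σ v (A j) := by
  have h1 := coord_mul_height h.isSimplex h.zero_notMem hσ hv hf (A j)
  have h2 := h.height_pos hσ hv hf
  have h3 := h.pos j hj
  rw [← h1] at h3
  exact pos_of_mul_pos_left h3 h2.le

end IsSupporting

/-! ### Soundness of the checks -/

theorem isPos_iff {x : SignType} : isPos x = true ↔ x = 1 := by cases x <;> decide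

theorem isNeg_iff {x : SignType} : isNeg x = true ↔ x = -1 := by cases x <;> decide

theorem isZero_iff {x : SignType} : isZero x = true ↔ x = 0 := by cases x <;> decide

/-- The family of the sets with bit masks in `l`. -/
def family (l : List ℕ) : Finset (Finset (Fin 17)) := (l.map bits).toFinset

theorem mem_family {l : List ℕ} {σ : Finset (Fin 17)} : σ ∈ family l ↔ ∃ c ∈ l, bits c = σ := by
  simp [family]

theorem bits_mem_family {l : List ℕ} {c : ℕ} (h : c ∈ l) : bits c ∈ family l :=
  mem_family.2 ⟨c, h, rfl⟩

theorem bool_rec_true {b c : Bool} : (Bool.rec c true b : Bool) = true ↔ (b = false → c = true) := by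
  cases b <;> simp

theorem bool_rec_false {b c : Bool} : (Bool.rec false c b : Bool) = true ↔ b = true ∧ c = true := by
  cases b <;> simp

section

variable {χ : List ℕ → SignType} {A : Fin 17 → Fin 6 → ℝ}

theorem Realizes.coord_pos (h : Realizes χ A) {w : ℕ} {a b : Fin 17}
    (hr : isPos (rel χ w a b) = true) :
    testb w a = false ∧ testb w b = false ∧ IsSimplex A (insert a (bits w)) ∧
      0 < coord A (insert a (bits w)) a (A b) := by
  rw [isPos_iff] at hr
  obtain ⟨h1, h2, h3, h4⟩ := h.sign_coord (by rw [hr]; decide)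
  exact ⟨h1, h2, h3, sign_eq_one_iff.1 (h4.trans hr)⟩

theorem Realizes.coord_neg (h : Realizes χ A) {w : ℕ} {a b : Fin 17}
    (hr : isNeg (rel χ w a b) = true) :
    testb w a = false ∧ testb w b = false ∧ IsSimplex A (insert a (bits w)) ∧
      coord A (insert a (bits w)) a (A b) < 0 := by
  rw [isNeg_iff] at hr
  obtain ⟨h1, h2, h3, h4⟩ := h.sign_coord (by rw [hr]; decide)
  exact ⟨h1, h2, h3, sign_eq_neg_one_iff.1 (h4.trans hr)⟩

theorem Realizes.isFacet (h : Realizes χ A) {f : ℕ} (hf : facetOK χ f = true) :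
    IsFacet A (bits f) := by
  rw [facetOK, Bool.and_eq_true, alls_iff] at hf
  obtain ⟨h0, h1⟩ := hf
  have h0' : testb f 0 = false := by simpa using h0
  have key : ∀ j : Fin 17, j ∉ bits f → IsSimplex A (insert 0 (bits f)) ∧
      0 < height A (bits f) (A j) := fun j hj => by
    rw [mem_bits, Bool.not_eq_true] at hj
    have := bool_rec_true.1 (h1 j (mem_labels.2 j.2)) hj
    exact (h.coord_pos (a := 0) this).2.2
  have h0m : (0 : Fin 17) ∉ bits f := by rw [mem_bits]; simpa using h0'
  have hs := (key 0 h0m).1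
  refine ⟨⟨hs, h0m, fun j => ?_⟩, fun j hj => (key j hj).2⟩
  by_cases hj : j ∈ bits f
  · exact (height_of_mem hs h0m hj).ge
  · exact (key j hj).2.le

theorem Realizes.isSimplex_of_offOK (h : Realizes χ A) {f : ℕ} (hf : offOK χ f = true) :
    IsSimplex A (insert 0 (bits f)) ∧ 0 ∉ bits f ∧ ∀ j : Fin 17, j ∉ bits f →
      rel χ f 0 j ≠ 0 ∧ SignType.sign (height A (bits f) (A j)) = rel χ f 0 j := by
  rw [offOK, Bool.and_eq_true, alls_iff] at hf
  obtain ⟨h0, h1⟩ := hf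
  have h0' : testb f 0 = false := by simpa using h0
  have key : ∀ j : Fin 17, j ∉ bits f → rel χ f 0 j ≠ 0 := fun j hj => by
    rw [mem_bits, Bool.not_eq_true] at hj
    have := bool_rec_true.1 (h1 j (mem_labels.2 j.2)) hj
    intro e
    rw [e] at this
    exact Bool.noConfusion this
  have h0m : (0 : Fin 17) ∉ bits f := by rw [mem_bits]; simpa using h0'
  exact ⟨(h.sign_coord (a := 0) (key 0 h0m)).2.2.1, h0m,
    fun j hj => ⟨key j hj, (h.sign_coord (a := 0) (key j hj)).2.2.2⟩⟩

theorem mem_others {T : List ℕ} {c w c' : ℕ} :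
    c' ∈ others T c w ↔ c' ∈ T ∧ subMask w c' = true ∧ c' ≠ c := by
  rw [others, filt_eq, List.mem_filter, bool_rec_false, Bool.not_eq_true', Bool.eq_false_iff,
    ne_eq, Nat.beq_eq]

theorem wallOK_cases {bd T : List ℕ} {c v : ℕ} (h : wallOK χ bd T c v = true) :
    (others T c (flipBit c v) = [] ∧ flipBit c v ∈ bd) ∨
    ∃ u : Fin 17, testb c u = false ∧ others T c (flipBit c v) = [flipBit (flipBit c v) u] ∧
      isNeg (rel χ (flipBit c v) v u) = true := by
  rcases hl : others T c (flipBit c v) with _ | ⟨c', _ | ⟨c'', l⟩⟩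
  · simp only [wallOK, hl] at h
    obtain ⟨f, hf, hf'⟩ := anys_iff.1 h
    rw [Nat.beq_eq] at hf'
    exact Or.inl ⟨rfl, hf' ▸ hf⟩
  · simp only [wallOK, hl, Bool.and_eq_true, Nat.blt_eq, Nat.beq_eq, Bool.not_eq_true'] at h
    obtain ⟨⟨h1, h2⟩, h3, h4⟩ := h
    exact Or.inr ⟨⟨_, h1⟩, h2, by rw [h3], h4⟩
  · simp [wallOK, hl] at h

/-- The check of walls on bit masks supplies the hypotheses of `isTriangulation_of_walls`: a wall in
no other cell must be in `bd`, and any other wall must separate two cells. -/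
theorem Realizes.isTriangulation (h : Realizes χ A) {bd T : List ℕ}
    (hT : ∀ c ∈ T, IsSimplex A (bits c)) (hbd : ∀ f ∈ bd, IsSupporting A (bits f))
    (hok : cellsOK χ bd T = true)
    (hstrict : ∃ c ∈ T, ∃ v ∈ bits c, others T c (flipBit c v) = [] ∧
      IsFacet A (bits (flipBit c v))) :
    IsTriangulation A (family T) := by
  have huniq : ∀ c v, ∀ τ ∈ family T, bits (flipBit c v) ⊆ τ →
      τ = bits c ∨ ∃ c' ∈ others T c (flipBit c v), bits c' = τ := by
    intro c v τ hτ hsub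
    obtain ⟨c', hc', rfl⟩ := mem_family.1 hτ
    by_cases hcc : c' = c
    · exact Or.inl (by rw [hcc])
    · exact Or.inr ⟨c', mem_others.2 ⟨hc', subMask_iff.2 hsub, hcc⟩, rfl⟩
  refine isTriangulation_of_walls (by norm_num) ?_ ?_ ?_
  · intro σ hσ
    obtain ⟨c, hc, rfl⟩ := mem_family.1 hσ
    exact hT c hc
  · intro σ hσ v hv
    obtain ⟨c, hc, rfl⟩ := mem_family.1 hσ
    have hv' := mem_bits.1 hv
    have hw := bits_flipBit_of_mem hv'
    have hok' := alls_iff.1 (alls_iff.1 hok c hc) v (mem_elems.2 ⟨v.2, hv'⟩)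
    rcases wallOK_cases hok' with ⟨-, h1⟩ | ⟨u, hu, h1, h2⟩
    · exact Or.inr fun j => (hbd _ h1).coord_nonneg (hT c hc) hv hw.symm j
    · refine Or.inl ⟨u, by rw [mem_bits, hu]; exact Bool.noConfusion, ?_, ?_, ?_⟩
      · have hwu : testb (flipBit c v) u = false := by
          have := (h.coord_neg h2).2.1
          exact this
        rw [← hw, ← bits_flipBit_of_notMem hwu]
        have : flipBit (flipBit c v) u ∈ others T c (flipBit c v) := by rw [h1]; simp
        exact bits_mem_family (mem_others.1 this).1
      · have := (h.coord_neg h2).2.2.2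
        rwa [hw, Finset.insert_erase hv] at this
      · intro τ hτ hsub
        rw [← hw] at hsub
        rcases huniq c v τ hτ hsub with h3 | ⟨c', hc', h3⟩
        · exact Or.inl h3
        · rw [h1, List.mem_singleton] at hc'
          right
          rw [← h3, hc', bits_flipBit_of_notMem (h.coord_neg h2).2.1, hw]
  · obtain ⟨c, hc, v, hv, h1, h2⟩ := hstrict
    have hw := bits_flipBit_of_mem (mem_bits.1 hv)
    refine ⟨bits c, bits_mem_family hc, v, hv, fun j hj => ?_, fun τ hτ hsub => ?_⟩
    · rw [hw] at h2
      exact h2.coord_pos (hT c hc) hv rfl hj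
    · rw [← hw] at hsub
      rcases huniq c v τ hτ hsub with h3 | ⟨c', hc', h3⟩
      · exact h3
      · rw [h1] at hc'
        exact absurd hc' (by simp)

end

theorem mem_cone {l : List ℕ} {c : ℕ} : c ∈ cone l ↔ ∃ f ∈ l, Nat.lor 1 f = c := by
  induction l with
  | nil => simp [cone]
  | cons a l ih =>
    rw [List.exists_mem_cons_iff, ← ih]
    change c ∈ Nat.lor 1 a :: cone l ↔ _
    rw [List.mem_cons, eq_comm]

theorem bits_lor_one (f : ℕ) : bits (Nat.lor 1 f) = insert 0 (bits f) := by
  ext i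
  rw [mem_bits, Finset.mem_insert, mem_bits, testb_eq, testb_eq]
  change (1 ||| f).testBit i = true ↔ _
  rw [Nat.testBit_or, Bool.or_eq_true, Nat.testBit_one_eq_true_iff_self_eq_zero]
  simp

/-! ### Flips that would destroy a frozen facet -/

/-- A negative coordinate of `x` puts `c` into `P`, so `t ∪ {x}` with `t = g \ {c}` is a cell. The
face `k` is `t` with `i` replaced by `z`, and `z` lies on the inner side of the walls opposite to
`x` and to `i`. So `k` enters this cell through `t \ {i}`. -/
theorem crossing_false {A : Fin 17 → Fin 6 → ℝ} (hA : Realizes chi A)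
    {T : Finset (Finset (Fin 17))} (hT : IsTriangulation A T) {P Q : Finset (Fin 17)}
    (hC : IsCircuit A P Q) {g k c : ℕ} {x : Fin 17} (hx : x ∈ P)
    (hsub : P ∪ Q ⊆ insert x (bits g)) (hxg : x ∉ bits g)
    (hcells : ∀ c ∈ P, (insert x (bits g)).erase c ∈ T) (hk : ∃ τ ∈ T, bits k ⊆ τ)
    (hcr : crossing g x k c = true) : False := by
  simp only [crossing, Bool.and_eq_true, Nat.blt_eq, Nat.beq_eq, Bool.not_eq_true',
    Bool.eq_false_iff, ne_eq] at hcr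
  obtain ⟨⟨⟨⟨hgc, hc⟩, hz, hi⟩, hxz, hti⟩, hk', hcx, hxz', hiz⟩ := hcr
  set z : Fin 17 := ⟨_, hz⟩ with hzdef
  set i : Fin 17 := ⟨_, hi⟩ with hidef
  obtain ⟨c, rfl⟩ : ∃ c' : Fin 17, (c' : ℕ) = c := ⟨⟨c, hc⟩, rfl⟩
  set t := flipBit g c with ht
  change testb t i = true at hti
  change flipBit (flipBit t i) z = k at hk'
  change isPos (rel chi t x z) = true at hxz'
  change isPos (rel chi (flipBit (flipBit t i) x) i z) = true at hiz
  have hbt : bits t = (bits g).erase c := bits_flipBit_of_mem hgc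
  have hcg : c ∈ bits g := mem_bits.2 hgc
  obtain ⟨-, -, hs1, hneg⟩ := hA.coord_neg hcx
  rw [hbt, Finset.insert_erase hcg] at hs1 hneg
  have hcP := hC.mem_of_coord_neg hs1 hx hsub hxg hcg hneg
  have hcell := hcells c hcP
  have hxc : x ≠ c := fun e => hxg (e ▸ hcg)
  rw [Finset.erase_insert_of_ne hxc, ← hbt] at hcell
  obtain ⟨htx, htz, hs2, hpos1⟩ := hA.coord_pos hxz'
  have hbti : bits (flipBit t i) = (bits t).erase i := bits_flipBit_of_mem hti
  have hit : i ∈ bits t := mem_bits.2 hti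
  have hxt : x ∉ bits t := by rw [mem_bits, htx]; exact Bool.noConfusion
  have hzt : z ∉ bits t := by rw [mem_bits, htz]; exact Bool.noConfusion
  have hf : ∀ {w : ℕ} {a : Fin 17}, a ∉ bits w → testb w a = false := fun h => by
    rwa [mem_bits, Bool.not_eq_true] at h
  have hbk : bits k = insert z ((bits t).erase i) := by
    rw [← hk', bits_flipBit_of_notMem (hf fun h => hzt ?_), hbti]
    rw [hbti] at h
    exact Finset.mem_of_mem_erase h
  obtain ⟨τ', hτ', hkτ⟩ := hk
  obtain ⟨-, -, hs3, hpos2⟩ := hA.coord_pos hiz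
  rw [bits_flipBit_of_notMem (hf fun h => hxt (by
    rw [hbti] at h
    exact Finset.mem_of_mem_erase h)), hbti, Finset.insert_comm, Finset.insert_erase hit] at hpos2
  have hxz2 : z ≠ x := fun e => hxz (congrArg Fin.val e).symm
  have hzk : z ∈ bits k := by rw [hbk]; exact Finset.mem_insert_self _ _
  have herase : (bits k).erase z = (bits t).erase i := by
    rw [hbk, Finset.erase_insert fun h => hzt (Finset.mem_of_mem_erase h)]
  refine hT.not_crossing hcell hτ' hkτ hzk ?_ ?_ ?_ ?_
  · rw [Finset.mem_insert, not_or]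
    exact ⟨hxz2, hzt⟩
  · rw [herase]
    exact (Finset.erase_subset _ _).trans (Finset.subset_insert _ _)
  · rw [herase, ← Finset.card_pos, Finset.card_erase_of_mem hit]
    have := hs2.card
    rw [Finset.card_insert_of_notMem hxt] at this
    omega
  · intro j hj hjk
    rcases Finset.mem_insert.1 hj with rfl | hj
    · exact hpos1
    · have : j = i := by
        by_contra hji
        exact hjk (hbk ▸ Finset.mem_insert_of_mem (Finset.mem_erase.2 ⟨hji, hj⟩))
      rw [this]
      exact hpos2

theorem bool_rec_true_false {b c : Bool} :
    (Bool.rec true c b : Bool) = true ↔ (b = true → c = true) := by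
  cases b <;> simp

/-- The order in which candidates for `k` and `c` are tried is immaterial; each success of the
search is a valid crossing. -/
theorem exists_crossing_of_killAll {ks : List ℕ} {f y v : ℕ} (h : killAll ks f y v = true)
    {x : ℕ} (hx : x < 17) (hxf : testb f x = false) (hpos : isPos (rel chi f 0 x) = true) :
    ∃ k ∈ ks, ∃ c, crossing (flipBit f y) x k c = true := by
  unfold killAll at h
  extract_lets g r cs at h
  have h1 := bool_rec_true_false.1 (bool_rec_true.1 (alls_iff.1 h x (mem_labels.2 hx)) hxf) hpos
  have hfilt : ∀ (p : ℕ → Bool) {k : ℕ} {l : List ℕ}, k ∈ filt p l → k ∈ l := fun p k l hk => by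
    rw [filt_eq] at hk
    exact List.mem_of_mem_filter hk
  revert h1
  generalize anys (fun k => testb k v) _ = b
  cases b <;> intro h1
  · obtain ⟨k, hk, h2⟩ := anys_iff.1 h1
    refine ⟨k, hfilt _ hk, ?_⟩
    revert h2
    generalize hb : crossing (flipBit f y) x k (twin v) = b
    cases b <;> intro h2
    · exact ⟨_, h2⟩
    · exact ⟨_, hb⟩
  · obtain ⟨k, hk, h2⟩ := anys_iff.1 h1
    exact ⟨k, hfilt _ (hfilt _ hk), _, h2⟩

theorem exists_crossing_of_killOK {ks : List ℕ} {f : ℕ} (h : killOK ks f = true) {x y : ℕ}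
    (hx : x < 17) (hxf : testb f x = false) (hpos : isPos (rel chi f 0 x) = true)
    (hy : y < 17) (hyf : testb f y = false) (hneg : isNeg (rel chi f 0 y) = true) :
    ∃ k ∈ ks, ∃ c, crossing (flipBit f y) x k c = true := by
  unfold killOK at h
  have hmem : y ∈ filt (fun j => Bool.rec (isNeg (rel chi f 0 j)) false (testb f j)) labels := by
    rw [filt_eq, List.mem_filter]
    exact ⟨mem_labels.2 hy, by rw [hyf]; exact hneg⟩
  generalize filt (fun j => Bool.rec (isNeg (rel chi f 0 j)) false (testb f j)) labels = l
    at h hmem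
  rcases l with _ | ⟨u, _ | ⟨v, _ | ⟨w, l⟩⟩⟩
  · exact Bool.noConfusion h
  · exact Bool.noConfusion h
  · obtain ⟨h1, h2⟩ := Bool.and_eq_true _ _ ▸ (h : (killAll ks f u v && killAll ks f v u) = true)
    simp only [List.mem_cons, List.not_mem_nil, or_false] at hmem
    rcases hmem with rfl | rfl
    · exact exists_crossing_of_killAll h1 hx hxf hpos
    · exact exists_crossing_of_killAll h2 hx hxf hpos
  · exact Bool.noConfusion h

/-- There are points of the configuration on both sides of `f`, so `f` lies in a cell `f ∪ {x}` on
the side of `O` and in a cell `f ∪ {y}` beyond. A flip destroying `f` would create the situation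
excluded by `crossing_false`. -/
theorem not_lost_of_killOK {A : Fin 17 → Fin 6 → ℝ} (hA : Realizes chi A)
    {T : Finset (Finset (Fin 17))} (hT : IsTriangulation A T) {P Q : Finset (Fin 17)}
    {L : Finset (Finset (Fin 17))} (hS : SupportsFlip A T P Q L) {ks : List ℕ} {f : ℕ}
    (hks : ∀ k ∈ ks, ∃ τ ∈ T, bits k ⊆ τ) (hf : f ∈ ks) (hoff : offOK chi f = true)
    (hkill : killOK ks f = true) (hneg : ∃ y : Fin 17, isNeg (rel chi f 0 y) = true) :
    ∃ τ' ∈ flipped T P Q L, bits f ⊆ τ' := by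
  by_contra hlost
  push Not at hlost
  obtain ⟨hs, h0, hsign⟩ := hA.isSimplex_of_offOK hoff
  obtain ⟨τ, hτ, hsub⟩ := hks f hf
  have hτs := hT.isSimplex hτ
  have hcardf : (bits f).card = 6 := by
    have := hs.card
    rw [Finset.card_insert_of_notMem h0] at this
    omega
  obtain ⟨v, hv⟩ : ∃ v, τ \ bits f = {v} := Finset.card_eq_one.1 (by
    rw [Finset.card_sdiff_of_subset hsub, hτs.card, hcardf])
  have hvτ : v ∈ τ ∧ v ∉ bits f := by
    rw [← Finset.mem_sdiff, hv]; exact Finset.mem_singleton_self v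
  have hτeq : insert v (bits f) = τ := by
    rw [← Finset.sdiff_union_of_subset hsub, hv]; rfl
  have herase : τ.erase v = bits f := by rw [← hτeq, Finset.erase_insert hvτ.2]
  have hne : ∀ j ∉ bits f, height A (bits f) (A j) ≠ 0 := fun j hj h => by
    obtain ⟨h1, h2⟩ := hsign j hj
    rw [h, sign_zero] at h2
    exact h1 h2.symm
  have hmul := fun x => coord_mul_height hs h0 hτs hvτ.1 herase x
  -- the points on both sides of the wall
  have hposneg : ∃ x y, (x ∉ bits f ∧ insert x (bits f) ∈ T ∧ 0 < height A (bits f) (A x)) ∧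
      (y ∉ bits f ∧ insert y (bits f) ∈ T ∧ height A (bits f) (A y) < 0) := by
    have hnb : ∀ j, coord A τ v (A j) < 0 → ∃ u ∉ bits f, insert u (bits f) ∈ T ∧
        coord A τ v (A u) < 0 := fun j hj => by
      obtain ⟨u, hu, h1, h2⟩ := hT.exists_neighbor (by norm_num) hτ hvτ.1 hj
      rw [herase] at h1
      exact ⟨u, fun h => hu (hτeq ▸ Finset.mem_insert_of_mem h), h1, h2⟩
    rcases lt_or_gt_of_ne (hne v hvτ.2) with h | h
    · obtain ⟨u, hu, h1, h2⟩ := hnb 0 (by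
        have := hmul (A 0)
        rw [height_zero hs] at this
        by_contra hcon
        push Not at hcon
        nlinarith)
      exact ⟨u, v, ⟨hu, h1, by rw [← hmul]; exact mul_pos_of_neg_of_neg h2 h⟩,
        hvτ.2, hτeq ▸ hτ, h⟩
    · obtain ⟨y, hy⟩ := hneg
      have hyf := (hA.coord_neg (a := 0) hy)
      obtain ⟨u, hu, h1, h2⟩ := hnb y (by
        have h3 : height A (bits f) (A y) < 0 := hyf.2.2.2
        rw [← hmul] at h3
        by_contra hcon
        push Not at hcon
        nlinarith)
      exact ⟨v, u, ⟨hvτ.2, hτeq ▸ hτ, h⟩, hu, h1, by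
        rw [← hmul]; exact mul_neg_of_neg_of_pos h2 h⟩
  obtain ⟨x, y, ⟨hxf, hxT, hx⟩, hyf, hyT, hy⟩ := hposneg
  have hxy : x ≠ y := fun e => by rw [e] at hx; exact lt_asymm hx hy
  have hsy := hT.isSimplex hyT
  obtain ⟨hxP, hsubC, hcells⟩ := hS.of_lost_wall hT hxf hyf hxy hxT hyT (fun j hj h => by
    have := coord_mul_height hs h0 hsy (Finset.mem_insert_self _ _)
      (Finset.erase_insert hyf) (A j)
    rw [h, zero_mul] at this
    exact hne j hj this.symm) hlost
  have hf' : ∀ {a : Fin 17}, a ∉ bits f → testb f a = false := fun h => by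
    rwa [mem_bits, Bool.not_eq_true] at h
  obtain ⟨k, hk, c, hcr⟩ := exists_crossing_of_killOK hkill x.2 (hf' hxf)
    (by rw [isPos_iff, ← (hsign x hxf).2, sign_pos hx]) y.2 (hf' hyf)
    (by rw [isNeg_iff, ← (hsign y hyf).2, sign_neg hy])
  rw [← bits_flipBit_of_notMem (hf' hyf)] at hsubC hcells
  refine crossing_false hA hT hS.circuit hxP hsubC ?_ hcells (hks k hk) hcr
  rw [bits_flipBit_of_notMem (hf' hyf), Finset.mem_insert, not_or]
  exact ⟨hxy, hxf⟩

/-- A lost `σ` contains `Q`. Its supporting function then vanishes on `P` as well, so the circuit is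
contained in the vertices of a simplex. -/
theorem not_lost_of_isFacet {A : Fin 17 → Fin 6 → ℝ} {T : Finset (Finset (Fin 17))}
    (hT : IsTriangulation A T) {P Q : Finset (Fin 17)} {L : Finset (Finset (Fin 17))}
    (hS : SupportsFlip A T P Q L) {σ : Finset (Fin 17)} (hσ : IsFacet A σ)
    (hsub : ∃ τ ∈ T, σ ⊆ τ) : ∃ τ' ∈ flipped T P Q L, σ ⊆ τ' := by
  by_contra hlost
  push Not at hlost
  obtain ⟨τ, hτ, hστ⟩ := hsub
  have hQ := (SupportsFlip.subset_of_lost hτ hστ hlost).1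
  have hP := hS.circuit.eq_zero_of_nonneg hσ.nonneg fun j hj => hσ.height_of_mem (hQ hj)
  refine hS.circuit.dependent ((hT.indep τ hτ).mono (Finset.union_subset ?_ (hQ.trans hστ)))
  intro j hj
  by_contra hjσ
  exact (hσ.pos j fun h => hjσ (hστ h)).ne' (hP j hj)

theorem exists_isNeg_of_killOK {ks : List ℕ} {f : ℕ} (h : killOK ks f = true) :
    ∃ y : Fin 17, isNeg (rel chi f 0 y) = true := by
  unfold killOK at h
  rcases hl : filt (fun j => Bool.rec (isNeg (rel chi f 0 j)) false (testb f j)) labels with _ | ⟨u, l⟩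
  · rw [hl] at h
    exact Bool.noConfusion h
  · have hu : u ∈ filt (fun j => Bool.rec (isNeg (rel chi f 0 j)) false (testb f j)) labels := by
      rw [hl]; exact List.mem_cons_self
    rw [filt_eq, List.mem_filter] at hu
    obtain ⟨h1, h2⟩ := hu
    refine ⟨⟨u, mem_labels.1 h1⟩, ?_⟩
    revert h2
    cases testb f u
    · exact id
    · exact fun h => Bool.noConfusion h

/-! ### The finite checks -/

/-- `c` is a simplex. -/
noncomputable def simplexOK (χ : List ℕ → SignType) (c : ℕ) : Bool :=
  let v := Nat.log2 c
  and (Nat.blt v 17) (and (testb c v) (isPos (rel χ (flipBit c v) v v)))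

theorem Realizes.isSimplex {χ : List ℕ → SignType} {A : Fin 17 → Fin 6 → ℝ} (h : Realizes χ A)
    {c : ℕ} (hc : simplexOK χ c = true) : IsSimplex A (bits c) := by
  simp only [simplexOK, Bool.and_eq_true, Nat.blt_eq] at hc
  obtain ⟨hv, hcv, hr⟩ := hc
  have := (h.coord_pos (w := flipBit c (Nat.log2 c)) (a := ⟨_, hv⟩) (b := ⟨_, hv⟩) hr).2.2.1
  have he : bits (flipBit c (Nat.log2 c)) = (bits c).erase ⟨_, hv⟩ :=
    bits_flipBit_of_mem (i := ⟨_, hv⟩) hcv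
  rwa [he, Finset.insert_erase (mem_bits.2 hcv)] at this

set_option maxRecDepth 100000

theorem facetOK_stable : alls (facetOK chi0) stableFacets = true := by decide +kernel

theorem facetOK_outer : alls (facetOK chi) outerFacets = true := by decide +kernel

theorem offOK_inner : alls (offOK chi) innerFacets = true := by decide +kernel

theorem simplexOK_outerCells : alls (simplexOK chi) outerCells = true := by decide +kernel

/-- The combinatorial heart: every possible flip at a simplex of `innerFacets` is blocked by some
other simplex of `innerFacets`. -/
theorem killOK_inner : alls (killOK innerFacets) innerFacets = true := by decide +kernel

theorem cellsOK_cone_hull : cellsOK chi (stableFacets ++ outerFacets)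
    (cone (stableFacets ++ outerFacets)) = true := by decide +kernel

theorem cellsOK_filled : cellsOK chi (stableFacets ++ outerFacets)
    (cone (stableFacets ++ innerFacets) ++ outerCells) = true := by decide +kernel

/-- The mask `911` is the cone over the stable facet `910`; this supplies the strict wall required
by the criterion for triangulations. -/
theorem others_hull : others (cone (stableFacets ++ outerFacets)) 911 910 = [] := by
  decide +kernel

theorem others_filled :
    others (cone (stableFacets ++ innerFacets) ++ outerCells) 911 910 = [] := by decide +kernel

theorem not_subMask_hull :
    alls (fun c => Bool.not (subMask 190 c)) (cone (stableFacets ++ outerFacets)) = true := by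
  decide +kernel

/-! ### Separation -/

/-- The frozen triangulation of the boundary of `conv A(0)`. -/
def frozenBoundary : Finset (Finset (Fin 17)) := family (stableFacets ++ innerFacets)

theorem isFacet_hull {A : Fin 17 → Fin 6 → ℝ} (hA : Realizes chi A)
    {f : ℕ} (hf : f ∈ stableFacets ++ outerFacets) : IsFacet A (bits f) := by
  rcases List.mem_append.1 hf with h | h
  · exact hA.chi0.isFacet (alls_iff.1 facetOK_stable f h)
  · exact hA.isFacet (alls_iff.1 facetOK_outer f h)

theorem isFacet_910 {A : Fin 17 → Fin 6 → ℝ} (hA : Realizes chi A) :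
    ∃ v ∈ bits 911, flipBit 911 v = 910 ∧ IsFacet A (bits (flipBit 911 v)) := by
  have h : flipBit 911 (0 : Fin 17) = 910 := by decide +kernel
  refine ⟨0, mem_bits.2 (by decide), h, ?_⟩
  rw [h]
  exact isFacet_hull hA (by decide)

theorem isTriangulation_hull {A : Fin 17 → Fin 6 → ℝ} (hA : Realizes chi A) :
    IsTriangulation A (family (cone (stableFacets ++ outerFacets))) := by
  obtain ⟨v, hv, he, hf⟩ := isFacet_910 hA
  refine hA.isTriangulation (fun c hc => ?_) (fun f hf => (isFacet_hull hA hf).toIsSupporting)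
    cellsOK_cone_hull ⟨911, mem_cone.2 ⟨910, by decide, rfl⟩, v, hv, ?_, hf⟩
  · obtain ⟨f, hf, rfl⟩ := mem_cone.1 hc
    rw [bits_lor_one]
    exact (isFacet_hull hA hf).isSimplex
  · rw [he, others_hull]

theorem isTriangulation_filled {A : Fin 17 → Fin 6 → ℝ} (hA : Realizes chi A)
    :
    IsTriangulation A (family (cone (stableFacets ++ innerFacets) ++ outerCells)) := by
  obtain ⟨v, hv, he, hf⟩ := isFacet_910 hA
  refine hA.isTriangulation (fun c hc => ?_) (fun f hf => (isFacet_hull hA hf).toIsSupporting)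
    cellsOK_filled ⟨911, List.mem_append_left _ (mem_cone.2 ⟨910, by decide, rfl⟩), v, hv, ?_, hf⟩
  · rcases List.mem_append.1 hc with hc | hc
    · obtain ⟨f, hf, rfl⟩ := mem_cone.1 hc
      rw [bits_lor_one]
      rcases List.mem_append.1 hf with h | h
      · exact (isFacet_hull hA (List.mem_append_left _ h)).isSimplex
      · exact (hA.isSimplex_of_offOK (alls_iff.1 offOK_inner f h)).1
    · exact hA.isSimplex (alls_iff.1 simplexOK_outerCells c hc)
  · rw [he, others_filled]

theorem containsComplex_of_isFlip {A : Fin 17 → Fin 6 → ℝ} (hA : Realizes chi A)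
    {T T' : Finset (Finset (Fin 17))} (hT : IsTriangulation A T)
    (hK : ContainsComplex T frozenBoundary) (hflip : IsFlip A T T') :
    ContainsComplex T' frozenBoundary := by
  obtain ⟨P, Q, L, hS, rfl⟩ := isFlip_iff.1 hflip
  intro σ hσ
  obtain ⟨f, hf, rfl⟩ := mem_family.1 hσ
  rcases List.mem_append.1 hf with h | h
  · exact not_lost_of_isFacet hT hS (isFacet_hull hA (List.mem_append_left _ h)) (hK _ hσ)
  · have hkill := alls_iff.1 killOK_inner f h
    exact not_lost_of_killOK hA hT hS
      (fun k hk => hK _ (bits_mem_family (List.mem_append_right _ hk))) h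
      (alls_iff.1 offOK_inner f h) hkill (exists_isNeg_of_killOK hkill)

theorem isSeparatedBy_frozenBoundary {A : Fin 17 → Fin 6 → ℝ} (hA : Realizes chi A) :
    IsSeparatedBy A frozenBoundary := by
  have h1 : ∃ T, IsTriangulation A T ∧ ContainsComplex T frozenBoundary := by
    refine ⟨_, isTriangulation_filled hA, fun σ hσ => ?_⟩
    obtain ⟨f, hf, rfl⟩ := mem_family.1 hσ
    refine ⟨_, bits_mem_family (List.mem_append_left _ (mem_cone.2 ⟨f, hf, rfl⟩)), ?_⟩
    rw [bits_lor_one]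
    exact Finset.subset_insert _ _
  have h2 : ∃ T, IsTriangulation A T ∧ ¬ ContainsComplex T frozenBoundary := by
    refine ⟨_, isTriangulation_hull hA, fun hcon => ?_⟩
    -- The mask `190` is the first simplex of `innerFacets`; no cell of the cone over the boundary
    -- contains it.
    obtain ⟨τ, hτ, hsub⟩ := hcon (bits 190) (bits_mem_family (by decide))
    obtain ⟨c, hc, rfl⟩ := mem_family.1 hτ
    have := alls_iff.1 not_subMask_hull c hc
    rw [Bool.not_eq_true', ← Bool.not_eq_true] at this
    exact this (subMask_iff.2 hsub)
  have h3 : ∀ T T', IsTriangulation A T → ContainsComplex T frozenBoundary → IsFlip A T T' →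
      ContainsComplex T' frozenBoundary := fun T T' hT hK hf =>
    containsComplex_of_isFlip hA hT hK hf
  exact ⟨h1, h2, h3, not_preconnected_flipGraph h3 h1 h2⟩

/-! ### The boundary of the convex hull -/

theorem height_eq_zero_of_mem_hull {A : Fin 17 → Fin 6 → ℝ} {f σ : Finset (Fin 17)}
    (hσ : ∀ i ∈ σ, height A f (A i) = 0) {x : Fin 6 → ℝ} (hx : x ∈ hull A σ) :
    height A f x = 0 := by
  obtain ⟨w, -, h1, rfl⟩ := mem_hull_iff.1 hx
  rw [affineMap_sum _ _ _ _ h1]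
  exact Finset.sum_eq_zero fun i hi => by rw [hσ i hi, mul_zero]

/-- A step from `x` away from `A 0`, towards `2 x - A 0` of height `-1`, leaves the closed
half-space containing the hull. -/
theorem IsSupporting.notMem_interior {A : Fin 17 → Fin 6 → ℝ} {f : Finset (Fin 17)}
    (h : IsSupporting A f) {x : Fin 6 → ℝ} (hx : height A f x = 0) :
    x ∉ interior (convexHull ℝ (Set.range A)) := by
  intro hxi
  have hlim : Filter.Tendsto (fun ε : ℝ => x + ε • ((2 : ℝ) • x - A 0 - x)) (𝓝[>] 0) (𝓝 x) :=
    tendsto_add_smul_sub x ((2 : ℝ) • x - A 0)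
  have hev := hlim.eventually (isOpen_interior.mem_nhds hxi)
  obtain ⟨ε, hmem, hε⟩ := (hev.and (eventually_mem_nhdsWithin : ∀ᶠ ε : ℝ in 𝓝[>] 0, 0 < ε)).exists
  have h1 := h.nonneg_of_mem_convexHull (interior_subset hmem)
  have h2 : height A f ((2 : ℝ) • x - A 0) = -1 := by
    have e : (2 : ℝ) • x - A 0 = A 0 + (2 : ℝ) • (x - A 0) := by module
    rw [e, affineMap_add_smul_sub, hx, height_zero h.isSimplex]
    norm_num
  rw [affineMap_add_smul_sub, hx, h2] at h1
  have hε' : 0 < ε := hε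
  linarith

theorem IsSupporting.hull_subset_frontier {A : Fin 17 → Fin 6 → ℝ} {f : Finset (Fin 17)}
    (h : IsSupporting A f) {σ : Finset (Fin 17)} (hσ : ∀ i ∈ σ, height A f (A i) = 0) :
    hull A σ ⊆ frontier (convexHull ℝ (Set.range A)) := fun _ hx =>
  ⟨subset_closure (hull_subset_convexHull_range A σ hx),
    h.notMem_interior (height_eq_zero_of_mem_hull hσ hx)⟩

theorem isClosed_convexHull_range (A : Fin 17 → Fin 6 → ℝ) :
    IsClosed (convexHull ℝ (Set.range A)) :=
  ((Set.finite_range A).isCompact_convexHull (𝕜 := ℝ)).isClosed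

theorem interior_convexHull_nonempty {A : Fin 17 → Fin 6 → ℝ} {σ : Finset (Fin 17)}
    (h : IsSimplex A σ) : (interior (convexHull ℝ (Set.range A))).Nonempty := by
  refine ⟨barycenter A σ, mem_interior.2 ⟨_, fun x hx => hull_subset_convexHull_range A σ
    (h.mem_hull.2 fun i hi => (hx i hi).le), IsSimplex.isOpen_coord_pos A σ, fun i hi => ?_⟩⟩
  rw [h.coord_barycenter subset_rfl h.nonempty hi, if_pos hi]
  exact inv_pos.2 (by exact_mod_cast h.nonempty.card_pos)

/-- The origin is the midpoint of an interior point `p` and the point `-p` of the symmetric hull. -/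
theorem apply_zero_mem_interior {A : Fin 17 → Fin 6 → ℝ} {σ : Finset (Fin 17)}
    (h : IsSimplex A σ) (h0 : A 0 = 0) (hsymm : ∀ i, ∃ j, A j = -A i) :
    A 0 ∈ interior (convexHull ℝ (Set.range A)) := by
  obtain ⟨p, hp⟩ := interior_convexHull_nonempty h
  have hneg : -p ∈ convexHull ℝ (Set.range A) := by
    have hr : -Set.range A ⊆ Set.range A := by
      rintro x ⟨i, hi⟩
      obtain ⟨j, hj⟩ := hsymm i
      exact ⟨j, by rw [hj, hi, neg_neg]⟩
    have := convexHull_mono (𝕜 := ℝ) hr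
    rw [convexHull_neg] at this
    exact this (Set.neg_mem_neg.2 (interior_subset hp))
  have := (convex_convexHull ℝ (Set.range A)).combo_interior_self_mem_interior hp hneg
    (show (0 : ℝ) < 1 / 2 by norm_num) (show (0 : ℝ) ≤ 1 / 2 by norm_num) (by norm_num)
  rw [h0]
  convert this using 1
  module

/-! ### Boundary complexes and cones from an interior point -/

section Cone

variable {A : Fin 17 → Fin 6 → ℝ} {K : Finset (Finset (Fin 17))}

/-- A common point lies in the common face of the two cones, and its coordinate at the apex is zero
because it lies in a base. -/
theorem hull_inter_of_cone (hK : ∀ σ ∈ K, IsSupporting A σ)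
    (hT : IsTriangulation A (K.image (insert 0))) {σ τ : Finset (Fin 17)} (hσ : σ ∈ K)
    (hτ : τ ∈ K) : hull A σ ∩ hull A τ = hull A (σ ∩ τ) := by
  refine Set.Subset.antisymm ?_ (Set.subset_inter (hull_mono A Finset.inter_subset_left)
    (hull_mono A Finset.inter_subset_right))
  rintro x ⟨hxσ, hxτ⟩
  have hs := (hK σ hσ).isSimplex
  have h1 : x ∈ hull A (insert 0 σ ∩ insert 0 τ) := by
    rw [← hT.inter _ (Finset.mem_image_of_mem _ hσ) _ (Finset.mem_image_of_mem _ hτ)]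
    exact ⟨hull_mono A (Finset.subset_insert _ _) hxσ, hull_mono A (Finset.subset_insert _ _) hxτ⟩
  rw [hs.mem_hull_of_subset Finset.inter_subset_left] at h1
  rw [hs.mem_hull_of_subset (Finset.inter_subset_left.trans (Finset.subset_insert _ _))]
  refine ⟨h1.1, fun i hi hiστ => ?_⟩
  by_cases hi0 : i = 0
  · rw [hi0]
    exact height_eq_zero_of_mem_hull (fun j hj => (hK σ hσ).height_of_mem hj) hxσ
  · refine h1.2 i hi fun h => hiστ ?_
    rw [Finset.mem_inter, Finset.mem_insert, Finset.mem_insert] at h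
    exact Finset.mem_inter.2 ⟨h.1.resolve_left hi0, h.2.resolve_left hi0⟩

/-- A family of supporting simplices whose cone from an interior point is a triangulation
triangulates the boundary. -/
theorem isBoundaryTriangulation_of_cone (hK : ∀ σ ∈ K, IsSupporting A σ)
    (hT : IsTriangulation A (K.image (insert 0)))
    (h0 : A 0 ∈ interior (convexHull ℝ (Set.range A))) : IsBoundaryTriangulation A K := by
  refine ⟨fun σ hσ => (hK σ hσ).card,
    fun σ hσ => (hK σ hσ).isSimplex.1.mono (Finset.subset_insert _ _),
    fun σ hσ τ hτ => hull_inter_of_cone hK hT hσ hτ, Set.Subset.antisymm ?_ ?_⟩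
  · exact Set.iUnion₂_subset fun σ hσ =>
      (hK σ hσ).hull_subset_frontier fun i hi => (hK σ hσ).height_of_mem hi
  · intro x hx
    have hxc : x ∈ convexHull ℝ (Set.range A) :=
      (isClosed_convexHull_range A).frontier_subset hx
    rw [← hT.cover] at hxc
    simp only [Set.mem_iUnion] at hxc ⊢
    obtain ⟨τ, hτ, hxτ⟩ := hxc
    obtain ⟨σ, hσ, rfl⟩ := Finset.mem_image.1 hτ
    refine ⟨σ, hσ, ?_⟩
    have hs := (hK σ hσ).isSimplex
    rw [hs.mem_hull_of_subset (Finset.subset_insert _ _)]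
    refine ⟨hs.mem_hull.1 hxτ, fun i hi hiσ => ?_⟩
    obtain rfl : i = 0 := (Finset.mem_insert.1 hi).resolve_right hiσ
    by_contra hne
    -- With positive weight at the apex, `x` is a combination of the interior point `A 0` and a
    -- point of the hull, so it is interior. The case of weight `1` at the apex is separate because
    -- the other weights cannot be normalized.
    have hpos : 0 < coord A (insert 0 σ) 0 x :=
      lt_of_le_of_ne (hs.mem_hull.1 hxτ 0 hi) (Ne.symm hne)
    refine hx.2 ?_
    have hsum := hs.sum_coord x
    have hcomb := hs.sum_coord_smul x
    rw [Finset.sum_insert hiσ] at hsum hcomb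
    set c := coord A (insert 0 σ) 0 x with hc
    have hnn : ∀ j ∈ σ, 0 ≤ coord A (insert 0 σ) j x := fun j hj =>
      hs.mem_hull.1 hxτ j (Finset.mem_insert_of_mem hj)
    set S := ∑ j ∈ σ, coord A (insert 0 σ) j x with hS
    have hS0 : 0 ≤ S := Finset.sum_nonneg hnn
    rcases hS0.eq_or_lt with hSz | hSpos
    · have hz : ∀ j ∈ σ, coord A (insert 0 σ) j x = 0 :=
        (Finset.sum_eq_zero_iff_of_nonneg hnn).1 hSz.symm
      rw [Finset.sum_eq_zero fun j hj => by rw [hz j hj, zero_smul], add_zero] at hcomb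
      have : c = 1 := by linarith
      rw [this, one_smul] at hcomb
      rw [← hcomb]
      exact h0
    · have hy : S⁻¹ • ∑ j ∈ σ, coord A (insert 0 σ) j x • A j ∈ convexHull ℝ (Set.range A) := by
        refine hull_subset_convexHull_range A σ (mem_hull_iff.2
          ⟨fun j => S⁻¹ * coord A (insert 0 σ) j x, fun j hj => ?_, ?_, ?_⟩)
        · exact mul_nonneg (inv_nonneg.2 hS0) (hnn j hj)
        · rw [← Finset.mul_sum, inv_mul_cancel₀ hSpos.ne']
        · simp_rw [mul_smul]
          rw [Finset.smul_sum]
      have := (convex_convexHull ℝ (Set.range A)).combo_interior_self_mem_interior h0 hy hpos hS0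
        hsum
      rwa [smul_inv_smul₀ hSpos.ne', hcomb] at this

/-- A boundary face cannot contain the interior apex; having as many vertices as the base, it is the
base. -/
theorem inducesOnBoundary_of_cone (hK : ∀ σ ∈ K, IsSupporting A σ)
    (h0 : A 0 ∈ interior (convexHull ℝ (Set.range A))) :
    InducesOnBoundary A (K.image (insert 0)) K := by
  intro σ
  constructor
  · intro hσ
    exact ⟨(hK σ hσ).card, ⟨_, Finset.mem_image_of_mem _ hσ, Finset.subset_insert _ _⟩,
      (hK σ hσ).hull_subset_frontier fun i hi => (hK σ hσ).height_of_mem hi⟩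
  · rintro ⟨hcard, ⟨τ, hτ, hστ⟩, hfr⟩
    obtain ⟨κ, hκ, rfl⟩ := Finset.mem_image.1 hτ
    have h0σ : 0 ∉ σ := fun h => (hfr (mem_hull_self A h)).2 h0
    have hsub : σ ⊆ κ := fun i hi =>
      (Finset.mem_insert.1 (hστ hi)).resolve_left fun e => h0σ (e ▸ hi)
    rwa [Finset.eq_of_subset_of_card_le hsub (by rw [hcard, (hK κ hκ).card])]

end Cone

/-! ### Flips do not affect a boundary without circuits -/

/-- If no circuit that supports a flip is contained in a supporting hyperplane of an element of `K`,
then flips do not affect the boundary. -/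
theorem inducesOnBoundary_flipped {A : Fin 17 → Fin 6 → ℝ} {K : Finset (Finset (Fin 17))}
    (hK : ∀ σ ∈ K, IsSupporting A σ) (hB : IsBoundaryTriangulation A K)
    {T : Finset (Finset (Fin 17))} (hTK : InducesOnBoundary A T K)
    {P Q : Finset (Fin 17)} {L : Finset (Finset (Fin 17))} (hS : SupportsFlip A T P Q L)
    (hno : ∀ κ ∈ K, ¬ ∀ i ∈ P ∪ Q, height A κ (A i) = 0) :
    InducesOnBoundary A (flipped T P Q L) K := by
  have hzero : ∀ κ ∈ K, (∀ i ∈ Q, height A κ (A i) = 0) → False := fun κ hκ hQ => by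
    refine hno κ hκ fun i hi => ?_
    rcases Finset.mem_union.1 hi with h | h
    · exact hS.circuit.eq_zero_of_nonneg (hK κ hκ).nonneg hQ i h
    · exact hQ i h
  intro σ
  constructor
  · intro hσ
    obtain ⟨h1, ⟨τ, hτ, hsub⟩, h3⟩ := (hTK σ).1 hσ
    refine ⟨h1, ?_, h3⟩
    by_contra hlost
    push Not at hlost
    have hQ := (SupportsFlip.subset_of_lost hτ hsub hlost).1
    exact hzero σ hσ fun i hi => (hK σ hσ).height_of_mem (hQ hi)
  · rintro ⟨hcard, ⟨τ', hτ', hsub⟩, hfr⟩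
    suffices h : ∃ τ ∈ T, σ ⊆ τ from (hTK σ).2 ⟨hcard, h, hfr⟩
    rcases Finset.mem_union.1 hτ' with h | h
    · exact ⟨τ', (Finset.mem_sdiff.1 h).1, hsub⟩
    · obtain ⟨ρ, hρ, q, hq, rfl⟩ := mem_join_circuit.1 h
      -- If `P ⊆ σ`, the barycenter of `σ` lies in some `κ ∈ K`. The supporting function of `κ` then
      -- vanishes on all of `σ`, hence on `P` and on the whole circuit. If some `c ∈ P` is missing,
      -- an old cell already contains `σ`.
      by_cases hP : P ⊆ σ
      · exfalso
        have hne : σ.Nonempty := Finset.card_pos.1 (by omega)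
        have hmem := hfr (barycenter_mem_hull A hne)
        rw [← hB.cover] at hmem
        simp only [Set.mem_iUnion] at hmem
        obtain ⟨κ, hκ, hbκ⟩ := hmem
        have hz := height_eq_zero_of_mem_hull (fun i hi => (hK κ hκ).height_of_mem hi) hbκ
        rw [affineMap_barycenter _ _ hne] at hz
        have hc : ((σ.card : ℝ)⁻¹) ≠ 0 := inv_ne_zero (by exact_mod_cast hne.card_pos.ne')
        have hz' := (Finset.sum_eq_zero_iff_of_nonneg fun i _ => (hK κ hκ).nonneg i).1
          ((mul_eq_zero.1 hz).resolve_left hc)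
        have hPz : ∀ i ∈ P, height A κ (A i) = 0 := fun i hi => hz' i (hP hi)
        exact hzero κ hκ (hS.circuit.symm.eq_zero_of_nonneg (hK κ hκ).nonneg hPz)
      · obtain ⟨c, hc, hcσ⟩ := Finset.not_subset.1 hP
        refine ⟨_, hS.union_mem hρ hc, fun i hi => ?_⟩
        rcases Finset.mem_union.1 (hsub hi) with h1 | h1
        · exact Finset.mem_union_left _ h1
        · have := Finset.mem_of_mem_erase h1
          rw [Finset.union_comm] at this
          exact Finset.mem_union_right _ (Finset.mem_erase.2 ⟨fun e => hcσ (e ▸ hi), this⟩)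

/-! ### Circuits in the facets with eight vertices -/

/-- A dependence that also vanishes at a point of the circuit is supported on a proper subset, which
is independent by minimality. -/
theorem IsCircuit.eq_zero_of_support {ι : Type*} [Fintype ι] [DecidableEq ι] {d : ℕ}
    {A : ι → Fin d → ℝ} {P Q : Finset ι} (h : IsCircuit A P Q) {w : ι → ℝ} (h1 : ∑ i, w i = 0)
    (h2 : ∑ i, w i • A i = 0) (hsupp : ∀ i, w i ≠ 0 → i ∈ P ∪ Q) {j : ι} (hj : j ∈ P ∪ Q)
    (hwj : w j = 0) (i : ι) : w i = 0 := by
  set S := (P ∪ Q).erase j with hS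
  have hind := h.minimal S (Finset.erase_ssubset hj)
  have hz : ∀ i, i ∉ S → w i = 0 := fun i hi => by
    by_contra hne
    refine hi (Finset.mem_erase.2 ⟨fun e => hne (e ▸ hwj), hsupp i hne⟩)
  by_cases hi : i ∈ S
  · rw [Indep, affineIndependent_iff] at hind
    have e1 : ∑ k : {k // k ∈ S}, w k = 0 := by
      rw [Finset.sum_coe_sort S w, ← h1]
      exact Finset.sum_subset (Finset.subset_univ S) fun k _ hk => hz k hk
    have e2 : ∑ k : {k // k ∈ S}, w k • A k = 0 := by
      rw [Finset.sum_coe_sort S fun k => w k • A k, ← h2]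
      exact Finset.sum_subset (Finset.subset_univ S) fun k _ hk => by rw [hz k hk, zero_smul]
    exact hind Finset.univ (fun k => w k) e1 e2 ⟨i, hi⟩ (Finset.mem_univ _)
  · exact hz i hi

/-- The coefficients `p i, q i` at `a_{i+1}⁺, a_{i+1}⁻` and `-p i, -q i` at the partners of these
points. -/
def pairing (p q : Fin 4 → ℝ) : Fin 17 → ℝ :=
  ![0, p 0, p 1, p 2, p 3, -p 0, -p 1, -p 2, -p 3,
    q 0, q 1, q 2, q 3, -q 0, -q 1, -q 2, -q 3]

theorem sum_pairing (p q : Fin 4 → ℝ) : ∑ i, pairing p q i = 0 := by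
  simp [pairing, Fin.sum_univ_succ]
  ring

theorem sum_pairing_smul {p q : Fin 4 → ℝ}
    (h1 : Real.sqrt 2 * (p 0 + q 0) + (p 1 + q 1) - (p 3 + q 3) = 0)
    (h2 : Real.sqrt 2 * (p 2 + q 2) + (p 1 + q 1) + (p 3 + q 3) = 0) :
    ∑ i, pairing p q i • config 0 i = 0 := by
  ext k
  rw [Finset.sum_apply]
  fin_cases k <;>
    simp [pairing, config, coords, Fin.sum_univ_succ] <;>
    first | ring1 | linear_combination 2 * h1 | linear_combination 2 * h2

/-- `j` is the label of a vertex of the facet number `s` of `conv A(0)`. -/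
def inFacet (s j : ℕ) : Bool :=
  and (Bool.not (Nat.beq j 0))
    (Bool.not (Bool.xor (testb s (Nat.land (Nat.pred j) 3)) (testb (Nat.pred j) 3)))

/-- An affine dependence in one of the facets. -/
theorem exists_pairing {s : ℕ} {w : Fin 17 → ℝ} (h1 : ∑ i, w i • config 0 i = 0)
    (hs : ∀ j : Fin 17, inFacet s j = false → w j = 0) :
    ∃ p q : Fin 4 → ℝ, w = pairing p q ∧
      (∀ i : Fin 4, (testb s i = false → q i = 0) ∧ (testb s i = true → p i = 0)) ∧
      Real.sqrt 2 * (p 0 + q 0) + (p 1 + q 1) - (p 3 + q 3) = 0 ∧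
      Real.sqrt 2 * (p 2 + q 2) + (p 1 + q 1) + (p 3 + q 3) = 0 := by
  have e0 := congrFun h1 0
  have e1 := congrFun h1 1
  have e2 := congrFun h1 2
  have e3 := congrFun h1 3
  have e4 := congrFun h1 4
  have e5 := congrFun h1 5
  -- Each of the first four equations involves only the points over one axis. Of these the facet
  -- contains one pair, so its two coefficients are opposite; the last two equations give the planar
  -- relation of the octagon vectors.
  simp [config, coords, Fin.sum_univ_succ, Finset.sum_apply] at e0 e1 e2 e3 e4 e5
  have hw0 : w 0 = 0 := hs 0 rfl
  have hcase : ∀ (i : ℕ) (a b c d : Fin 17),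
      (∀ x, testb s i = x → inFacet s a = !x ∧ inFacet s b = !x ∧ inFacet s c = x ∧
        inFacet s d = x) → w a + w b - w c - w d = 0 →
      (testb s i = false → w c = 0) ∧ (testb s i = true → w a = 0) ∧ w b = -w a ∧
        w d = -w c := by
    intro i a b c d h e
    cases hx : testb s i
    · obtain ⟨-, -, h3, h4⟩ := h _ hx
      have hc := hs c h3
      have hd := hs d h4
      exact ⟨fun _ => hc, fun h => Bool.noConfusion h, by linarith, by linarith⟩
    · obtain ⟨h1, h2, -, -⟩ := h _ hx
      have ha := hs a h1
      have hb := hs b h2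
      exact ⟨fun h => Bool.noConfusion h, fun _ => ha, by linarith, by linarith⟩
  have hin : ∀ (j i : ℕ) (y : Bool), (inFacet s j = (true && !(testb s i ^^ y))) →
      ∀ x, testb s i = x → inFacet s j = !(x ^^ y) := fun j i y h x hx => by rw [h, hx]; simp
  have k0 := hcase 0 1 5 9 13 (fun x hx => ⟨by simpa using hin 1 0 false rfl x hx,
    by simpa using hin 5 0 false rfl x hx, by simpa using hin 9 0 true rfl x hx,
    by simpa using hin 13 0 true rfl x hx⟩) (by linarith)
  have k1 := hcase 1 2 6 10 14 (fun x hx => ⟨by simpa using hin 2 1 false rfl x hx,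
    by simpa using hin 6 1 false rfl x hx, by simpa using hin 10 1 true rfl x hx,
    by simpa using hin 14 1 true rfl x hx⟩) (by linarith)
  have k2 := hcase 2 3 7 11 15 (fun x hx => ⟨by simpa using hin 3 2 false rfl x hx,
    by simpa using hin 7 2 false rfl x hx, by simpa using hin 11 2 true rfl x hx,
    by simpa using hin 15 2 true rfl x hx⟩) (by linarith)
  have k3 := hcase 3 4 8 12 16 (fun x hx => ⟨by simpa using hin 4 3 false rfl x hx,
    by simpa using hin 8 3 false rfl x hx, by simpa using hin 12 3 true rfl x hx,
    by simpa using hin 16 3 true rfl x hx⟩) (by linarith)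
  obtain ⟨k01, k02, k03, k04⟩ := k0
  obtain ⟨k11, k12, k13, k14⟩ := k1
  obtain ⟨k21, k22, k23, k24⟩ := k2
  obtain ⟨k31, k32, k33, k34⟩ := k3
  rw [k03, k04, k13, k14, k33, k34] at e4
  rw [k13, k14, k23, k24, k33, k34] at e5
  refine ⟨![w 1, w 2, w 3, w 4], ![w 9, w 10, w 11, w 12], ?_, ?_, ?_, ?_⟩
  · funext j
    fin_cases j
    all_goals first | exact hw0 | rfl | assumption
  · intro i
    fin_cases i
    · exact ⟨k01, k02⟩
    · exact ⟨k11, k12⟩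
    · exact ⟨k21, k22⟩
    · exact ⟨k31, k32⟩
  · simp
    linarith
  · simp
    linarith

/-- The signs of the coefficients of the circuit that avoids the pair number `m`. -/
def circuitSign (m i : ℕ) : SignType :=
  ([[0, 1, -1, 1], [1, 0, -1, 1], [1, -1, 0, 1], [1, -1, 1, 0]].getD m []).getD i 0

/-- The relations say that `c` is a linear dependence of four octagon vectors in the plane, any two
of which are independent. With one coefficient zero, it is unique up to a factor. -/
theorem exists_sign_eq {c : Fin 4 → ℝ} (h1 : Real.sqrt 2 * c 0 + c 1 - c 3 = 0)
    (h2 : Real.sqrt 2 * c 2 + c 1 + c 3 = 0) (hz : ∃ i, c i = 0) (hne : ∃ i, c i ≠ 0) :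
    ∃ m < 4, ∃ ε : SignType, ε ≠ 0 ∧ ∀ i : Fin 4, SignType.sign (c i) = ε * circuitSign m i := by
  have hs : 0 < Real.sqrt 2 := by positivity
  have key : ∀ (m : ℕ) (x : ℝ) (k : Fin 4 → ℝ), m < 4 → (∀ i, c i = x * k i) →
      (∀ i : Fin 4, SignType.sign (k i) = circuitSign m i) →
      ∃ m < 4, ∃ ε : SignType, ε ≠ 0 ∧
        ∀ i : Fin 4, SignType.sign (c i) = ε * circuitSign m i := by
    intro m x k hm hx hk
    refine ⟨m, hm, SignType.sign x, fun h0 => ?_, fun i => by rw [hx, sign_mul, hk]⟩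
    obtain ⟨i, hi⟩ := hne
    rw [sign_eq_zero_iff] at h0
    exact hi (by rw [hx, h0, zero_mul])
  obtain ⟨i, hi⟩ := hz
  fin_cases i
  · have hi : c 0 = 0 := hi
    rw [hi] at h1
    refine key 0 (c 1) ![0, 1, -(2 / Real.sqrt 2), 1] (by norm_num) (fun i => ?_) (fun i => ?_)
    · fin_cases i
      · simpa using hi
      · simp
      · change c 2 = c 1 * -(2 / Real.sqrt 2)
        field_simp
        linarith
      · change c 3 = c 1 * 1
        linarith
    · fin_cases i
      · exact sign_zero
      · exact sign_one
      · have : -(2 / Real.sqrt 2) < 0 := neg_neg_of_pos (by positivity)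
        exact sign_neg this
      · exact sign_one
  · have hi : c 1 = 0 := hi
    rw [hi] at h1 h2
    refine key 1 (c 0) ![1, 0, -1, Real.sqrt 2] (by norm_num) (fun i => ?_) (fun i => ?_)
    · fin_cases i
      · simp
      · simpa using hi
      · change c 2 = c 0 * -1
        have : Real.sqrt 2 * (c 2 + c 0) = 0 := by linarith
        have := (mul_eq_zero.1 this).resolve_left hs.ne'
        linarith
      · change c 3 = c 0 * Real.sqrt 2
        linarith
    · fin_cases i
      · exact sign_one
      · exact sign_zero
      · exact sign_neg (by norm_num)
      · exact sign_pos hs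
  · have hi : c 2 = 0 := hi
    rw [hi] at h2
    refine key 2 (c 3) ![2 / Real.sqrt 2, -1, 0, 1] (by norm_num) (fun i => ?_) (fun i => ?_)
    · fin_cases i
      · change c 0 = c 3 * (2 / Real.sqrt 2)
        field_simp
        linarith
      · change c 1 = c 3 * -1
        linarith
      · simpa using hi
      · simp
    · fin_cases i
      · have : 0 < 2 / Real.sqrt 2 := by positivity
        exact sign_pos this
      · exact sign_neg (by norm_num)
      · exact sign_zero
      · exact sign_one
  · have hi : c 3 = 0 := hi
    rw [hi] at h1 h2
    refine key 3 (c 0) ![1, -Real.sqrt 2, 1, 0] (by norm_num) (fun i => ?_) (fun i => ?_)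
    · fin_cases i
      · simp
      · change c 1 = c 0 * -Real.sqrt 2
        linarith
      · change c 2 = c 0 * 1
        have : Real.sqrt 2 * (c 2 - c 0) = 0 := by linarith
        have := (mul_eq_zero.1 this).resolve_left hs.ne'
        linarith
      · simpa using hi
    · fin_cases i
      · exact sign_one
      · exact sign_neg (neg_neg_of_pos hs)
      · exact sign_one
      · exact sign_zero

/-- The sign of the point `j` in the circuit number `m` of the facet number `s`. -/
noncomputable def pointSign (s m j : ℕ) : SignType :=
  Bool.rec 0 (Bool.rec (circuitSign m (Nat.land (Nat.pred j) 3))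
    (-circuitSign m (Nat.land (Nat.pred j) 3)) (testb (Nat.pred j) 2)) (inFacet s j)

theorem sign_pairing {s m : ℕ} {ε : SignType} {p q : Fin 4 → ℝ}
    (h : ∀ i : Fin 4, (testb s i = false → q i = 0) ∧ (testb s i = true → p i = 0))
    (hc : ∀ i : Fin 4, SignType.sign (p i + q i) = ε * circuitSign m i) (j : Fin 17) :
    SignType.sign (pairing p q j) = ε * pointSign s m j := by
  have key : ∀ (i : Fin 4) (b y : Bool) (j : ℕ), inFacet s j = (true && !(testb s i ^^ b)) →
      Nat.land (Nat.pred j) 3 = i → testb (Nat.pred j) 2 = y →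
      ∀ x : ℝ, x = (if y then -1 else 1) * (if b then q i else p i) →
      SignType.sign x = ε * pointSign s m j := by
    intro i b y j h1 h2 h3 x hx
    rw [pointSign, h1, h2, h3, hx]
    have hci := hc i
    obtain ⟨hq, hp⟩ := h i
    cases hb : testb s i
    · rw [hq hb, add_zero] at hci
      cases b <;> cases y <;> simp [hq hb, hci, Left.sign_neg]
    · rw [hp hb, zero_add] at hci
      cases b <;> cases y <;> simp [hp hb, hci, Left.sign_neg]
  fin_cases j
  · simp [pairing, pointSign, inFacet]
  · exact key 0 false false 1 rfl rfl rfl _ (by simp [pairing])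
  · exact key 1 false false 2 rfl rfl rfl _ (by simp [pairing])
  · exact key 2 false false 3 rfl rfl rfl _ (by simp [pairing])
  · exact key 3 false false 4 rfl rfl rfl _ (by simp [pairing])
  · exact key 0 false true 5 rfl rfl rfl _ (by simp [pairing])
  · exact key 1 false true 6 rfl rfl rfl _ (by simp [pairing])
  · exact key 2 false true 7 rfl rfl rfl _ (by simp [pairing])
  · exact key 3 false true 8 rfl rfl rfl _ (by simp [pairing])
  · exact key 0 true false 9 rfl rfl rfl _ (by simp [pairing])
  · exact key 1 true false 10 rfl rfl rfl _ (by simp [pairing])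
  · exact key 2 true false 11 rfl rfl rfl _ (by simp [pairing])
  · exact key 3 true false 12 rfl rfl rfl _ (by simp [pairing])
  · exact key 0 true true 13 rfl rfl rfl _ (by simp [pairing])
  · exact key 1 true true 14 rfl rfl rfl _ (by simp [pairing])
  · exact key 2 true true 15 rfl rfl rfl _ (by simp [pairing])
  · exact key 3 true true 16 rfl rfl rfl _ (by simp [pairing])

/-- The circuits of `A(0)` that are contained in a facet. -/
theorem IsCircuit.eq_of_inFacet {P Q : Finset (Fin 17)} (h : IsCircuit (config 0) P Q) {s : ℕ}
    (hs : ∀ j ∈ P ∪ Q, inFacet s j = true) :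
    ∃ m < 4, ∃ ε : SignType, ε ≠ 0 ∧
      (∀ j : Fin 17, j ∈ P ↔ pointSign s m j = ε) ∧ ∀ j : Fin 17, j ∈ Q ↔ pointSign s m j = -ε := by
  obtain ⟨w, h1, h2, h3, h4⟩ := h.sign
  have hmem : ∀ j, w j ≠ 0 ↔ j ∈ P ∪ Q := fun j => by
    rw [Finset.mem_union, ← h3, ← h4, or_comm]
    exact lt_or_lt_iff_ne.symm
  obtain ⟨p, q, rfl, hpq, e1, e2⟩ := exists_pairing (s := s) h2 fun j hj => by
    by_contra hne
    rw [hs j ((hmem j).1 hne)] at hj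
    exact Bool.noConfusion hj
  -- If all four pairs occurred, rescaling them to the dependence `(0, 1, -√2, 1)` would give a
  -- nonzero dependence on a proper subset of the circuit.
  have hzero : ∃ i, p i + q i = 0 := by
    by_contra hall
    push Not at hall
    have h2' : Real.sqrt 2 * Real.sqrt 2 = 2 := Real.mul_self_sqrt (by norm_num)
    set k : Fin 4 → ℝ := ![0, 1, -Real.sqrt 2, 1] with hk
    set p' : Fin 4 → ℝ := fun i => p i * (k i / (p i + q i)) with hp'
    set q' : Fin 4 → ℝ := fun i => q i * (k i / (p i + q i)) with hq'
    have hsum : ∀ i, p' i + q' i = k i := fun i => by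
      have := hall i
      simp only [hp', hq']
      field_simp
    have hsupp : ∀ i, pairing p' q' i ≠ 0 → pairing p q i ≠ 0 := by
      have : ∀ x y : ℝ, x * y ≠ 0 → x ≠ 0 := fun x y h => left_ne_zero_of_mul h
      intro i
      fin_cases i <;> simp [pairing, hp', hq'] <;> tauto
    have hd1 := sum_pairing_smul (p := p') (q := q')
      (by rw [hsum, hsum, hsum]; simp [hk]) (by rw [hsum, hsum, hsum]; simp [hk]; linarith)
    have hvan := fun j hj h0 => h.eq_zero_of_support (sum_pairing p' q') hd1
      (fun i hi => (hmem i).1 (hsupp i hi)) (j := j) hj h0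
    have hcon : pairing p' q' 2 = 0 ∧ pairing p' q' 10 = 0 := by
      by_cases hp0 : p 0 = 0
      · have hq0 : q 0 ≠ 0 := fun hq0 => hall 0 (by rw [hp0, hq0, add_zero])
        have := hvan 9 ((hmem 9).1 (by simpa [pairing] using hq0)) (by simp [pairing, hq', hk])
        exact ⟨this _, this _⟩
      · have := hvan 1 ((hmem 1).1 (by simpa [pairing] using hp0)) (by simp [pairing, hp', hk])
        exact ⟨this _, this _⟩
    have h11 := hsum 1
    have e3 : p' 1 = 0 := hcon.1
    have e4 : q' 1 = 0 := hcon.2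
    rw [e3, e4] at h11
    simp [hk] at h11
  have hne : ∃ i, p i + q i ≠ 0 := by
    by_contra hall
    push Not at hall
    have hp0 : ∀ i, p i = 0 ∧ q i = 0 := fun i => by
      have := hall i
      cases hb : testb s i
      · have h5 := (hpq i).1 hb
        exact ⟨by linarith, h5⟩
      · have h5 := (hpq i).2 hb
        exact ⟨h5, by linarith⟩
    obtain ⟨j, hj⟩ := h.nonempty
    refine ((h3 j).2 hj).ne' ?_
    fin_cases j <;> simp [pairing, hp0]
  obtain ⟨m, hm, ε, hε, hsign⟩ := exists_sign_eq (c := fun i => p i + q i) e1 e2 hzero hne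
  refine ⟨m, hm, ε, hε, fun j => ?_, fun j => ?_⟩
  · rw [← h3, ← sign_eq_one_iff, sign_pairing hpq hsign]
    generalize pointSign s m j = x
    revert hε
    cases ε <;> cases x <;> decide
  · rw [← h4, ← sign_eq_neg_one_iff, sign_pairing hpq hsign]
    generalize pointSign s m j = x
    revert hε
    cases ε <;> cases x <;> decide

/-! ### Finite checks for the boundary at `t = 0` -/

noncomputable section

/-- All points lie on the closed side of `0` of the hyperplane `f`. -/
def weakOK (χ : List ℕ → SignType) (f : ℕ) : Bool :=
  and (and (Bool.not (testb f 0)) (Bool.not (isZero (χ (elems (flipBit f 0))))))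
    (alls (fun j => Bool.rec (and (validWall f 0 j) (Bool.not (isNeg (rel χ f 0 j)))) true
      (testb f j)) labels)

/-- All points on the hyperplane `f` are vertices of one of the facets with eight vertices. -/
def numberOK (f : ℕ) : Bool :=
  anys (fun s => alls (fun j => Bool.rec (Bool.rec (isPos (rel chi0 f 0 j)) false (testb f j)) true
    (inFacet s j)) labels) (List.range 16)

/-- The bit mask of the set of labels with the property `q`. -/
def maskOf (q : ℕ → Bool) : ℕ :=
  List.rec 0 (fun a _ ih => Bool.rec ih (Nat.lor (Nat.shiftLeft 1 a) ih) (q a)) labels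

/-- A triangulation of `A(0)` that induces the complex `K` has no flip at the circuit `(p, q)`. -/
def circuitOK (K : List ℕ) (p q : ℕ) : Bool :=
  anys (fun k => Bool.rec
    (let C := Nat.lor p q
     let c := Nat.log2 (diffMask C k)
     let a := Nat.log2 (diffMask k C)
     and (and (and (testb p c) (Nat.blt c 17)) (and (Nat.blt a 17) (Bool.not (testb C a))))
      (and (Nat.beq (flipBit (flipBit C c) a) k)
        (anys (fun c' => alls (fun k' => Bool.not (subMask (flipBit (flipBit C c') a) k')) K)
          (elems p))))
    true (subMask p k)) K

/-- Flips are oriented, so both orders of the two sides of a circuit are tested. -/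
def circuitsOK (K : List ℕ) (s m : ℕ) : Bool :=
  let p := maskOf fun j => isPos (pointSign s m j)
  let q := maskOf fun j => isNeg (pointSign s m j)
  and (circuitOK K p q) (circuitOK K q p)

end

set_option maxRecDepth 100000

theorem weakOK_inner : alls (weakOK chi0) innerFacets = true := by decide +kernel

theorem numberOK_inner : alls numberOK innerFacets = true := by decide +kernel

theorem circuitsOK_all : alls (fun s => alls (circuitsOK (stableFacets ++ innerFacets) s)
    (List.range 4)) (List.range 16) = true := by decide +kernel

theorem cellsOK_cone : cellsOK chi0 (stableFacets ++ innerFacets)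
    (cone (stableFacets ++ innerFacets)) = true := by decide +kernel

theorem others_cone : others (cone (stableFacets ++ innerFacets)) 911 910 = [] := by
  decide +kernel

theorem testb_maskOf (q : ℕ → Bool) (i : Fin 17) : testb (maskOf q) i = q i := by
  have key : ∀ l : List ℕ, ∀ i : ℕ, Nat.testBit
      (List.rec 0 (fun a _ ih => Bool.rec ih (Nat.lor (Nat.shiftLeft 1 a) ih) (q a)) l) i =
      (decide (i ∈ l) && q i) := by
    intro l i
    induction l with
    | nil => simp
    | cons a l ih =>
      simp only
      cases hq : q a
      · rw [ih]
        by_cases hia : i = a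
        · simp [hia, hq]
        · simp [hia]
      · change Nat.testBit ((1 <<< a) ||| _) i = _
        rw [Nat.testBit_or, ih, Nat.one_shiftLeft, Nat.testBit_two_pow]
        by_cases hia : i = a
        · simp [hia, hq]
        · simp [hia, Ne.symm hia]
  rw [testb_eq]
  refine (key labels i).trans ?_
  simp [mem_labels.2 i.2]

theorem bits_lor (p q : ℕ) : bits (Nat.lor p q) = bits p ∪ bits q := by
  ext i
  rw [mem_bits, Finset.mem_union, mem_bits, mem_bits, testb_eq, testb_eq, testb_eq]
  change (p ||| q).testBit i = true ↔ _
  rw [Nat.testBit_or, Bool.or_eq_true]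

/-- Either `P` lies in an element of `K`, which is impossible because `Q` is a face as well. Or `K`
contains `{a} ∪ C \ {c}` for some `c ∈ P` and `a ∉ C`, where `C = P ∪ Q`; equality of links then
makes `{a} ∪ C \ {c'}` a boundary face for all `c' ∈ P`, but for some `c'` it is not in `K`. -/
theorem circuitOK_false {A : Fin 17 → Fin 6 → ℝ} {K : List ℕ}
    (hK : ∀ σ ∈ family K, IsSupporting A σ) {T : Finset (Finset (Fin 17))}
    (hT : IsTriangulation A T) (hTK : InducesOnBoundary A T (family K)) {p q : ℕ}
    {L : Finset (Finset (Fin 17))} (hS : SupportsFlip A T (bits p) (bits q) L)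
    (hok : circuitOK K p q = true) : False := by
  obtain ⟨k, hk, h⟩ := anys_iff.1 hok
  have hkK := bits_mem_family hk
  obtain ⟨hcard, ⟨τ, hτ, hkτ⟩, -⟩ := (hTK _).1 hkK
  replace h := bool_rec_true.1 h
  cases hpk : subMask p k
  · replace h := h hpk
    simp only [Bool.and_eq_true, Nat.blt_eq, Nat.beq_eq, Bool.not_eq_true'] at h
    obtain ⟨⟨⟨hpc, hc⟩, ha, hCa⟩, hk', h'⟩ := h
    set c : Fin 17 := ⟨_, hc⟩ with hcdef
    set a : Fin 17 := ⟨_, ha⟩ with hadef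
    change testb p c = true at hpc
    change testb (Nat.lor p q) a = false at hCa
    change flipBit (flipBit (Nat.lor p q) c) a = k at hk'
    obtain ⟨c', hc', h2⟩ := anys_iff.1 h'
    obtain ⟨hc17, hpc'⟩ := mem_elems.1 hc'
    obtain ⟨c', rfl⟩ : ∃ e : Fin 17, (e : ℕ) = c' := ⟨⟨c', hc17⟩, rfl⟩
    change alls (fun k' => Bool.not (subMask (flipBit (flipBit (Nat.lor p q) c') a) k')) K = true
      at h2
    have hC : bits (Nat.lor p q) = bits p ∪ bits q := bits_lor p q
    have haC : a ∉ bits p ∪ bits q := by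
      rw [← hC, mem_bits, hCa]
      exact Bool.noConfusion
    have hflip : ∀ e : Fin 17, testb p e = true →
        bits (flipBit (flipBit (Nat.lor p q) e) a) = insert a ((bits p ∪ bits q).erase e) := by
      intro e he
      have heC : testb (Nat.lor p q) e = true := by
        rw [← mem_bits, hC]
        exact Finset.mem_union_left _ (mem_bits.2 he)
      have h1 : bits (flipBit (Nat.lor p q) e) = (bits p ∪ bits q).erase e := by
        rw [bits_flipBit_of_mem heC, hC]
      have h2 : testb (flipBit (Nat.lor p q) e) a = false := by
        rw [← Bool.not_eq_true, ← mem_bits, h1]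
        exact fun h => haC (Finset.mem_of_mem_erase h)
      rw [bits_flipBit_of_notMem h2, h1]
    have hbk : bits k = insert a ((bits p ∪ bits q).erase c) := by rw [← hk', hflip c hpc]
    have hcP : c ∈ bits p := mem_bits.2 hpc
    have hcP' : c' ∈ bits p := mem_bits.2 hpc'
    have hsub : (bits p ∪ bits q).erase c ⊆ τ := (Finset.subset_insert _ _).trans (hbk ▸ hkτ)
    have hlink : τ \ (bits p ∪ bits q).erase c ∈ L := by
      rw [← hS.link_eq c hcP, mem_link, Finset.sdiff_union_of_subset hsub]
      exact ⟨Finset.sdiff_disjoint, hτ⟩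
    have hnew := hS.union_mem hlink hcP'
    have hzero : ∀ i ∈ bits p ∪ bits q, height A (bits k) (A i) = 0 := by
      have hQ : ∀ i ∈ bits q, height A (bits k) (A i) = 0 := fun i hi =>
        (hK _ hkK).height_of_mem (by
          rw [hbk]
          exact Finset.mem_insert_of_mem (hS.subset_erase_right hcP hi))
      intro i hi
      rcases Finset.mem_union.1 hi with h | h
      · exact hS.circuit.eq_zero_of_nonneg (hK _ hkK).nonneg hQ i h
      · exact hQ i h
    have hmem : insert a ((bits p ∪ bits q).erase c') ∈ family K := by
      refine (hTK _).2 ⟨?_, ⟨_, hnew, ?_⟩, (hK _ hkK).hull_subset_frontier ?_⟩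
      · have h3 := hcard
        rw [hbk, Finset.card_insert_of_notMem fun h => haC (Finset.mem_of_mem_erase h),
          Finset.card_erase_of_mem (Finset.mem_union_left _ hcP)] at h3
        rw [Finset.card_insert_of_notMem fun h => haC (Finset.mem_of_mem_erase h),
          Finset.card_erase_of_mem (Finset.mem_union_left _ hcP'), h3]
      · refine Finset.insert_subset (Finset.mem_union_left _ (Finset.mem_sdiff.2
          ⟨hkτ (hbk ▸ Finset.mem_insert_self _ _), fun h => haC (Finset.mem_of_mem_erase h)⟩))
          Finset.subset_union_right
      · intro i hi
        rcases Finset.mem_insert.1 hi with rfl | hi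
        · exact (hK _ hkK).height_of_mem (hbk ▸ Finset.mem_insert_self _ _)
        · exact hzero i (Finset.mem_of_mem_erase hi)
    obtain ⟨k', hk'K, he⟩ := mem_family.1 hmem
    have := alls_iff.1 h2 k' hk'K
    rw [Bool.not_eq_true', ← Bool.not_eq_true] at this
    refine this (subMask_iff.2 ?_)
    rw [hflip c' hpc', he]
  · obtain ⟨c, hc⟩ := hS.circuit.nonempty
    obtain ⟨τ', hτ', hsub⟩ := hS.exists_mem hc
    exact hS.circuit.not_faces hT hτ hτ' ((subMask_iff.1 hpk).trans hkτ)
      ((hS.subset_erase_right hc).trans hsub)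

/-! ### The frozen boundary -/

theorem realizes_chi0_config : Realizes chi0 (config 0) := fun I _ => sign_orientDet_config_zero I

theorem isSupporting_of_weakOK {f : ℕ} (hf : weakOK chi0 f = true) :
    IsSupporting (config 0) (bits f) ∧ ∀ j : Fin 17, j ∉ bits f →
      SignType.sign (height (config 0) (bits f) (config 0 j)) = rel chi0 f 0 j := by
  simp only [weakOK, Bool.and_eq_true, Bool.not_eq_true', alls_iff] at hf
  obtain ⟨⟨h0, hχ⟩, hj⟩ := hf
  have hf' : ∀ {a : Fin 17}, a ∉ bits f → testb f a = false := fun h => by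
    rwa [mem_bits, Bool.not_eq_true] at h
  have h0m : (0 : Fin 17) ∉ bits f := by
    rw [mem_bits]
    simpa using h0
  have hχ' : chi0 (elems (flipBit f (0 : Fin 17))) ≠ 0 := fun h => by
    have : isZero (chi0 (elems (flipBit f 0))) = true := isZero_iff.2 h
    rw [hχ] at this
    exact Bool.noConfusion this
  have key : ∀ j : Fin 17, j ∉ bits f → (IsSimplex (config 0) (insert 0 (bits f)) ∧
      SignType.sign (height (config 0) (bits f) (config 0 j)) = rel chi0 f 0 j) ∧
      rel chi0 f 0 j ≠ -1 := by
    intro j hjf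
    have h := bool_rec_true.1 (hj j (mem_labels.2 j.2)) (hf' hjf)
    rw [Bool.and_eq_true, Bool.not_eq_true'] at h
    refine ⟨sign_coord_of_sign_orientDet (a := 0) (b := j) h.1 (fun v _ I hI => ?_) hχ', fun hr => ?_⟩
    · rw [← hI]
      exact sign_orientDet_config_zero I
    · rw [hr] at h
      exact Bool.noConfusion h.2
  have hs := (key 0 h0m).1.1
  refine ⟨⟨hs, h0m, fun j => ?_⟩, fun j hj => (key j hj).1.2⟩
  by_cases hjf : j ∈ bits f
  · exact (height_of_mem hs h0m hjf).ge
  · obtain ⟨⟨-, h2⟩, h3⟩ := key j hjf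
    by_contra hneg
    push Not at hneg
    rw [sign_neg hneg] at h2
    exact h3 h2.symm

theorem isSupporting_frozenBoundary {σ : Finset (Fin 17)} (hσ : σ ∈ frozenBoundary) :
    IsSupporting (config 0) σ := by
  obtain ⟨f, hf, rfl⟩ := mem_family.1 hσ
  rcases List.mem_append.1 hf with h | h
  · exact (realizes_chi0_config.isFacet (alls_iff.1 facetOK_stable f h)).toIsSupporting
  · exact (isSupporting_of_weakOK (alls_iff.1 weakOK_inner f h)).1

theorem family_cone (l : List ℕ) : family (cone l) = (family l).image (insert 0) := by
  ext σ
  rw [mem_family, Finset.mem_image]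
  constructor
  · rintro ⟨c, hc, rfl⟩
    obtain ⟨f, hf, rfl⟩ := mem_cone.1 hc
    exact ⟨bits f, bits_mem_family hf, (bits_lor_one f).symm⟩
  · rintro ⟨τ, hτ, rfl⟩
    obtain ⟨f, hf, rfl⟩ := mem_family.1 hτ
    exact ⟨_, mem_cone.2 ⟨f, hf, rfl⟩, bits_lor_one f⟩

theorem isTriangulation_cone_frozenBoundary :
    IsTriangulation (config 0) (frozenBoundary.image (insert 0)) := by
  rw [frozenBoundary, ← family_cone]
  have h : flipBit 911 (0 : Fin 17) = 910 := by decide +kernel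
  refine realizes_chi0_config.isTriangulation (fun c hc => ?_)
    (fun f hf => isSupporting_frozenBoundary (bits_mem_family hf)) cellsOK_cone
    ⟨911, mem_cone.2 ⟨910, by decide, rfl⟩, 0, mem_bits.2 (by decide), ?_, ?_⟩
  · obtain ⟨f, hf, rfl⟩ := mem_cone.1 hc
    rw [bits_lor_one]
    exact (isSupporting_frozenBoundary (bits_mem_family hf)).isSimplex
  · rw [h, others_cone]
  · rw [h]
    exact realizes_chi0_config.isFacet (alls_iff.1 facetOK_stable 910 (by decide))

theorem config_zero_symm (i : Fin 17) : ∃ j, config 0 j = -config 0 i := by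
  -- The reflection in the origin exchanges `a_i^±` with `a_{i+4}^∓`.
  refine ⟨(![0, 13, 14, 15, 16, 9, 10, 11, 12, 5, 6, 7, 8, 1, 2, 3, 4] : Fin 17 → Fin 17) i, ?_⟩
  ext k
  fin_cases i <;> fin_cases k <;> simp [config, coords]

theorem isFrozenBoundary_frozenBoundary : IsFrozenBoundary (config 0) frozenBoundary := by
  have hK := fun σ => isSupporting_frozenBoundary (σ := σ)
  have hT := isTriangulation_cone_frozenBoundary
  have h0 : config 0 0 ∈ interior (convexHull ℝ (Set.range (config 0))) := by
    refine apply_zero_mem_interior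
      (isSupporting_frozenBoundary (bits_mem_family (c := 910) (by decide))).isSimplex ?_
      config_zero_symm
    ext k
    fin_cases k <;> simp [config, coords]
  have hB := isBoundaryTriangulation_of_cone hK hT h0
  refine ⟨hB, ⟨_, hT, inducesOnBoundary_of_cone hK h0⟩, ?_⟩
  rintro T T' hT' hTK hflip
  obtain ⟨P, Q, L, hS, rfl⟩ := isFlip_iff.1 hflip
  refine inducesOnBoundary_flipped hK hB hTK hS fun κ hκ hzero => ?_
  obtain ⟨f, hf, rfl⟩ := mem_family.1 hκ
  rcases List.mem_append.1 hf with h | h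
  · have hfac := realizes_chi0_config.isFacet (alls_iff.1 facetOK_stable f h)
    obtain ⟨-, ⟨τ, hτ, hsub⟩, -⟩ := (hTK _).1 hκ
    refine hS.circuit.dependent ((hT'.indep τ hτ).mono fun i hi => hsub ?_)
    by_contra hif
    exact (hfac.pos i hif).ne' (hzero i hi)
  · obtain ⟨-, hsign⟩ := isSupporting_of_weakOK (alls_iff.1 weakOK_inner f h)
    obtain ⟨s, hs, hin⟩ := anys_iff.1 (alls_iff.1 numberOK_inner f h)
    -- Points outside the eight-vertex facet number `s` have positive height over `f`, whereas the
    -- circuit has height zero.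
    have hface : ∀ j ∈ P ∪ Q, inFacet s j = true := by
      intro j hj
      by_contra hjs
      rw [Bool.not_eq_true] at hjs
      have h1 := bool_rec_true.1 (alls_iff.1 hin j (mem_labels.2 j.2)) hjs
      cases hfj : testb f j
      · rw [hfj] at h1
        have h2 := hsign j (by rw [mem_bits, hfj]; exact Bool.noConfusion)
        rw [hzero j hj, sign_zero, isPos_iff.1 h1] at h2
        exact absurd h2 (by decide)
      · rw [hfj] at h1
        exact Bool.noConfusion h1
    obtain ⟨m, hm, ε, hε, hP, hQ⟩ := hS.circuit.eq_of_inFacet hface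
    have hok := alls_iff.1 (alls_iff.1 circuitsOK_all s hs) m (List.mem_range.2 hm)
    simp only [circuitsOK, Bool.and_eq_true] at hok
    have hpos : bits (maskOf fun j => isPos (pointSign s m j)) =
        Finset.univ.filter fun j : Fin 17 => pointSign s m j = 1 := by
      ext j
      rw [mem_bits, testb_maskOf, isPos_iff]
      simp
    have hneg : bits (maskOf fun j => isNeg (pointSign s m j)) =
        Finset.univ.filter fun j : Fin 17 => pointSign s m j = -1 := by
      ext j
      rw [mem_bits, testb_maskOf, isNeg_iff]
      simp
    have hsplit : ε = 1 ∨ ε = -1 := by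
      revert hε
      cases ε <;> decide
    rcases hsplit with rfl | rfl
    · have e1 : P = bits (maskOf fun j => isPos (pointSign s m j)) := by
        rw [hpos]; ext j; simp [hP]
      have e2 : Q = bits (maskOf fun j => isNeg (pointSign s m j)) := by
        rw [hneg]; ext j; simp [hQ]
      subst e1 e2
      exact circuitOK_false hK hT' hTK hS hok.1
    · have e1 : P = bits (maskOf fun j => isNeg (pointSign s m j)) := by
        rw [hneg]; ext j; simp [hP]
      have e2 : Q = bits (maskOf fun j => isPos (pointSign s m j)) := by
        rw [hpos]; ext j; simp [hQ]
      subst e1 e2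
      exact circuitOK_false hK hT' hTK hS hok.2

end PointConfig

theorem mainTheorem4 :
    ∃ K : Finset (Finset (Fin 17)), PointConfig.IsFrozenBoundary (PointConfig.config 0) K ∧
      ∃ t₀ : ℝ, 0 < t₀ ∧ ∀ t : ℝ, 0 < t → t < t₀ →
        PointConfig.IsSeparatedBy (PointConfig.config t) K ∧
        ∀ A' : Fin 17 → Fin 6 → ℝ,
          PointConfig.IsPerturbation (PointConfig.config t) A' →
          PointConfig.InGeneralPosition A' →
          PointConfig.IsSeparatedBy A' K := by
  refine ⟨PointConfig.frozenBoundary, PointConfig.isFrozenBoundary_frozenBoundary, ?_⟩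
  obtain ⟨t₀, ht₀, h⟩ :=
    mem_nhdsGT_iff_exists_Ioo_subset.1 PointConfig.eventually_realizes_config
  refine ⟨t₀, ht₀, fun t ht htt => ?_⟩
  have hR : PointConfig.Realizes PointConfig.chi (PointConfig.config t) := h ⟨ht, htt⟩
  exact ⟨PointConfig.isSeparatedBy_frozenBoundary hR, fun A' hA' _ =>
    PointConfig.isSeparatedBy_frozenBoundary (hR.of_isPerturbation hA')⟩
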